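/- **Conventions.** All notions below are understood in second order arithmetic: linear orders, functions and sequences are sets of numbers (with the usual coding of pairs and finite sequences), $\mathbb N$ is the internal set of natural numbers, and a linear order is *well founded* if it has no infinite strictly descending sequence $\mathbb N\to X$. A statement is *provable in* $\mathsf{RCA}_0$ if it follows from the axioms of a discretely ordered commutative semiring together with $\Sigma^0_1$-induction and $\Delta^0_1$-comprehension (with parameters); equivalently, if it holds in every model $(M,\mathcal S)$ of $\mathsf{RCA}_0$. Two linear orders are *equimorphic* if each of them embeds into the other. **The Goodstein predilator.** For a linear order $X$, the linear order $G(X)$ consists of the terms $$\sigma=(1+X)^{\gamma_0}\cdot(1+\delta_0)+\dots+(1+X)^{\gamma_{n-1}}\cdot(1+\delta_{n-1}),\qquad \gamma_i\in G(X),\ \delta_i\in X,\ \gamma_0>\dots>\gamma_{n-1}$$ ($n=0$ allowed), which are compared by simultaneous recursion: $\sigma<\tau$ holds iff the sequence of pairs $(\gamma_i',\delta_i')$ of $\tau$ properly extends the sequence of pairs $(\gamma_i,\delta_i)$ of $\sigma$, or at the first index $i$ at which both are defined and differ, $\gamma_i<\gamma_i'$ or ($\gamma_i=\gamma_i'$ and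 $\delta_i<\delta_i'$). The support is $\operatorname{supp}(\sigma)=\bigcup_{i<n}(\operatorname{supp}(\gamma_i)\cup\{\delta_i\})$. For an embedding $f:X\to Y$, $G(f):G(X)\to G(Y)$ replaces every $\delta$ by $f(\delta)$, hereditarily; if $X\subseteq Y$ is a suborder with inclusion $\iota$, we regard $G(X)$ as a suborder of $G(Y)$ via $G(\iota)$. **Termination points.** For $x\in X$ put $X{\restriction}x=\{y\in X\mid y<x\}$. A linear order $X$ with a sequence $(A_x)_{x\in X}$, $A_x\in G(X{\restriction}x)$, is a *$G$-sequence termination point* if 1. for every $x\in X$, $A_x$ is the smallest element of $G(X{\restriction}x)$ that is greater than $A_y$ for all $y<x$; 2. for every $\sigma\in G(X)$ there is $x\in X$ with $\sigma\le A_x$ in $G(X)$. It is *strong* if moreover 3. there is $h:X\to\mathbb N$ such that $h(x)<h(y)$ whenever $x,y\in X$ and $x\in\operatorname{supp}(A_y)$; 4. for every $\sigma\in G(X)$ there is a smallest $x\in X$ such that $y\le x$ for all $y\in\operatorname{supp}(\sigma)$ and $\sigma\le A_x$. **The notation system.** The set of terms $\mathsf{OT}(\vartheta)$, its order, and finite sets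 $E(\sigma)$ are defined by simultaneous recursion. Terms are: $\Omega$; $\vartheta(\sigma)$ for every term $\sigma$; and $\omega^{\gamma_0}+\dots+\omega^{\gamma_{n-1}}$ for terms $\gamma_0\ge\dots\ge\gamma_{n-1}$, where the case that $n=1$ and $\gamma_0$ is $\Omega$ or of the form $\vartheta(\sigma)$ is excluded (the empty sum, $n=0$, is allowed). Put $E(\Omega)=\emptyset$, $E(\vartheta(\sigma))=\{\vartheta(\sigma)\}$, $E(\omega^{\gamma_0}+\dots+\omega^{\gamma_{n-1}})=\bigcup_{i<n}E(\gamma_i)$. The order is given by: * $\Omega<\tau$ iff $\tau=\omega^{\gamma_0}+\dots+\omega^{\gamma_{n-1}}$ with $n>0$ and $\Omega\le\gamma_0$; * $\vartheta(\sigma)<\tau$ iff $\tau=\Omega$; or $\tau=\vartheta(\tau')$ and either $\vartheta(\sigma)\le\rho$ for some $\rho\in E(\tau')$, or $\sigma<\tau'$ and $\rho<\vartheta(\tau')$ for all $\rho\in E(\sigma)$; or $\tau=\omega^{\gamma_0}+\dots+\omega^{\gamma_{n-1}}$ with $n>0$ and $\vartheta(\sigma)\le\gamma_0$; * $\omega^{\gamma_0}+\dots+\omega^{\gamma_{n-1}}<\tau$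 iff $\tau$ is $\Omega$ or of the form $\vartheta(\tau')$ and ($n=0$ or $\gamma_0<\tau$); or $\tau=\omega^{\delta_0}+\dots+\omega^{\delta_{m-1}}$ and $(\gamma_i)_{i<n}$ is lexicographically smaller than $(\delta_i)_{i<m}$ (proper initial segments being smaller). Let $\vartheta(\varepsilon_{\Omega+1})=\{\sigma\in\mathsf{OT}(\vartheta)\mid\sigma<\Omega\}$, a suborder of $\mathsf{OT}(\vartheta)$. **Proposition.** The following is provable in $\mathsf{RCA}_0$. If $X$ with $(A_x)_{x\in X}$ is any strong $G$-sequence termination point, then $X$ is equimorphic to $\vartheta(\varepsilon_{\Omega+1})$. Moreover, there is a well founded $G$-sequence termination point if and only if $\vartheta(\varepsilon_{\Omega+1})$ is well founded. -/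

import Mathlib

namespace InvGoodstein

/-! ### Second order arithmetic and the theory RCA₀

A model of second order arithmetic is a pair `(M, 𝒮)`: a number domain `M` (a semiring with an order)
and a family `𝒮` of subsets of `M` over which the set variables range. -/

/-- Number terms of second order arithmetic. -/
inductive NumTerm : Type
  | var (i : ℕ)
  | zero
  | one
  | add (s t : NumTerm)
  | mul (s t : NumTerm)

/-- Bounded quantifier (i.e. `Δ⁰₀`) formulas with number variables and set variables, both indexed
by `ℕ`. The remaining connectives and the bounded existential quantifier are definable. -/
inductive BddFormula : Type
  | eq (s t : NumTerm)
  | lt (s t : NumTerm)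
  | mem (t : NumTerm) (i : ℕ)
  | not (φ : BddFormula)
  | and (φ ψ : BddFormula)
  | ball (i : ℕ) (t : NumTerm) (φ : BddFormula)

section Semantics

variable {M : Type*} [CommSemiring M] [LinearOrder M]

/-- Value of a number term under the assignment `e`. -/
def NumTerm.val (e : ℕ → M) : NumTerm → M
  | .var i => e i
  | .zero => 0
  | .one => 1
  | .add s t => s.val e + t.val e
  | .mul s t => s.val e * t.val e

/-- Truth of a bounded formula, under the assignments `e` (numbers) and `V` (sets). -/
def BddFormula.Holds (V : ℕ → Set M) : (ℕ → M) → BddFormula → Prop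
  | e, .eq s t => s.val e = t.val e
  | e, .lt s t => s.val e < t.val e
  | e, .mem t i => t.val e ∈ V i
  | e, .not φ => ¬ φ.Holds V e
  | e, .and φ ψ => φ.Holds V e ∧ ψ.Holds V e
  | e, .ball i t φ => ∀ a < t.val e, φ.Holds V (Function.update e i a)

/-- `θ(a, b, …)`: the variable `0` is interpreted by `a`, the variable `1` by `b`, and all other
variables are parameters. -/
def BddFormula.At (θ : BddFormula) (V : ℕ → Set M) (e : ℕ → M) (a b : M) : Prop :=
  θ.Holds V (Function.update (Function.update e 0 a) 1 b)

/-- `(M, 𝒮)` is a model of `RCA₀`. The first order axioms of a discretely ordered commutative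
semiring (`PA⁻`) are expressed by the type classes together with `discrete`; the second order part
consists of `Σ⁰₁`-induction and `Δ⁰₁`-comprehension, with number and set parameters. -/
structure ModelsRCA0 [IsStrictOrderedRing M] [CanonicallyOrderedAdd M] (𝒮 : Set (Set M)) : Prop where
  nonempty : 𝒮.Nonempty
  discrete : ∀ a : M, 0 < a → 1 ≤ a
  sigma_induction : ∀ (θ : BddFormula) (V : ℕ → Set M) (e : ℕ → M), (∀ i, V i ∈ 𝒮) →
    (∃ b, θ.At V e 0 b) → (∀ a, (∃ b, θ.At V e a b) → ∃ b, θ.At V e (a + 1) b) →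
    ∀ a, ∃ b, θ.At V e a b
  delta_comprehension : ∀ (θ ψ : BddFormula) (V : ℕ → Set M) (e : ℕ → M), (∀ i, V i ∈ 𝒮) →
    (∀ a, (∃ b, θ.At V e a b) ↔ ∀ b, ψ.At V e a b) → {a | ∃ b, θ.At V e a b} ∈ 𝒮

end Semantics

section Internal

variable {M : Type*} [CommSemiring M]

/-! ### Coding inside a model -/

/-- The usual code of a pair of numbers in second order arithmetic. -/
def pair (a b : M) : M := (a + b) * (a + b) + a

/-- Code of the empty finite sequence. -/
def nil : M := 0

/-- Code of the finite sequence with first entry `a` and remaining entries `l`. -/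
def cons (a l : M) : M := pair a l + 1

/-- The binary relation `R` is (coded by) a set of the model. -/
def CodedRel (𝒮 : Set (Set M)) (R : M → M → Prop) : Prop :=
  {c | ∃ a b, c = pair a b ∧ R a b} ∈ 𝒮

/-- The function `f` with domain `D` is (coded by) a set of the model; only values on `D` matter. -/
def CodedFun (𝒮 : Set (Set M)) (D : Set M) (f : M → M) : Prop :=
  {c | ∃ a ∈ D, c = pair a (f a)} ∈ 𝒮

/-- A set of numbers with a binary relation, thought of as a strict order; only the restriction of
`lt` to `dom` matters. -/
structure Ord (M : Type*) where
  dom : Set M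
  lt : M → M → Prop

/-- The non-strict order. -/
def Ord.le (X : Ord M) (a b : M) : Prop := a = b ∨ X.lt a b

/-- The order exists in the model. -/
def Ord.Coded (𝒮 : Set (Set M)) (X : Ord M) : Prop := X.dom ∈ 𝒮 ∧ CodedRel 𝒮 X.lt

/-- The order is linear. -/
structure Ord.IsLinear (X : Ord M) : Prop where
  irrefl : ∀ a ∈ X.dom, ¬ X.lt a a
  trans : ∀ a ∈ X.dom, ∀ b ∈ X.dom, ∀ c ∈ X.dom, X.lt a b → X.lt b c → X.lt a c
  trichotomy : ∀ a ∈ X.dom, ∀ b ∈ X.dom, X.lt a b ∨ a = b ∨ X.lt b a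

/-- The suborder `X ↾ x` of all elements strictly below `x`. -/
def Ord.below (X : Ord M) (x : M) : Ord M where
  dom := {y | y ∈ X.dom ∧ X.lt y x}
  lt := X.lt

/-- The order is well founded in the sense of the model: no sequence of the model, indexed by all
numbers of the model, is strictly descending. -/
def Ord.WellFounded (𝒮 : Set (Set M)) (X : Ord M) : Prop :=
  ¬ ∃ f : M → M, CodedFun 𝒮 Set.univ f ∧ (∀ n, f n ∈ X.dom) ∧ ∀ n, X.lt (f (n + 1)) (f n)

/-- The model contains an embedding of `X` into `Y`. -/
def Ord.Embeds (𝒮 : Set (Set M)) (X Y : Ord M) : Prop :=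
  ∃ f : M → M, CodedFun 𝒮 X.dom f ∧ (∀ a ∈ X.dom, f a ∈ Y.dom) ∧
    ∀ a ∈ X.dom, ∀ b ∈ X.dom, X.lt a b ↔ Y.lt (f a) (f b)

/-- In the model, each order embeds into the other. -/
def Ord.Equimorphic (𝒮 : Set (Set M)) (X Y : Ord M) : Prop :=
  X.Embeds 𝒮 Y ∧ Y.Embeds 𝒮 X

/-! ### The Goodstein predilator

The term `(1+X)^γ₀·(1+δ₀) + ⋯ + (1+X)^γₙ₋₁·(1+δₙ₋₁)` is coded by the finite sequence of the pairs
`(γᵢ, δᵢ)`. Objects defined by recursion on codes are described by their recursion equations, which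
determine them uniquely in every model of `RCA₀`, and which have solutions there. -/

/-- The code of the term `(1+X)^γ·(1+δ) + r`. -/
def gcons (γ δ r : M) : M := cons (pair γ δ) r

/-- The recursive definition of the order `G(X)`. -/
structure IsGoodstein (X G : Ord M) : Prop where
  mem_iff : ∀ s, s ∈ G.dom ↔ s = nil ∨ ∃ γ δ r, s = gcons γ δ r ∧ γ ∈ G.dom ∧ δ ∈ X.dom ∧
    r ∈ G.dom ∧ ∀ γ' δ' r', r = gcons γ' δ' r' → G.lt γ' γ
  lt_iff : ∀ s t, G.lt s t ↔ s ∈ G.dom ∧ t ∈ G.dom ∧ ((s = nil ∧ t ≠ nil) ∨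
    ∃ γ δ r γ' δ' r', s = gcons γ δ r ∧ t = gcons γ' δ' r' ∧
      (G.lt γ γ' ∨ (γ = γ' ∧ (X.lt δ δ' ∨ (δ = δ' ∧ G.lt r r')))))

/-- The order `G(X)`, as computed in the model. -/
def goodstein (𝒮 : Set (Set M)) (X : Ord M) : Ord M where
  dom := {s | ∃ G : Ord M, G.Coded 𝒮 ∧ IsGoodstein X G ∧ s ∈ G.dom}
  lt s t := ∃ G : Ord M, G.Coded 𝒮 ∧ IsGoodstein X G ∧ G.lt s t

/-- The recursive definition of the action `F = G(f)` of the Goodstein predilator on a map `f`. -/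
def IsGoodsteinMap (f F : M → M) : Prop :=
  F nil = nil ∧ ∀ γ δ r, F (gcons γ δ r) = gcons (F γ) (f δ) (F r)

/-- If `f` is an inclusion of suborders, then `G(f)` does not change codes of terms. This is why
inclusion maps `G(ι)` are not written below. -/
theorem isGoodsteinMap_inclusion : IsGoodsteinMap (fun δ : M => δ) (fun s : M => s) :=
  ⟨rfl, fun _ _ _ => rfl⟩

/-- The recursive definition of the relation `x ∈ supp(s)`. -/
def IsSupp (P : M → M → Prop) : Prop :=
  ∀ x s, P x s ↔ ∃ γ δ r, s = gcons γ δ r ∧ (P x γ ∨ x = δ ∨ P x r)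

/-- The support of a Goodstein term, as computed in the model. -/
def supp (𝒮 : Set (Set M)) (s : M) : Set M := {x | ∃ P, CodedRel 𝒮 P ∧ IsSupp P ∧ P x s}

/-- `X` with `(A x)_{x ∈ X}` is a `G`-sequence termination point, in the sense of the model. -/
structure IsTerminationPoint (𝒮 : Set (Set M)) (X : Ord M) (A : M → M) : Prop where
  coded : X.Coded 𝒮
  linear : X.IsLinear
  coded_seq : CodedFun 𝒮 X.dom A
  mem : ∀ x ∈ X.dom, A x ∈ (goodstein 𝒮 (X.below x)).dom
  above : ∀ x ∈ X.dom, ∀ y ∈ (X.below x).dom, (goodstein 𝒮 (X.below x)).lt (A y) (A x)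
  smallest : ∀ x ∈ X.dom, ∀ σ ∈ (goodstein 𝒮 (X.below x)).dom,
    (∀ y ∈ (X.below x).dom, (goodstein 𝒮 (X.below x)).lt (A y) σ) →
      (goodstein 𝒮 (X.below x)).le (A x) σ
  cofinal : ∀ σ ∈ (goodstein 𝒮 X).dom, ∃ x ∈ X.dom, (goodstein 𝒮 X).le σ (A x)

/-- A termination point is regular if the relation `x ∈ supp(A y)` admits a height function. -/
structure IsRegularTerminationPoint (𝒮 : Set (Set M)) [LT M] (X : Ord M) (A : M → M) : Prop
    extends IsTerminationPoint 𝒮 X A where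
  height : ∃ h : M → M, CodedFun 𝒮 X.dom h ∧
    ∀ x ∈ X.dom, ∀ y ∈ X.dom, x ∈ supp 𝒮 (A y) → h x < h y

/-- The condition `supp(σ) ≤_fin x` and `σ ≤ A x`. -/
def Dominates (𝒮 : Set (Set M)) (X : Ord M) (A : M → M) (x σ : M) : Prop :=
  (∀ y ∈ supp 𝒮 σ, X.le y x) ∧ (goodstein 𝒮 X).le σ (A x)

/-- Strong termination points. -/
structure IsStrongTerminationPoint (𝒮 : Set (Set M)) [LT M] (X : Ord M) (A : M → M) : Prop
    extends IsRegularTerminationPoint 𝒮 X A where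
  least : ∀ σ ∈ (goodstein 𝒮 X).dom, ∃ x ∈ X.dom, Dominates 𝒮 X A x σ ∧
    ∀ z ∈ X.dom, Dominates 𝒮 X A z σ → X.le x z

/-! ### The Rathjen–Weiermann notation system -/

/-- The code of `Ω`. -/
def tOmega : M := pair 0 0

/-- The code of `ϑ(s)`. -/
def tTheta (s : M) : M := pair 1 s

/-- The code of the sum `ω^γ₀ + ⋯ + ω^γₙ₋₁`, where `l` codes the sequence of the exponents `γᵢ`. -/
def tSum (l : M) : M := pair 2 l

/-- The objects defined by simultaneous recursion: the terms of `OT(ϑ)`, the weakly descending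
finite sequences of terms, the orders on terms and (lexicographically) on these sequences, and the
relations `x ∈ E(s)` for terms `s` and `x ∈ E(γ₀) ∪ ⋯ ∪ E(γₙ₋₁)` for sequences. -/
structure OTData (M : Type*) where
  term : Set M
  seq : Set M
  lt : M → M → Prop
  seqLt : M → M → Prop
  memE : M → M → Prop
  seqMemE : M → M → Prop

/-- The non-strict order on terms. -/
def OTData.le (O : OTData M) (s t : M) : Prop := s = t ∨ O.lt s t

/-- All the objects exist in the model. -/
structure OTData.Coded (𝒮 : Set (Set M)) (O : OTData M) : Prop where
  term : O.term ∈ 𝒮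
  seq : O.seq ∈ 𝒮
  lt : CodedRel 𝒮 O.lt
  seqLt : CodedRel 𝒮 O.seqLt
  memE : CodedRel 𝒮 O.memE
  seqMemE : CodedRel 𝒮 O.seqMemE

/-- `Ω < t`. -/
def OTData.OmegaLt (O : OTData M) (t : M) : Prop :=
  ∃ γ l, t = tSum (cons γ l) ∧ O.le tOmega γ

/-- `ϑ(σ) < t`. -/
def OTData.ThetaLt (O : OTData M) (σ t : M) : Prop :=
  t = tOmega ∨
  (∃ τ, t = tTheta τ ∧
    ((∃ x, O.memE x τ ∧ O.le (tTheta σ) x) ∨ (O.lt σ τ ∧ ∀ x, O.memE x σ → O.lt x t))) ∨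
  (∃ γ l, t = tSum (cons γ l) ∧ O.le (tTheta σ) γ)

/-- `ω^γ₀ + ⋯ + ω^γₙ₋₁ < t`, for the sequence `k` of the `γᵢ`. The empty sum is below all other
terms. -/
def OTData.SumLt (O : OTData M) (k t : M) : Prop :=
  (t = tOmega ∧ ∀ γ l, k = cons γ l → O.lt γ tOmega) ∨
  ((∃ τ, t = tTheta τ) ∧ ∀ γ l, k = cons γ l → O.lt γ t) ∨
  (∃ m, t = tSum m ∧ O.seqLt k m)

/-- The simultaneous recursive definition of `OT(ϑ)`. -/
structure IsOT (O : OTData M) : Prop where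
  term_iff : ∀ s, s ∈ O.term ↔ s = tOmega ∨ (∃ σ ∈ O.term, s = tTheta σ) ∨
    ∃ l ∈ O.seq, s = tSum l ∧
      ∀ γ, l = cons γ nil → ¬ (γ = tOmega ∨ ∃ σ ∈ O.term, γ = tTheta σ)
  seq_iff : ∀ l, l ∈ O.seq ↔ l = nil ∨ ∃ γ k, l = cons γ k ∧ γ ∈ O.term ∧ k ∈ O.seq ∧
    ∀ γ' k', k = cons γ' k' → O.le γ' γ
  lt_iff : ∀ s t, O.lt s t ↔ s ∈ O.term ∧ t ∈ O.term ∧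
    ((s = tOmega ∧ O.OmegaLt t) ∨ (∃ σ, s = tTheta σ ∧ O.ThetaLt σ t) ∨
      (∃ k, s = tSum k ∧ O.SumLt k t))
  seqLt_iff : ∀ k l, O.seqLt k l ↔ k ∈ O.seq ∧ l ∈ O.seq ∧ ((k = nil ∧ l ≠ nil) ∨
    ∃ γ k' δ l', k = cons γ k' ∧ l = cons δ l' ∧ (O.lt γ δ ∨ (γ = δ ∧ O.seqLt k' l')))
  memE_iff : ∀ x s, O.memE x s ↔ s ∈ O.term ∧
    ((∃ σ, s = tTheta σ ∧ x = s) ∨ ∃ l, s = tSum l ∧ O.seqMemE x l)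
  seqMemE_iff : ∀ x l, O.seqMemE x l ↔ l ∈ O.seq ∧
    ∃ γ k, l = cons γ k ∧ (O.memE x γ ∨ O.seqMemE x k)

/-- The order `ϑ(ε_{Ω+1})`, i.e. the suborder of all terms below `Ω`, as computed in the model. -/
def bachmannHoward (𝒮 : Set (Set M)) : Ord M where
  dom := {s | ∃ O : OTData M, O.Coded 𝒮 ∧ IsOT O ∧ O.lt s tOmega}
  lt s t := ∃ O : OTData M, O.Coded 𝒮 ∧ IsOT O ∧ O.lt s t

end Internal

end InvGoodstein

namespace InvGoodstein

/-! Everything is compared with one explicit order T, called `canonical`. Its elements are Goodstein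
terms x whose coefficients are hereditarily elements of T and whose support lies below x in the
hereditary lexicographic order `tlt`. Dropping the condition on the support of the outermost term
yields the set `GT`, which is exactly G(T). Membership x ∈ T then says x ∈ G(T↾x), and T with A_x =
x is a termination point (`canonical_isTerminationPoint`). It is regular, because elements of the
support have smaller codes.

Three embeddings carry the proof.

A regular termination point X embeds into the notation system (`embeds_bachmannHoward`) by f(x) =
ϑ(Λ(A_x)), where Λ sends the term with exponents γ_i and coefficients δ_i to the sum of the
ω^(ω^Λ(γ_i) + ω^f(δ_i)), followed by Ω + 1. The map Λ preserves order, and E(Λ(A_x)) consists of the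
f(z) with z ∈ supp(A_x). These z are below x, so induction along the height function gives exactly
the conditions of the second clause for ϑ(σ) < ϑ(τ).

The notation system embeds into T (`bachmannHoward_embeds_canonical`). The role of ϑ is played by
`collapse`: for an exponent b and m ∈ T, keep the part of m with exponents above b and append
(1+X)^b·(1+m). The result exceeds m, and it increases with b as long as the old m stays below the
new value. Interpreting Ω as (1+X)^1 and ϑ(σ) by a collapse at a double power with exponent σ*,
where m bounds the values of E(σ), turns both clauses for ϑ into properties of `collapse`.

T embeds into every strong termination point X (`canonical_embeds`) by a map f with A_{f(x)} =
G(f)(x). The point f(x) is the least one that dominates G(f)(x), which exists by the strength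
condition; minimality of A at this point forces equality.

For the equivalence, a well founded termination point is strong (`IsTerminationPoint.isStrong`), so
the notation system embeds into it and is well founded. Conversely T embeds into the notation system
and inherits its well foundedness.

All recursions and inductions have to be available in RCA₀. For this purpose `Rec` expresses that a
function or relation on codes is a set of the model, and `exists_course_of_values` provides
recursion along the numbers of the model. -/

set_option linter.unusedSectionVars false

/-! ### Discreteness and the pairing polynomial in an ordered semiring. -/

section Arithmetic

/-- Discretely ordered semirings. -/
class DiscreteNumbers (M : Type*) [CommSemiring M] [LinearOrder M] : Prop where
  one_le : ∀ a : M, 0 < a → 1 ≤ a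

variable {M : Type*} [CommSemiring M] [LinearOrder M] [IsStrictOrderedRing M]
    [CanonicallyOrderedAdd M]

theorem num_nonneg (a : M) : 0 ≤ a := zero_le

variable [DiscreteNumbers M]

theorem add_one_le_of_lt {a b : M} (h : a < b) : a + 1 ≤ b := by
  obtain ⟨c, rfl⟩ := le_iff_exists_add.1 h.le
  have : 0 < c := by
    rcases eq_or_lt_of_le (num_nonneg c) with h0 | h0
    · rw [← h0] at h; simp at h
    · exact h0
  have := DiscreteNumbers.one_le c this
  grind

theorem lt_add_one_iff' {a b : M} : a < b + 1 ↔ a ≤ b := by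
  constructor
  · intro h
    by_contra! h'
    have := add_one_le_of_lt h'
    grind
  · intro h
    have := zero_lt_one (α := M)
    grind

theorem exists_eq_add_one {a : M} (h : a ≠ 0) : ∃ b, a = b + 1 := by
  have h1 : 1 ≤ a := DiscreteNumbers.one_le a (lt_of_le_of_ne (num_nonneg a) (Ne.symm h))
  obtain ⟨c, rfl⟩ := le_iff_exists_add.1 h1
  exact ⟨c, add_comm _ _⟩

theorem le_mul_self' (a : M) : a ≤ a * a := by
  by_cases h : a = 0
  · simp [h]
  · obtain ⟨b, rfl⟩ := exists_eq_add_one h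
    have := num_nonneg (b * b)
    have h2 := num_nonneg b
    have : (b + 1) * (b + 1) = b * b + b + b + 1 := by ring
    generalize (b + 1) * (b + 1) = x at *
    generalize b * b = y at *
    grind

/-- The code of (a, b) lies between (a+b)² and (a+b+1)², so codes are ordered by sums first. This
yields injectivity, and it lets recursion on pairs use the sum as its measure. -/
theorem pair_lt_pair {a b c d : M} (h : a + b < c + d) : pair a b < pair c d := by
  have h1 := add_one_le_of_lt h
  have h2 : (a + b + 1) * (a + b + 1) ≤ (c + d) * (c + d) := by gcongr
  have h3 : (a + b + 1) * (a + b + 1) = (a + b) * (a + b) + (a + b) + (a + b) + 1 := by ring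
  have := num_nonneg b
  have := num_nonneg a
  have := num_nonneg c
  have := zero_lt_one (α := M)
  unfold pair
  generalize (a + b) * (a + b) = x at *
  generalize (c + d) * (c + d) = y at *
  generalize (a + b + 1) * (a + b + 1) = z at *
  grind

theorem pair_inj {a b c d : M} : pair a b = pair c d ↔ a = c ∧ b = d := by
  constructor
  · intro h
    rcases lt_trichotomy (a + b) (c + d) with h1 | h1 | h1
    · exact absurd h (pair_lt_pair h1).ne
    · unfold pair at h
      rw [h1] at h
      have h2 : a = c := add_left_cancel h
      subst h2
      exact ⟨rfl, add_left_cancel h1⟩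
    · exact absurd h (pair_lt_pair h1).ne'
  · rintro ⟨rfl, rfl⟩; rfl

theorem le_pair_left (a b : M) : a ≤ pair a b := le_add_self

theorem le_pair_right (a b : M) : b ≤ pair a b := by
  have h1 := le_mul_self' (a + b)
  have := num_nonneg a
  unfold pair
  generalize (a + b) * (a + b) = x at *
  grind

theorem add_le_pair (a b : M) : a + b ≤ pair a b :=
  (le_mul_self' (a + b)).trans le_self_add

theorem lt_pair_of_pos {a : M} (b : M) (h : 0 < a) : b < pair a b := by
  have := add_le_pair a b
  grind

open Classical in
/-- The first component of a coded pair. -/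
noncomputable def unpairL (c : M) : M := if h : ∃ a b, c = pair a b then h.choose else 0

open Classical in
/-- The second component of a coded pair. -/
noncomputable def unpairR (c : M) : M := if h : ∃ a b, c = pair a b then h.choose_spec.choose else 0

@[simp] theorem unpairL_pair (a b : M) : unpairL (pair a b) = a := by
  have h : ∃ a' b', pair a b = pair a' b' := ⟨a, b, rfl⟩
  unfold unpairL
  rw [dif_pos h]
  exact ((pair_inj.1 h.choose_spec.choose_spec).1).symm

@[simp] theorem unpairR_pair (a b : M) : unpairR (pair a b) = b := by
  have h : ∃ a' b', pair a b = pair a' b' := ⟨a, b, rfl⟩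
  unfold unpairR
  rw [dif_pos h]
  exact ((pair_inj.1 h.choose_spec.choose_spec).2).symm

theorem unpairL_of_not {c : M} (h : ¬ ∃ a b, c = pair a b) : unpairL c = 0 := by
  unfold unpairL; rw [dif_neg h]

theorem unpairR_of_not {c : M} (h : ¬ ∃ a b, c = pair a b) : unpairR c = 0 := by
  unfold unpairR; rw [dif_neg h]

end Arithmetic

/-! ### Derived connectives for bounded formulas. -/

section Formulas

variable {M : Type*} [CommSemiring M] [LinearOrder M]

/-- Polynomial term for the pairing function. -/
def NumTerm.pair (s t : NumTerm) : NumTerm := .add (.mul (.add s t) (.add s t)) s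

@[simp] theorem NumTerm.val_pair (e : ℕ → M) (s t : NumTerm) :
    (NumTerm.pair s t).val e = InvGoodstein.pair (s.val e) (t.val e) := rfl

/-- Disjunction. -/
def BddFormula.or (φ ψ : BddFormula) : BddFormula := .not (.and (.not φ) (.not ψ))

/-- Existential quantification over numbers that are at most `t`. -/
def BddFormula.bex (i : ℕ) (t : NumTerm) (φ : BddFormula) : BddFormula :=
  .not (.ball i (.add t .one) (.not φ))

@[simp] theorem BddFormula.holds_or (V : ℕ → Set M) (e : ℕ → M) (φ ψ : BddFormula) :
    (BddFormula.or φ ψ).Holds V e ↔ φ.Holds V e ∨ ψ.Holds V e := by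
  simp only [BddFormula.or, BddFormula.Holds]; tauto

@[simp] theorem BddFormula.holds_bex [IsStrictOrderedRing M] [CanonicallyOrderedAdd M]
    [DiscreteNumbers M] (V : ℕ → Set M) (e : ℕ → M) (i : ℕ) (t : NumTerm) (φ : BddFormula) :
    (BddFormula.bex i t φ).Holds V e ↔ ∃ a ≤ t.val e, φ.Holds V (Function.update e i a) := by
  simp only [BddFormula.bex, BddFormula.Holds, NumTerm.val, lt_add_one_iff']
  push Not
  rfl

attribute [simp] BddFormula.Holds NumTerm.val

end Formulas

/-! ### Comprehension and closure properties of the sets of the model. -/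

section Base

variable {M : Type*} [CommSemiring M] [LinearOrder M] [IsStrictOrderedRing M]
    [CanonicallyOrderedAdd M] [DiscreteNumbers M] {𝒮 : Set (Set M)} [hS : Fact (ModelsRCA0 𝒮)]

include hS in
-- Δ⁰₁-comprehension in symmetric form: the set and its complement are both Σ⁰₁. This avoids
-- universal unbounded quantifiers in the applications.
theorem mem_of_delta_one (V : ℕ → Set M) (hV : ∀ i, V i ∈ 𝒮) (e : ℕ → M) (θ ψ : BddFormula)
    {S : Set M} (h₁ : ∀ a, a ∈ S ↔ ∃ b, θ.At V e a b) (h₂ : ∀ a, a ∉ S ↔ ∃ b, ψ.At V e a b) :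
    S ∈ 𝒮 := by
  have := hS.out.delta_comprehension θ (.not ψ) V e hV (fun a => by
    rw [← h₁]
    have := h₂ a
    simp only [BddFormula.At, BddFormula.Holds] at *
    rw [← not_exists, ← this, not_not])
  convert this using 1
  ext a
  exact h₁ a

include hS in
theorem mem_of_delta_zero (V : ℕ → Set M) (hV : ∀ i, V i ∈ 𝒮) (e : ℕ → M) (θ : BddFormula)
    {S : Set M} (h : ∀ a b, a ∈ S ↔ θ.At V e a b) : S ∈ 𝒮 := by
  refine mem_of_delta_one V hV e θ (.not θ) (fun a => ?_) (fun a => ?_)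
  · simp [← h]
  · simp only [BddFormula.At, BddFormula.Holds] at *
    simp [← h]

/-- A valuation of the set variables by three sets. -/
def threeSets (S T U : Set M) : ℕ → Set M
  | 0 => S
  | 1 => T
  | _ => U

theorem threeSets_mem {S T U : Set M} (h₁ : S ∈ 𝒮) (h₂ : T ∈ 𝒮) (h₃ : U ∈ 𝒮) :
    ∀ i, threeSets S T U i ∈ 𝒮
  | 0 => h₁
  | 1 => h₂
  | _ + 2 => h₃

@[simp] theorem threeSets_zero (S T U : Set M) : threeSets S T U 0 = S := rfl
@[simp] theorem threeSets_one (S T U : Set M) : threeSets S T U 1 = T := rfl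
@[simp] theorem threeSets_two (S T U : Set M) : threeSets S T U 2 = U := rfl

end Base

section Base

variable {M : Type*} [CommSemiring M] [LinearOrder M] [IsStrictOrderedRing M]
    [CanonicallyOrderedAdd M] [DiscreteNumbers M] {𝒮 : Set (Set M)} [hS : Fact (ModelsRCA0 𝒮)]

/-- The graph of a function, as a set of coded pairs. -/
def graph (f : M → M) : Set M := {c | ∃ a ∈ Set.univ, c = pair a (f a)}

@[simp] theorem pair_mem_graph {f : M → M} {a v : M} : pair a v ∈ graph f ↔ v = f a := by
  simp only [graph, Set.mem_ofPred_eq, Set.mem_univ, true_and, pair_inj]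
  constructor
  · rintro ⟨b, rfl, h⟩; exact h
  · rintro h; exact ⟨a, rfl, h⟩

/-- Total functions that exist in the model. -/
abbrev Total (𝒮 : Set (Set M)) (f : M → M) : Prop := graph f ∈ 𝒮

theorem mem_graph_iff {f : M → M} {c : M} :
    c ∈ graph f ↔ ∃ a ≤ c, ∃ v ≤ c, c = pair a v ∧ v = f a := by
  constructor
  · rintro ⟨a, -, rfl⟩
    exact ⟨a, le_pair_left _ _, f a, le_pair_right _ _, rfl, rfl⟩
  · rintro ⟨a, -, v, -, rfl, rfl⟩
    exact ⟨a, trivial, rfl⟩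

theorem not_mem_graph_iff {f : M → M} {c : M} :
    c ∉ graph f ↔ (∀ a < c + 1, ∀ v < c + 1, c ≠ pair a v) ∨
      ∃ a ≤ c, ∃ v ≤ c, c = pair a v ∧ v ≠ f a := by
  simp only [lt_add_one_iff']
  by_cases h : ∃ a v, c = pair a v
  · obtain ⟨a, v, rfl⟩ := h
    rw [pair_mem_graph]
    constructor
    · intro h
      exact Or.inr ⟨a, le_pair_left _ _, v, le_pair_right _ _, rfl, h⟩
    · rintro (h | ⟨a', -, v', -, h, h'⟩)
      · exact absurd rfl (h a (le_pair_left _ _) v (le_pair_right _ _))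
      · rw [pair_inj] at h
        obtain ⟨rfl, rfl⟩ := h
        exact h'
  · push Not at h
    simp only [h, ne_eq, not_false_eq_true, implies_true, true_or, iff_true]
    rintro ⟨a, -, rfl⟩
    exact h _ _ rfl

open NumTerm BddFormula

local notation "x₀" => NumTerm.var 0
local notation "x₁" => NumTerm.var 1
local notation "x₂" => NumTerm.var 2
local notation "x₃" => NumTerm.var 3
local notation "x₄" => NumTerm.var 4
local notation "x₅" => NumTerm.var 5

theorem exists_mem_model : ∃ S, S ∈ 𝒮 := hS.out.nonempty

theorem compl_mem_model {S : Set M} (h : S ∈ 𝒮) : Sᶜ ∈ 𝒮 :=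
  mem_of_delta_zero (threeSets S S S) (threeSets_mem h h h) 0 (.not (.mem x₀ 0))
    (fun a b => by simp [At])

theorem inter_mem_model {S T : Set M} (h : S ∈ 𝒮) (h' : T ∈ 𝒮) : S ∩ T ∈ 𝒮 :=
  mem_of_delta_zero (threeSets S T S) (threeSets_mem h h' h) 0 (.and (.mem x₀ 0) (.mem x₀ 1))
    (fun a b => by simp [At])

theorem preimage_mem_model {S : Set M} {f : M → M} (hf : Total 𝒮 f) (h : S ∈ 𝒮) :
    f ⁻¹' S ∈ 𝒮 :=
  mem_of_delta_one (threeSets (graph f) S S) (threeSets_mem hf h h) 0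
    (.and (.mem (NumTerm.pair x₀ x₁) 0) (.mem x₁ 1))
    (.and (.mem (NumTerm.pair x₀ x₁) 0) (.not (.mem x₁ 1)))
    (fun a => by simp [At]) (fun a => by simp [At])

theorem sigma_induction_set {T : Set M} (hT : T ∈ 𝒮) (h0 : ∃ b, pair 0 b ∈ T)
    (hs : ∀ a, (∃ b, pair a b ∈ T) → ∃ b, pair (a + 1) b ∈ T) (a : M) : ∃ b, pair a b ∈ T := by
  have := fun e => hS.out.sigma_induction (.mem (NumTerm.pair x₀ x₁) 0) (threeSets T T T) e
    (threeSets_mem hT hT hT)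
  simp only [At, Function.update_apply, Holds, val_pair, val] at this
  simp only [threeSets_zero, reduceIte, one_ne_zero, zero_ne_one] at this
  exact this (fun _ => 0) h0 hs a

/-- The intermediate value g(a) is not bounded by the code of (a, f(g(a))), so it becomes the
unbounded witness of a Σ⁰₁ definition. For the complement the same witness works, apart from codes
that are not pairs. -/
theorem Total.comp {f g : M → M} (hf : Total 𝒮 f) (hg : Total 𝒮 g) :
    Total 𝒮 (fun a => f (g a)) := by
  refine mem_of_delta_one (threeSets (graph g) (graph f) (graph f)) (threeSets_mem hg hf hf) 0
    (.bex 2 x₀ (.bex 3 x₀ (.and (.eq x₀ (.pair x₂ x₃)) (.and (.mem (.pair x₂ x₁) 0)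
      (.mem (.pair x₁ x₃) 1)))))
    (.or (.ball 2 (.add x₀ .one) (.ball 3 (.add x₀ .one) (.not (.eq x₀ (.pair x₂ x₃)))))
      (.bex 2 x₀ (.bex 3 x₀ (.and (.eq x₀ (.pair x₂ x₃)) (.and (.mem (.pair x₂ x₁) 0)
      (.not (.mem (.pair x₁ x₃) 1)))))))
    (fun c => ?_) (fun c => ?_)
  · rw [mem_graph_iff]
    simp [At]
  · rw [not_mem_graph_iff]
    simp only [At, Function.update_apply, Holds, val_pair, val, holds_or, holds_bex, threeSets,
      pair_mem_graph]
    simp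
    constructor
    · rintro (h | ⟨a, h, v, h', h1, h2⟩)
      · exact ⟨0, Or.inl h⟩
      · exact ⟨_, Or.inr ⟨a, h, v, h', h1, rfl, h2⟩⟩
    · rintro ⟨_, (h | ⟨a, h, v, h', h1, rfl, h2⟩)⟩
      · exact Or.inl h
      · exact Or.inr ⟨a, h, v, h', h1, h2⟩

theorem total_id : Total 𝒮 (fun a => a) := by
  obtain ⟨S, hS'⟩ := exists_mem_model (𝒮 := 𝒮)
  refine mem_of_delta_zero (threeSets S S S) (threeSets_mem hS' hS' hS') 0
    (.bex 2 x₀ (.eq x₀ (.pair x₂ x₂))) (fun c b => ?_)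
  rw [mem_graph_iff]
  simp [At]

theorem total_const (k : M) : Total 𝒮 (fun _ => k) := by
  obtain ⟨S, hS'⟩ := exists_mem_model (𝒮 := 𝒮)
  refine mem_of_delta_zero (threeSets S S S) (threeSets_mem hS' hS' hS') (fun _ => k)
    (.bex 2 x₀ (.eq x₀ (.pair x₂ x₃))) (fun c b => ?_)
  rw [mem_graph_iff]
  simp [At]
  constructor
  · rintro ⟨a, h, -, h'⟩; exact ⟨a, h, h'⟩
  · rintro ⟨a, h, rfl⟩; exact ⟨a, h, le_pair_right _ _, rfl⟩

theorem Total.pair {f g : M → M} (hf : Total 𝒮 f) (hg : Total 𝒮 g) :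
    Total 𝒮 (fun a => InvGoodstein.pair (f a) (g a)) := by
  refine mem_of_delta_zero (threeSets (graph f) (graph g) (graph g)) (threeSets_mem hf hg hg) 0
    (.bex 2 x₀ (.bex 3 x₀ (.bex 4 x₀ (.and (.eq x₀ (.pair x₂ (.pair x₃ x₄)))
      (.and (.mem (.pair x₂ x₃) 0) (.mem (.pair x₂ x₄) 1)))))) (fun c b => ?_)
  rw [mem_graph_iff]
  simp [At]
  constructor
  · rintro ⟨a, h, h', rfl⟩
    exact ⟨a, h, (le_pair_left _ _).trans h', (le_pair_right _ _).trans h', rfl⟩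
  · rintro ⟨a, h, h', h'', rfl⟩
    exact ⟨a, h, le_pair_right _ _, rfl⟩

theorem Total.add {f g : M → M} (hf : Total 𝒮 f) (hg : Total 𝒮 g) :
    Total 𝒮 (fun a => f a + g a) := by
  refine mem_of_delta_zero (threeSets (graph f) (graph g) (graph g)) (threeSets_mem hf hg hg) 0
    (.bex 2 x₀ (.bex 3 x₀ (.bex 4 x₀ (.and (.eq x₀ (.pair x₂ (.add x₃ x₄)))
      (.and (.mem (.pair x₂ x₃) 0) (.mem (.pair x₂ x₄) 1)))))) (fun c b => ?_)
  rw [mem_graph_iff]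
  simp [At]
  constructor
  · rintro ⟨a, h, h', rfl⟩
    exact ⟨a, h, le_self_add.trans h', le_add_self.trans h', rfl⟩
  · rintro ⟨a, h, h', h'', rfl⟩
    exact ⟨a, h, le_pair_right _ _, rfl⟩

theorem Total.lt {f g : M → M} (hf : Total 𝒮 f) (hg : Total 𝒮 g) : {a | f a < g a} ∈ 𝒮 := by
  refine mem_of_delta_one (threeSets (graph f) (graph g) (graph g)) (threeSets_mem hf hg hg) 0
    (.bex 2 x₁ (.bex 3 x₁ (.and (.and (.mem (.pair x₀ x₂) 0) (.mem (.pair x₀ x₃) 1)) (.lt x₂ x₃))))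
    (.bex 2 x₁ (.bex 3 x₁ (.and (.and (.mem (.pair x₀ x₂) 0) (.mem (.pair x₀ x₃) 1))
      (.not (.lt x₂ x₃))))) (fun c => ?_) (fun c => ?_)
  all_goals
    simp only [At, Holds, val_pair, val, holds_or, holds_bex, threeSets_zero, threeSets_one,
      threeSets_two, Function.update_apply, reduceIte, Nat.reduceEqDiff, one_ne_zero, zero_ne_one,
      OfNat.ofNat_ne_zero, OfNat.zero_ne_ofNat, OfNat.ofNat_ne_one, OfNat.one_ne_ofNat, pair_mem_graph]
    constructor
    · intro (h : _)
      exact ⟨max (f c) (g c), _, le_max_left _ _, _, le_max_right _ _, ⟨rfl, rfl⟩, h⟩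
    · rintro ⟨_, _, -, _, -, ⟨rfl, rfl⟩, h⟩
      exact h

open Classical in
theorem Total.ite {f g : M → M} {S : Set M} (hT : S ∈ 𝒮) (hf : Total 𝒮 f) (hg : Total 𝒮 g) :
    Total 𝒮 (fun a => if a ∈ S then f a else g a) := by
  refine mem_of_delta_zero (threeSets (graph f) (graph g) S) (threeSets_mem hf hg hT) 0
    (.bex 2 x₀ (.bex 3 x₀ (.and (.eq x₀ (.pair x₂ x₃))
      (.or (.and (.mem x₂ 2) (.mem x₀ 0)) (.and (.not (.mem x₂ 2)) (.mem x₀ 1)))))) (fun c b => ?_)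
  rw [mem_graph_iff]
  simp only [At, Holds, val_pair, val, holds_or, holds_bex, threeSets_zero, threeSets_one,
      threeSets_two, Function.update_apply, reduceIte, Nat.reduceEqDiff, one_ne_zero, zero_ne_one,
      OfNat.ofNat_ne_zero, OfNat.zero_ne_ofNat, OfNat.ofNat_ne_one, OfNat.one_ne_ofNat, pair_mem_graph]
  refine exists_congr fun a => and_congr_right fun h => exists_congr fun v =>
    and_congr_right fun h' => and_congr_right fun h'' => ?_
  subst h''
  simp only [pair_mem_graph]
  split_ifs <;> simp [*]

open Classical in
theorem Total.mul {f g : M → M} (hf : Total 𝒮 f) (hg : Total 𝒮 g) :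
    Total 𝒮 (fun a => f a * g a) := by
  -- A factor need not be bounded by the product when the other factor is 0. Adding 1 to both
  -- factors makes them bounded, hence the graph Δ⁰₀.
  have key : Total 𝒮 (fun a => (f a + 1) * (g a + 1)) := by
    refine mem_of_delta_zero (threeSets (graph f) (graph g) (graph g)) (threeSets_mem hf hg hg) 0
      (.bex 2 x₀ (.bex 3 x₀ (.bex 4 x₀
        (.and (.eq x₀ (.pair x₂ (.mul (.add x₃ .one) (.add x₄ .one))))
        (.and (.mem (.pair x₂ x₃) 0) (.mem (.pair x₂ x₄) 1)))))) (fun c b => ?_)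
    rw [mem_graph_iff]
    simp [At]
    have h1 : ∀ a, f a ≤ (f a + 1) * (g a + 1) := fun a => by
      have : (f a + 1) * (g a + 1) = f a + (f a * g a + g a + 1) := by ring
      rw [this]; exact le_self_add
    have h2 : ∀ a, g a ≤ (f a + 1) * (g a + 1) := fun a => by
      have : (f a + 1) * (g a + 1) = g a + (f a * g a + f a + 1) := by ring
      rw [this]; exact le_self_add
    constructor
    · rintro ⟨a, h, h', rfl⟩
      exact ⟨a, h, (h1 a).trans h', (h2 a).trans h', rfl⟩
    · rintro ⟨a, h, h', h'', rfl⟩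
      exact ⟨a, h, le_pair_right _ _, rfl⟩
  have hp := key.pair (hf.add hg)
  -- The product is recovered from (f+1)(g+1) by subtracting f + g + 1, with f + g as the unbounded
  -- witness.
  have hsub : Total 𝒮 (fun a => f a * g a) := by
    refine mem_of_delta_one (threeSets _ _ _) (threeSets_mem hp hp hp) 0
      (.bex 2 x₀ (.bex 3 x₀ (.and (.eq x₀ (.pair x₂ x₃))
        (.mem (.pair x₂ (.pair (.add (.add x₃ x₁) .one) x₁)) 0))))
      (.or (.ball 2 (.add x₀ .one) (.ball 3 (.add x₀ .one) (.not (.eq x₀ (.pair x₂ x₃)))))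
      (.bex 2 x₀ (.bex 3 x₀ (.and (.eq x₀ (.pair x₂ x₃)) (.bex 4 x₁ (.bex 5 x₁ (.and
        (.mem (.pair x₂ (.pair x₄ x₅)) 0) (.not (.eq x₄ (.add (.add x₃ x₅) .one))))))))))
      (fun c => ?_) (fun c => ?_)
    · rw [mem_graph_iff]
      simp only [At, Holds, val_pair, val, holds_or, holds_bex, threeSets_zero, threeSets_one,
      threeSets_two, Function.update_apply, reduceIte, Nat.reduceEqDiff, one_ne_zero, zero_ne_one,
      OfNat.ofNat_ne_zero, OfNat.zero_ne_ofNat, OfNat.ofNat_ne_one, OfNat.one_ne_ofNat, pair_mem_graph]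
      simp only [pair_inj]
      constructor
      · rintro ⟨a, h, v, h1, h2, rfl⟩; refine ⟨_, a, h, _, h1, h2, ?_, rfl⟩
        ring
      · rintro ⟨_, a, h, v, h', h1, h2, rfl⟩
        have : v = f a * g a := by
          have : v + (f a + g a + 1) = f a * g a + (f a + g a + 1) := by
            rw [← add_assoc, h2]; ring
          exact add_right_cancel this
        subst this
        exact ⟨a, h, _, h', h1, rfl⟩
    · rw [not_mem_graph_iff]
      simp only [At, Holds, val_pair, val, holds_or, holds_bex, threeSets_zero, threeSets_one,
      threeSets_two, Function.update_apply, reduceIte, Nat.reduceEqDiff, one_ne_zero, zero_ne_one,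
      OfNat.ofNat_ne_zero, OfNat.zero_ne_ofNat, OfNat.ofNat_ne_one, OfNat.one_ne_ofNat, pair_mem_graph]
      simp only [pair_inj]
      have hh : ∀ a v, (f a + 1) * (g a + 1) = v + (f a + g a) + 1 ↔ v = f a * g a := by
        intro a v
        have : (f a + 1) * (g a + 1) = f a * g a + (f a + g a) + 1 := by ring
        rw [this]
        simp [eq_comm]
      constructor
      · rintro (h | ⟨a, h, v, h', h1, h2⟩)
        · exact ⟨0, Or.inl h⟩
        · refine ⟨max ((f a + 1) * (g a + 1)) (f a + g a), Or.inr ⟨a, h, v, h', h1, _,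
            le_max_left _ _, _, le_max_right _ _, ⟨rfl, rfl⟩, ?_⟩⟩
          rwa [hh]
      · rintro ⟨_, (h | ⟨a, h, v, h', h1, _, -, _, -, ⟨rfl, rfl⟩, h2⟩)⟩
        · exact Or.inl h
        · rw [hh] at h2
          exact Or.inr ⟨a, h, v, h', h1, h2⟩
  exact hsub

theorem total_unpairL : Total 𝒮 unpairL := by
  obtain ⟨S, hS'⟩ := exists_mem_model (𝒮 := 𝒮)
  refine mem_of_delta_zero (threeSets S S S) (threeSets_mem hS' hS' hS') 0
    (.bex 2 x₀ (.bex 3 x₀ (.and (.eq x₀ (.pair x₂ x₃)) (.or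
      (.bex 4 x₂ (.eq x₂ (.pair x₃ x₄)))
      (.and (.eq x₃ .zero) (.ball 4 (.add x₂ .one) (.ball 5 (.add x₂ .one)
        (.not (.eq x₂ (.pair x₄ x₅))))))))))
    (fun c b => ?_)
  rw [mem_graph_iff]
  simp only [At, Holds, val_pair, val, holds_or, holds_bex, threeSets_zero, threeSets_one,
      threeSets_two, Function.update_apply, reduceIte, Nat.reduceEqDiff, one_ne_zero, zero_ne_one,
      OfNat.ofNat_ne_zero, OfNat.zero_ne_ofNat, OfNat.ofNat_ne_one, OfNat.one_ne_ofNat, pair_mem_graph]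
  simp only [lt_add_one_iff']
  refine exists_congr fun a => and_congr_right fun h => exists_congr fun v =>
    and_congr_right fun h' => and_congr_right fun h'' => ?_
  by_cases h : ∃ u w, a = InvGoodstein.pair u w
  · obtain ⟨u, w, rfl⟩ := h
    simp only [unpairL_pair, pair_inj]
    constructor
    · rintro rfl; exact Or.inl ⟨w, le_pair_right _ _, rfl, rfl⟩
    · rintro (⟨w', -, rfl, -⟩ | ⟨-, h⟩)
      · rfl
      · exact absurd ⟨rfl, rfl⟩ (h u (le_pair_left _ _) w (le_pair_right _ _))
  · rw [unpairL_of_not h]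
    push Not at h
    simp [h]

theorem total_unpairR : Total 𝒮 unpairR := by
  obtain ⟨S, hS'⟩ := exists_mem_model (𝒮 := 𝒮)
  refine mem_of_delta_zero (threeSets S S S) (threeSets_mem hS' hS' hS') 0
    (.bex 2 x₀ (.bex 3 x₀ (.and (.eq x₀ (.pair x₂ x₃)) (.or
      (.bex 4 x₂ (.eq x₂ (.pair x₄ x₃)))
      (.and (.eq x₃ .zero) (.ball 4 (.add x₂ .one) (.ball 5 (.add x₂ .one)
        (.not (.eq x₂ (.pair x₄ x₅))))))))))
    (fun c b => ?_)
  rw [mem_graph_iff]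
  simp only [At, Holds, val_pair, val, holds_or, holds_bex, threeSets_zero, threeSets_one,
      threeSets_two, Function.update_apply, reduceIte, Nat.reduceEqDiff, one_ne_zero, zero_ne_one,
      OfNat.ofNat_ne_zero, OfNat.zero_ne_ofNat, OfNat.ofNat_ne_one, OfNat.one_ne_ofNat, pair_mem_graph]
  simp only [lt_add_one_iff']
  refine exists_congr fun a => and_congr_right fun h => exists_congr fun v =>
    and_congr_right fun h' => and_congr_right fun h'' => ?_
  by_cases h : ∃ u w, a = InvGoodstein.pair u w
  · obtain ⟨u, w, rfl⟩ := h
    simp only [unpairR_pair, pair_inj]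
    constructor
    · rintro rfl; exact Or.inl ⟨u, le_pair_left _ _, rfl, rfl⟩
    · rintro (⟨w', -, -, rfl⟩ | ⟨-, h⟩)
      · rfl
      · exact absurd ⟨rfl, rfl⟩ (h u (le_pair_left _ _) w (le_pair_right _ _))
  · rw [unpairR_of_not h]
    push Not at h
    simp [h]

theorem ball_mem_model {S : Set M} (h : S ∈ 𝒮) :
    {c | ∃ a n, c = pair a n ∧ ∀ i < n, pair a i ∈ S} ∈ 𝒮 := by
  refine mem_of_delta_zero (threeSets S S S) (threeSets_mem h h h) 0
    (.bex 2 x₀ (.bex 3 x₀ (.and (.eq x₀ (.pair x₂ x₃))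
      (.ball 4 x₃ (.mem (.pair x₂ x₄) 0))))) (fun c b => ?_)
  simp only [At, Function.update_apply, Holds, val_pair, val, holds_bex, threeSets]
  simp
  constructor
  · rintro ⟨a, n, rfl, h⟩
    exact ⟨a, le_pair_left _ _, n, le_pair_right _ _, rfl, h⟩
  · rintro ⟨a, -, n, -, rfl, h⟩
    exact ⟨a, n, rfl, h⟩

end Base

/-- Types whose elements are coded by numbers. -/
class Enc (M : Type*) (α : Type*) where
  /-- The code of an element. -/
  enc : α → M
  inj : Function.Injective enc

/-! ### Computability on codes, and the induction principles of RCA₀. -/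

section Rec

variable {M : Type*} [CommSemiring M] [LinearOrder M] [IsStrictOrderedRing M]
    [CanonicallyOrderedAdd M] [DiscreteNumbers M] {𝒮 : Set (Set M)} [hS : Fact (ModelsRCA0 𝒮)]

instance : Enc M M := ⟨id, Function.injective_id⟩

instance {α β : Type*} [Enc M α] [Enc M β] : Enc M (α × β) where
  enc p := pair (Enc.enc p.1) (Enc.enc p.2)
  inj p q h := by
    rw [pair_inj] at h
    exact Prod.ext (Enc.inj h.1) (Enc.inj h.2)

open Classical in
noncomputable instance : Enc M Prop where
  enc p := if p then 1 else 0
  inj p q h := by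
    by_cases hp : p <;> by_cases hq : q <;> simp_all

theorem enc_num (a : M) : (Enc.enc a : M) = a := rfl

theorem enc_prod {α β : Type*} [Enc M α] [Enc M β] (a : α) (b : β) :
    (Enc.enc (a, b) : M) = pair (Enc.enc a) (Enc.enc b) := rfl

open Classical in
theorem enc_prop (p : Prop) : (Enc.enc p : M) = if p then 1 else 0 := rfl

variable {α β γ : Type*} [Enc M α] [Enc M β] [Enc M γ]

/-- The function `f` is computed on codes by a total function of the model. -/
@[fun_prop]
def Rec (𝒮 : Set (Set M)) (f : α → β) : Prop :=
  ∃ g : M → M, Total 𝒮 g ∧ ∀ a, g (Enc.enc a) = Enc.enc (f a)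

@[fun_prop]
theorem Rec.id : Rec 𝒮 (fun a : α => a) := ⟨_, total_id, fun _ => rfl⟩

@[fun_prop]
theorem Rec.const (b : β) : Rec 𝒮 (fun _ : α => b) := ⟨_, total_const (Enc.enc b), fun _ => rfl⟩

@[fun_prop]
theorem Rec.comp {f : β → γ} {g : α → β} (hf : Rec 𝒮 f) (hg : Rec 𝒮 g) :
    Rec 𝒮 (fun a => f (g a)) := by
  obtain ⟨F, hF, h⟩ := hf
  obtain ⟨G, hG, h'⟩ := hg
  exact ⟨_, hF.comp hG, fun a => by rw [h', h]⟩

@[fun_prop]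
theorem Rec.prodMk {f : α → β} {g : α → γ} (hf : Rec 𝒮 f) (hg : Rec 𝒮 g) :
    Rec 𝒮 (fun a => (f a, g a)) := by
  obtain ⟨F, hF, h⟩ := hf
  obtain ⟨G, hG, h'⟩ := hg
  exact ⟨_, hF.pair hG, fun a => by rw [h', h]; rfl⟩

@[fun_prop]
theorem Rec.fst {f : α → β × γ} (hf : Rec 𝒮 f) : Rec 𝒮 (fun a => (f a).1) := by
  obtain ⟨F, hF, h⟩ := hf
  exact ⟨_, total_unpairL.comp hF, fun a => by rw [h]; exact unpairL_pair _ _⟩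

@[fun_prop]
theorem Rec.snd {f : α → β × γ} (hf : Rec 𝒮 f) : Rec 𝒮 (fun a => (f a).2) := by
  obtain ⟨F, hF, h⟩ := hf
  exact ⟨_, total_unpairR.comp hF, fun a => by rw [h]; exact unpairR_pair _ _⟩

theorem rec_of_total {f : M → M} (h : Total 𝒮 f) : Rec 𝒮 f := ⟨f, h, fun _ => rfl⟩

theorem Rec.total {f : M → M} (h : Rec 𝒮 f) : Total 𝒮 f := by
  obtain ⟨F, hF, h⟩ := h
  convert hF
  funext a
  exact (h a).symm

@[fun_prop]
theorem Rec.pair {f g : α → M} (hf : Rec 𝒮 f) (hg : Rec 𝒮 g) :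
    Rec 𝒮 (fun a => InvGoodstein.pair (f a) (g a)) := by
  obtain ⟨F, hF, h⟩ := hf
  obtain ⟨G, hG, h'⟩ := hg
  exact ⟨_, hF.pair hG, fun a => by rw [h', h]; rfl⟩

@[fun_prop]
theorem Rec.add {f g : α → M} (hf : Rec 𝒮 f) (hg : Rec 𝒮 g) : Rec 𝒮 (fun a => f a + g a) := by
  obtain ⟨F, hF, h⟩ := hf
  obtain ⟨G, hG, h'⟩ := hg
  exact ⟨_, hF.add hG, fun a => by rw [h', h]; rfl⟩

@[fun_prop]
theorem Rec.mul {f g : α → M} (hf : Rec 𝒮 f) (hg : Rec 𝒮 g) : Rec 𝒮 (fun a => f a * g a) := by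
  obtain ⟨F, hF, h⟩ := hf
  obtain ⟨G, hG, h'⟩ := hg
  exact ⟨_, hF.mul hG, fun a => by rw [h', h]; rfl⟩

@[fun_prop]
theorem rec_unpairL : Rec 𝒮 (unpairL : M → M) := rec_of_total total_unpairL

@[fun_prop]
theorem rec_unpairR : Rec 𝒮 (unpairR : M → M) := rec_of_total total_unpairR

open Classical in
theorem recP_of_mem {p : α → Prop} {S : Set M} (h : S ∈ 𝒮) (hp : ∀ a, p a ↔ Enc.enc a ∈ S) :
    Rec 𝒮 p := by
  refine ⟨_, Total.ite h (total_const 1) (total_const 0), fun a => ?_⟩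
  rw [enc_prop]
  simp only [hp]

theorem Rec.exists_mem {p : α → Prop} (h : Rec 𝒮 p) : ∃ S ∈ 𝒮, ∀ a, p a ↔ Enc.enc a ∈ S := by
  obtain ⟨F, hF, h⟩ := h
  have h1 : {a | (fun _ => 0) a < F a} ∈ 𝒮 := (total_const 0).lt hF
  refine ⟨_, h1, fun a => ?_⟩
  have := h a
  rw [enc_prop] at this
  simp only [Set.mem_ofPred_eq, this]
  split_ifs with h2 <;> simp [h2]

theorem Rec.mem {p : M → Prop} (h : Rec 𝒮 p) : {a | p a} ∈ 𝒮 := by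
  obtain ⟨S, hS, h⟩ := h.exists_mem
  convert hS
  ext a
  exact h a

theorem rec_mem_set {S : Set M} (h : S ∈ 𝒮) : Rec 𝒮 (fun a => a ∈ S) :=
  recP_of_mem h (fun _ => Iff.rfl)

theorem Rec.of_iff {p q : α → Prop} (h : Rec 𝒮 p) (hq : ∀ a, q a ↔ p a) : Rec 𝒮 q := by
  have : q = p := funext fun a => propext (hq a)
  rwa [this]

@[fun_prop]
theorem Rec.not {p : α → Prop} (h : Rec 𝒮 p) : Rec 𝒮 (fun a => ¬ p a) := by
  obtain ⟨S, hS, h⟩ := h.exists_mem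
  exact recP_of_mem (compl_mem_model hS) (fun a => by simp [h])

@[fun_prop]
theorem Rec.and {p q : α → Prop} (h : Rec 𝒮 p) (h' : Rec 𝒮 q) : Rec 𝒮 (fun a => p a ∧ q a) := by
  obtain ⟨S, hS, h⟩ := h.exists_mem
  obtain ⟨T, hT, h'⟩ := h'.exists_mem
  exact recP_of_mem (inter_mem_model hS hT) (fun a => by simp [h, h'])

@[fun_prop]
theorem Rec.or {p q : α → Prop} (h : Rec 𝒮 p) (h' : Rec 𝒮 q) : Rec 𝒮 (fun a => p a ∨ q a) :=
  (h.not.and h'.not).not.of_iff (fun a => by tauto)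

/-- Implication, as a binary connective. -/
def Imp (p q : Prop) : Prop := p → q

@[fun_prop]
theorem Rec.imp {p q : α → Prop} (h : Rec 𝒮 p) (h' : Rec 𝒮 q) : Rec 𝒮 (fun a => Imp (p a) (q a)) :=
  (h.not.or h').of_iff (fun a => by unfold Imp; tauto)

@[fun_prop]
theorem Rec.iff {p q : α → Prop} (h : Rec 𝒮 p) (h' : Rec 𝒮 q) : Rec 𝒮 (fun a => p a ↔ q a) :=
  ((h.imp h').and (h'.imp h)).of_iff (fun a => by unfold Imp; tauto)

@[fun_prop]
theorem Rec.lt {f g : α → M} (hf : Rec 𝒮 f) (hg : Rec 𝒮 g) : Rec 𝒮 (fun a => f a < g a) := by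
  obtain ⟨F, hF, h⟩ := hf
  obtain ⟨G, hG, h'⟩ := hg
  exact recP_of_mem (hF.lt hG) (fun a => by simp only [Set.mem_ofPred_eq, h, h']; rfl)

@[fun_prop]
theorem Rec.le {f g : α → M} (hf : Rec 𝒮 f) (hg : Rec 𝒮 g) : Rec 𝒮 (fun a => f a ≤ g a) :=
  (hg.lt hf).not.of_iff (fun a => by simp)

@[fun_prop]
theorem Rec.eq {f g : α → M} (hf : Rec 𝒮 f) (hg : Rec 𝒮 g) : Rec 𝒮 (fun a => f a = g a) :=
  ((hf.le hg).and (hg.le hf)).of_iff (fun a => le_antisymm_iff)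

/-- Bounded universal quantification. -/
def Ball (n : M) (p : M → Prop) : Prop := ∀ i, i < n → p i

/-- Bounded existential quantification. -/
def Bex (n : M) (p : M → Prop) : Prop := ∃ i, i < n ∧ p i

@[fun_prop]
theorem Rec.ball {n : α → M} {p : α → M → Prop} (hn : Rec 𝒮 n)
    (hp : Rec 𝒮 (fun q : α × M => p q.1 q.2)) : Rec 𝒮 (fun a => Ball (n a) (fun i => p a i)) := by
  obtain ⟨S, hS, h⟩ := hp.exists_mem
  obtain ⟨F, hF, h'⟩ := hn
  have := preimage_mem_model (total_id.pair hF) (ball_mem_model hS)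
  refine recP_of_mem this (fun a => ?_)
  simp only [Set.mem_preimage, Set.mem_ofPred_eq, pair_inj, h']
  constructor
  · intro h1
    exact ⟨_, _, ⟨rfl, rfl⟩, fun i hi => (h (a, i)).1 (h1 i hi)⟩
  · rintro ⟨_, _, ⟨rfl, rfl⟩, h1⟩ i hi
    exact (h (a, i)).2 (h1 i hi)

@[fun_prop]
theorem Rec.bex {n : α → M} {p : α → M → Prop} (hn : Rec 𝒮 n)
    (hp : Rec 𝒮 (fun q : α × M => p q.1 q.2)) : Rec 𝒮 (fun a => Bex (n a) (fun i => p a i)) :=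
  (Rec.ball (p := fun a i => ¬ p a i) hn hp.not).not.of_iff
    (fun a => by unfold Bex Ball; push Not; rfl)

open Classical in
/-- Definition by cases. -/
noncomputable def Cond {β : Type*} (p : Prop) (x y : β) : β := if p then x else y

theorem cond_pos {β : Type*} {p : Prop} (h : p) (x y : β) : Cond p x y = x := if_pos h
theorem cond_neg {β : Type*} {p : Prop} (h : ¬ p) (x y : β) : Cond p x y = y := if_neg h

@[simp] theorem cond_true' {β : Type*} (x y : β) : Cond True x y = x := if_pos trivial
@[simp] theorem cond_false' {β : Type*} (x y : β) : Cond False x y = y := if_neg id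

@[fun_prop]
theorem Rec.cond {p : α → Prop} {f g : α → β} (hp : Rec 𝒮 p) (hf : Rec 𝒮 f) (hg : Rec 𝒮 g) :
    Rec 𝒮 (fun a => Cond (p a) (f a) (g a)) := by
  obtain ⟨S, hS, h⟩ := hp.exists_mem
  obtain ⟨F, hF, h1⟩ := hf
  obtain ⟨G, hG, h2⟩ := hg
  refine ⟨_, Total.ite hS hF hG, fun a => ?_⟩
  unfold Cond
  simp only [h, h1, h2]
  split_ifs <;> simp_all

/-- Types with a computable decoding function. -/
class Decodable (𝒮 : Set (Set M)) (α : Type*) [Enc M α] : Prop where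
  exists_dec : ∃ d : M → α, Rec 𝒮 d ∧ ∀ a, d (Enc.enc a) = a

instance : Decodable 𝒮 M := ⟨fun a => a, Rec.id, fun _ => rfl⟩

instance [Decodable 𝒮 α] [Decodable 𝒮 β] : Decodable 𝒮 (α × β) := by
  obtain ⟨d, hd, h⟩ := Decodable.exists_dec (𝒮 := 𝒮) (α := α)
  obtain ⟨d', hd', h'⟩ := Decodable.exists_dec (𝒮 := 𝒮) (α := β)
  exact ⟨fun c => (d (unpairL c), d' (unpairR c)), by fun_prop, fun p => by
    obtain ⟨a, b⟩ := p; simp [enc_prod, h, h']⟩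

/-- Unbounded search. -/
theorem Rec.exists_least [Decodable 𝒮 α] {r : α → M → Prop}
    (hr : Rec 𝒮 (fun x : α × M => r x.1 x.2)) (h : ∀ a, ∃ b, r a b) :
    ∃ f : α → M, Rec 𝒮 f ∧ ∀ a, r a (f a) ∧ ∀ b < f a, ¬ r a b := by
  have least : ∀ a, ∃ b, r a b ∧ ∀ c < b, ¬ r a c := by
    intro a
    obtain ⟨b, hb⟩ := h a
    by_contra! hcon
    have hmem : {x : M | ∃ y, ∃ n, x = InvGoodstein.pair n y ∧ Ball (n + 1) (fun c => ¬ r a c)} ∈ 𝒮 := by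
      have : Rec 𝒮 (fun x : M => Bex (x + 1) fun y => Bex (x + 1) fun n =>
          x = InvGoodstein.pair n y ∧ Ball (n + 1) (fun c => ¬ r a c)) := by fun_prop
      convert this.mem using 1
      ext x
      constructor
      · rintro ⟨y, n, rfl, h⟩
        exact ⟨y, lt_add_one_iff'.2 (le_pair_right _ _), n, lt_add_one_iff'.2 (le_pair_left _ _), rfl, h⟩
      · rintro ⟨y, -, n, -, h⟩; exact ⟨y, n, h⟩
    have := sigma_induction_set hmem (by
      refine ⟨0, 0, 0, rfl, fun i hi hr => ?_⟩
      obtain ⟨c, hc, -⟩ := hcon i hr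
      rw [zero_add] at hi
      exact absurd (hc.trans hi) (by
        have := add_one_le_of_lt (num_nonneg i |>.trans_lt hi)
        have h0 : i ≤ 0 := lt_add_one_iff'.1 (by simpa using hi)
        exact not_lt.2 (by
          have : i = 0 := le_antisymm h0 (num_nonneg i)
          subst this
          exact absurd (hc.trans_le (num_nonneg c)) (lt_irrefl _)))) (by
      rintro n ⟨_, _, _, h1, h2⟩
      rw [pair_inj] at h1
      obtain ⟨rfl, rfl⟩ := h1
      refine ⟨0, 0, _, rfl, fun i hi hr => ?_⟩
      obtain ⟨c, hc, hc'⟩ := hcon i hr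
      exact h2 c (hc.trans_le (lt_add_one_iff'.1 hi)) hc') b
    obtain ⟨_, _, _, h1, h2⟩ := this
    rw [pair_inj] at h1
    obtain ⟨rfl, rfl⟩ := h1
    exact h2 _ (lt_add_one_iff'.2 le_rfl) hb
  choose f hf using least
  refine ⟨f, ?_, hf⟩
  obtain ⟨d, hd, hde⟩ := Decodable.exists_dec (𝒮 := 𝒮) (α := α)
  refine ⟨fun c => f (d c), ?_, fun a => by simp [hde, enc_num]⟩
  -- Minimality makes the graph of f bounded in r, so f itself is a set of the model.
  have key : ∀ a v, v = f a ↔ r a v ∧ Ball v (fun c => ¬ r a c) := by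
    intro a v
    constructor
    · rintro rfl; exact hf a
    · rintro ⟨h1, h2⟩
      rcases lt_trichotomy v (f a) with h3 | h3 | h3
      · exact absurd h1 ((hf a).2 v h3)
      · exact h3
      · exact absurd (hf a).1 (h2 _ h3)
  have : Rec 𝒮 (fun x : M => Bex (x + 1) fun a => Bex (x + 1) fun v =>
          x = InvGoodstein.pair a v ∧ r (d a) v ∧ Ball v (fun c => ¬ r (d a) c)) := by fun_prop
  unfold Total
  convert this.mem using 1
  ext x
  rw [mem_graph_iff]
  simp only [key, Bex, lt_add_one_iff', Set.mem_ofPred_eq]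

theorem Rec.exists_search [Decodable 𝒮 α] {r : α → M → Prop}
    (hr : Rec 𝒮 (fun x : α × M => r x.1 x.2)) (h : ∀ a, ∃ b, r a b) :
    ∃ f : α → M, Rec 𝒮 f ∧ ∀ a, r a (f a) := by
  obtain ⟨f, hf, h⟩ := hr.exists_least h
  exact ⟨f, hf, fun a => (h a).1⟩

include hS in
theorem sigma_induction {p : M → M → Prop} (hp : Rec 𝒮 (fun x : M × M => p x.1 x.2))
    (h0 : ∃ b, p 0 b) (hs : ∀ a, (∃ b, p a b) → ∃ b, p (a + 1) b) (a : M) : ∃ b, p a b := by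
  have h : Rec 𝒮 (fun x : M => p (unpairL x) (unpairR x)) := by fun_prop
  have := sigma_induction_set h.mem (by simpa using h0) (fun a => by simpa using hs a) a
  simpa using this

include hS in
theorem set_induction {p : M → Prop} (hp : Rec 𝒮 p)
    (h0 : p 0) (hs : ∀ a, p a → p (a + 1)) (a : M) : p a := by
  have h : Rec 𝒮 (fun x : M × M => p x.1) := by fun_prop
  obtain ⟨_, h⟩ := sigma_induction (p := fun a _ => p a) h ⟨0, h0⟩ (fun a ⟨_, h⟩ => ⟨0, hs a h⟩) a
  exact h

include hS in
theorem strong_induction {p : M → Prop} (hp : Rec 𝒮 p)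
    (hs : ∀ a, (∀ b < a, p b) → p a) (a : M) : p a := by
  have h : Rec 𝒮 (fun n : M => Ball n p) := by fun_prop
  refine hs a (set_induction h (fun i hi => absurd hi (not_lt.2 (num_nonneg i))) (fun n hn i hi => ?_) a)
  exact hs i (fun b hb => hn b (hb.trans_le (lt_add_one_iff'.1 hi)))

include hS in
theorem strong_induction_two {p : M × M → Prop} (hp : Rec 𝒮 p)
    (hs : ∀ a b, (∀ a' b', a' + b' < a + b → p (a', b')) → p (a, b)) (a b : M) : p (a, b) := by
  have h : Rec 𝒮 (fun n : M => Ball (n + 1) fun a => Ball (n + 1) fun b =>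
      Imp (a + b = n) (p (a, b))) := by
    fun_prop
  refine strong_induction h (fun n hn a _ b _ hab => hs a b fun a' b' hab' => ?_) (a + b) a
    (lt_add_one_iff'.2 le_self_add) b (lt_add_one_iff'.2 le_add_self) rfl
  rw [hab] at hab'
  exact hn _ hab' a' (lt_add_one_iff'.2 le_self_add) b' (lt_add_one_iff'.2 le_add_self) rfl

include hS in
theorem strong_induction_three {p : M × M × M → Prop} (hp : Rec 𝒮 p)
    (hs : ∀ a b c, (∀ a' b' c', a' + b' + c' < a + b + c → p (a', b', c')) → p (a, b, c))
    (a b c : M) : p (a, b, c) := by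
  have h : Rec 𝒮 (fun n : M => Ball (n + 1) fun a => Ball (n + 1) fun b => Ball (n + 1) fun c =>
      Imp (a + b + c = n) (p (a, b, c))) := by
    fun_prop
  have h1 : ∀ {a b c : M}, a < a + b + c + 1 := fun {a b c} => by
    rw [lt_add_one_iff', add_assoc]; exact le_self_add
  have h2 : ∀ {a b c : M}, b < a + b + c + 1 := fun {a b c} => by
    rw [lt_add_one_iff', add_comm a b, add_assoc]; exact le_self_add
  have h3 : ∀ {a b c : M}, c < a + b + c + 1 := fun {a b c} => by
    rw [lt_add_one_iff']; exact le_add_self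
  refine strong_induction h (fun n hn a _ b _ c _ habc => hs a b c fun a' b' c' hab' => ?_)
    (a + b + c) a h1 b h2 c h3 rfl
  rw [habc] at hab'
  exact hn _ hab' a' h1 b' h2 c' h3 rfl

end Rec

/-! ### Codes for finite sets and functions, and recursion along the numbers. -/

section FiniteSets

variable {M : Type*} [CommSemiring M] [LinearOrder M] [IsStrictOrderedRing M]
    [CanonicallyOrderedAdd M] [DiscreteNumbers M] {𝒮 : Set (Set M)} [hS : Fact (ModelsRCA0 𝒮)]

theorem dvd_of_dvd_add {a b c : M} (h : a ∣ b + c) (h' : a ∣ b) : a ∣ c := by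
  obtain ⟨k, hk⟩ := h
  obtain ⟨l, rfl⟩ := h'
  rcases le_total l k with hl | hl
  · obtain ⟨d, rfl⟩ := le_iff_exists_add.1 hl
    rw [mul_add] at hk
    exact ⟨d, add_left_cancel hk⟩
  · obtain ⟨d, rfl⟩ := le_iff_exists_add.1 hl
    rw [mul_add, add_assoc] at hk
    have h0 : a * d + c = 0 := by
      have : a * k + (a * d + c) = a * k + 0 := by rw [hk, add_zero]
      exact add_left_cancel this
    rw [add_eq_zero] at h0
    rw [h0.2]
    exact dvd_zero a

theorem le_of_dvd' {a b : M} (h : a ∣ b) (hb : b ≠ 0) : a ≤ b := by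
  obtain ⟨k, rfl⟩ := h
  obtain ⟨l, rfl⟩ := exists_eq_add_one (right_ne_zero_of_mul hb)
  rw [mul_add, mul_one]
  exact le_add_self

/-- The moduli used for coding finite sets. -/
def modulus (p x : M) : M := 1 + (x + 1) * p

/-- The moduli are pairwise coprime, as in Gödel's β-function: their difference is a multiple (d+1)p
of p, and d+1 divides p, so (d+1)p divides p², which is invertible modulo 1 + (x+1)p. The argument
is arranged without subtraction and without primes. -/
theorem modulus_euclid {N p x y m : M} (hp : 0 < p) (hN : ∀ i < N, i + 1 ∣ p) (hx : x < N)
    (hy : y < N) (hxy : x ≠ y) (h : modulus p x ∣ m * modulus p y) : modulus p x ∣ m := by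
  have hw : ∀ z : M, ∃ w, (z + 1) * p = w + 1 := fun z => exists_eq_add_one (by
    have : 0 < z + 1 := lt_of_le_of_lt (num_nonneg z) (lt_add_one_iff'.2 le_rfl)
    exact (mul_pos this hp).ne')
  rcases lt_or_gt_of_ne hxy with hlt | hlt
  · obtain ⟨e, rfl⟩ := le_iff_exists_add.1 hlt.le
    have he : e ≠ 0 := by rintro rfl; simp at hlt
    obtain ⟨d, rfl⟩ := exists_eq_add_one he
    obtain ⟨q, hq⟩ := hN d (lt_of_lt_of_le (lt_add_one_iff'.2 le_rfl) ((le_add_self).trans hy.le))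
    obtain ⟨w, hw⟩ := hw x
    have key : m * modulus p (x + (d + 1)) * (q * (x + 1) ^ 2)
        = modulus p x * (m * (q * (x + 1) ^ 2 + w)) + m := by
      have e1 : modulus p (x + (d + 1)) = modulus p x + (d + 1) * p := by unfold modulus; ring
      -- With (x+1)p = w+1 the modulus is w+2, and (w+1)² = (w+2)w + 1. This is the congruence (−1)²
      -- = 1.
      have e2 : (d + 1) * p * (q * (x + 1) ^ 2) = modulus p x * w + 1 := by
        have : (d + 1) * p * (q * (x + 1) ^ 2) = (x + 1) * ((d + 1) * q) * ((x + 1) * p) := by ring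
        rw [this, ← hq, hw]
        unfold modulus
        rw [hw]; ring
      rw [e1]
      calc m * (modulus p x + (d + 1) * p) * (q * (x + 1) ^ 2)
          = m * (modulus p x * (q * (x + 1) ^ 2) + (d + 1) * p * (q * (x + 1) ^ 2)) := by ring
        _ = _ := by rw [e2]; ring
    have h1 : modulus p x ∣ m * modulus p (x + (d + 1)) * (q * (x + 1) ^ 2) := h.mul_right _
    rw [key] at h1
    exact dvd_of_dvd_add h1 (dvd_mul_right _ _)
  · obtain ⟨e, rfl⟩ := le_iff_exists_add.1 hlt.le
    have he : e ≠ 0 := by rintro rfl; simp at hlt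
    obtain ⟨d, rfl⟩ := exists_eq_add_one he
    obtain ⟨q, hq⟩ := hN d (lt_of_lt_of_le (lt_add_one_iff'.2 le_rfl) ((le_add_self).trans hx.le))
    obtain ⟨w, hw⟩ := hw y
    have key : modulus p (y + (d + 1)) * (m * (q * (y + 1) ^ 2))
        = (m * modulus p y) * (q * (y + 1) ^ 2 + w) + m := by
      have e1 : modulus p (y + (d + 1)) = modulus p y + (d + 1) * p := by unfold modulus; ring
      have e2 : (d + 1) * p * (q * (y + 1) ^ 2) = modulus p y * w + 1 := by
        have : (d + 1) * p * (q * (y + 1) ^ 2) = (y + 1) * ((d + 1) * q) * ((y + 1) * p) := by ring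
        rw [this, ← hq, hw]
        unfold modulus
        rw [hw]; ring
      rw [e1]
      calc (modulus p y + (d + 1) * p) * (m * (q * (y + 1) ^ 2))
          = m * (modulus p y * (q * (y + 1) ^ 2) + (d + 1) * p * (q * (y + 1) ^ 2)) := by ring
        _ = _ := by rw [e2]; ring
    have h1 : modulus p (y + (d + 1)) ∣ modulus p (y + (d + 1)) * (m * (q * (y + 1) ^ 2)) :=
      dvd_mul_right _ _
    rw [key] at h1
    exact dvd_of_dvd_add h1 (h.mul_right _)

/-- Membership in a coded finite set. -/
def InCode (x s : M) : Prop := modulus (unpairR s) x ∣ unpairL s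

variable {α : Type*} [Enc M α]

@[fun_prop]
theorem Rec.dvd {f g : α → M} (hf : Rec 𝒮 f) (hg : Rec 𝒮 g) : Rec 𝒮 (fun a => f a ∣ g a) := by
  have : Rec 𝒮 (fun a => Bex (g a + 1) fun k => g a = f a * k) := by fun_prop
  refine this.of_iff fun a => ?_
  constructor
  · rintro ⟨k, hk⟩
    by_cases h0 : g a = 0
    · exact ⟨0, by simp [h0], by simp [h0]⟩
    · exact ⟨k, lt_add_one_iff'.2 (le_of_dvd' ⟨f a, by rw [hk, mul_comm]⟩ h0), hk⟩
  · rintro ⟨k, -, hk⟩; exact ⟨k, hk⟩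

@[fun_prop]
theorem Rec.inCode {f g : α → M} (hf : Rec 𝒮 f) (hg : Rec 𝒮 g) :
    Rec 𝒮 (fun a => InCode (f a) (g a)) := by
  unfold InCode modulus
  fun_prop

include hS in
theorem exists_common_multiple (N : M) : ∃ p : M, 0 < p ∧ ∀ i < N, i + 1 ∣ p := by
  have h : Rec 𝒮 (fun x : M × M => 0 < x.2 ∧ Ball x.1 fun i => i + 1 ∣ x.2) := by fun_prop
  refine sigma_induction (p := fun N p => 0 < p ∧ Ball N fun i => i + 1 ∣ p) h ?_ ?_ N
  · exact ⟨1, zero_lt_one, fun i hi => absurd hi (not_lt.2 (num_nonneg i))⟩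
  · rintro n ⟨p, hp, h⟩
    have : 0 < n + 1 := lt_of_le_of_lt (num_nonneg n) (lt_add_one_iff'.2 le_rfl)
    refine ⟨p * (n + 1), mul_pos hp this, fun i hi => ?_⟩
    rcases eq_or_lt_of_le (lt_add_one_iff'.1 hi) with rfl | hi
    · exact dvd_mul_left _ _
    · exact (h i hi).mul_right _

/-- The code is the product of the moduli of the elements, built by Σ⁰₁-induction on the number of
candidates treated so far; coprimality ensures that no further modulus divides it. The final clause
bounds quantifiers over coded elements. -/
theorem exists_set_code {q : M → Prop} (hq : Rec 𝒮 q) (N : M) :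
    ∃ s : M, (∀ x < N, InCode x s ↔ q x) ∧ ∀ x, InCode x s → x ≤ s := by
  obtain ⟨p, hp, hpN⟩ := exists_common_multiple (𝒮 := 𝒮) N
  have h : Rec 𝒮 (fun a : M × M => Imp (a.1 ≤ N) (a.2 ≠ 0 ∧
    Ball N fun x => modulus p x ∣ a.2 ↔ x < a.1 ∧ q x)) := by
    unfold modulus
    simp only [ne_eq]
    fun_prop
  have key : ∃ m, Imp (N ≤ N) (m ≠ 0 ∧ Ball N fun x => modulus p x ∣ m ↔ x < N ∧ q x) := by
    refine sigma_induction (p := fun n m => Imp (n ≤ N) (m ≠ 0 ∧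
      Ball N fun x => modulus p x ∣ m ↔ x < n ∧ q x)) h ?_ ?_ N
    · refine ⟨1, fun _ => ⟨one_ne_zero, fun x _ => ⟨fun h1 => ?_, fun h1 => ?_⟩⟩⟩
      · have h2 := le_of_dvd' h1 one_ne_zero
        have h3 : 0 < (x + 1) * p :=
          mul_pos (lt_of_le_of_lt (num_nonneg x) (lt_add_one_iff'.2 le_rfl)) hp
        have h4 : 1 < modulus p x := lt_add_of_pos_right _ h3
        exact absurd h2 (not_le.2 h4)
      · exact absurd h1.1 (not_lt.2 (num_nonneg x))
    · rintro n ⟨m, hm⟩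
      by_cases hn : n < N
      · obtain ⟨hm0, hm'⟩ := hm hn.le
        have hm : ∀ x < N, modulus p x ∣ m ↔ x < n ∧ q x := hm'
        by_cases hqn : q n
        · refine ⟨m * modulus p n, fun _ => ⟨mul_ne_zero hm0 ?_, fun x hx => ?_⟩⟩
          · unfold modulus; simp [add_eq_zero]
          · rcases eq_or_ne x n with rfl | hxn
            · simp [hqn, lt_add_one_iff']
            · rw [lt_add_one_iff', show x ≤ n ↔ x < n from
                ⟨fun h => lt_of_le_of_ne h hxn, le_of_lt⟩, ← hm x hx]
              exact ⟨modulus_euclid hp hpN hx hn hxn, fun h => h.mul_right _⟩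
        · refine ⟨m, fun _ => ⟨hm0, fun x hx => ?_⟩⟩
          beta_reduce
          rw [hm x hx, lt_add_one_iff']
          constructor
          · exact fun h => ⟨h.1.le, h.2⟩
          · rintro ⟨h1, h2⟩
            refine ⟨lt_of_le_of_ne h1 ?_, h2⟩
            rintro rfl; exact hqn h2
      · exact ⟨0, fun h => absurd (lt_of_lt_of_le (lt_add_one_iff'.2 le_rfl) h) hn⟩
  obtain ⟨m, hm⟩ := key
  obtain ⟨hm0, hm⟩ := hm le_rfl
  refine ⟨pair m p, fun x hx => ?_, fun x hx => ?_⟩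
  · simp only [InCode, unpairL_pair, unpairR_pair]
    have := hm x hx
    simp only [hx, true_and] at this
    exact this
  · simp only [InCode, unpairL_pair, unpairR_pair] at hx
    refine le_trans ?_ (le_pair_left _ _)
    refine le_trans ?_ (le_of_dvd' hx hm0)
    obtain ⟨r, rfl⟩ := exists_eq_add_one hp.ne'
    have : modulus (r + 1) x = x + (1 + x * r + r + 1) := by unfold modulus; ring
    rw [this]
    exact le_self_add

include hS in
theorem exists_least_of {p : M → Prop} (hp : Rec 𝒮 p) (h : ∃ b, p b) :
    ∃ b, p b ∧ ∀ c < b, ¬ p c := by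
  by_contra! hcon
  have : ∀ b, ¬ p b := strong_induction hp.not (fun a ih ha => by
    obtain ⟨c, hc, hpc⟩ := hcon a ha
    exact ih c hc hpc)
  exact this _ h.choose_spec

/-- The value at `i` of the finite function coded by `s` is `v`. -/
def IsApp (s i v : M) : Prop :=
  v ≤ s ∧ InCode (pair i v) s ∧ Ball v fun w => ¬ InCode (pair i w) s

open Classical in
/-- Application of coded finite functions. -/
noncomputable def app (s i : M) : M := if h : ∃ v, IsApp s i v then h.choose else 0

theorem IsApp.unique {s i v w : M} (h : IsApp s i v) (h' : IsApp s i w) : v = w := by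
  rcases lt_trichotomy v w with h1 | h1 | h1
  · exact absurd h.2.1 (h'.2.2 _ h1)
  · exact h1
  · exact absurd h'.2.1 (h.2.2 _ h1)

theorem IsApp.app_eq {s i v : M} (h : IsApp s i v) : app s i = v := by
  have h' : ∃ v, IsApp s i v := ⟨v, h⟩
  unfold app
  rw [dif_pos h']
  exact h'.choose_spec.unique h

theorem app_of_not {s i : M} (h : ¬ ∃ v, IsApp s i v) : app s i = 0 := by
  unfold app; rw [dif_neg h]

theorem rec_app : Rec 𝒮 (fun q : M × M => app q.1 q.2) := by
  have h : Rec 𝒮 (fun x : (M × M) × M => IsApp x.1.1 x.1.2 x.2 ∨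
      (x.2 = 0 ∧ Ball (x.1.1 + 1) fun w => ¬ IsApp x.1.1 x.1.2 w)) := by
    unfold IsApp
    fun_prop
  obtain ⟨f, hf, hspec⟩ := Rec.exists_search (r := fun (a : M × M) (v : M) => IsApp a.1 a.2 v ∨
      (v = 0 ∧ Ball (a.1 + 1) fun w => ¬ IsApp a.1 a.2 w)) h (fun a => by
    by_cases h' : ∃ v, IsApp a.1 a.2 v
    · obtain ⟨v, hv⟩ := h'; exact ⟨v, Or.inl hv⟩
    · push Not at h'
      exact ⟨0, Or.inr ⟨rfl, fun w _ => h' w⟩⟩)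
  have : f = fun q : M × M => app q.1 q.2 := by
    funext a
    rcases hspec a with h' | ⟨h1, h2⟩
    · exact h'.app_eq.symm
    · rw [h1, app_of_not]
      rintro ⟨v, hv⟩
      exact h2 v (lt_add_one_iff'.2 hv.1) hv
  rwa [← this]

@[fun_prop]
theorem Rec.app {f g : α → M} (hf : Rec 𝒮 f) (hg : Rec 𝒮 g) : Rec 𝒮 (fun a => app (f a) (g a)) :=
  rec_app.comp (hf.prodMk hg)

theorem exists_bound {f : M → M} (hf : Rec 𝒮 f) (n : M) : ∃ B, ∀ i < n, f i ≤ B := by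
  have h : Rec 𝒮 (fun x : M × M => Ball x.1 fun i => f i ≤ x.2) := by fun_prop
  refine sigma_induction (p := fun n B => Ball n fun i => f i ≤ B) h
    ⟨0, fun i hi => absurd hi (not_lt.2 (num_nonneg i))⟩ ?_ n
  rintro n ⟨B, hB⟩
  refine ⟨B + f n, fun i hi => ?_⟩
  rcases eq_or_lt_of_le (lt_add_one_iff'.1 hi) with rfl | hi
  · exact le_add_self
  · exact (hB i hi).trans le_self_add

theorem exists_code {f : M → M} (hf : Rec 𝒮 f) (n : M) : ∃ s, ∀ i < n, app s i = f i := by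
  obtain ⟨B, hB⟩ := exists_bound hf n
  have hq : Rec 𝒮 (fun x : M => f (unpairL x) = unpairR x) := by fun_prop
  obtain ⟨s, hs, hs'⟩ := exists_set_code hq (pair n B)
  refine ⟨s, fun i hi => IsApp.app_eq ?_⟩
  have hlt : ∀ v ≤ f i, pair i v < pair n B := fun v hv =>
    pair_lt_pair (add_lt_add_of_lt_of_le hi (hv.trans (hB i hi)))
  have h1 : InCode (pair i (f i)) s := by rw [hs _ (hlt _ le_rfl)]; simp
  refine ⟨(le_pair_right _ _).trans (hs' _ h1), h1, fun w hw => ?_⟩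
  beta_reduce
  rw [hs _ (hlt _ hw.le)]
  simp [hw.ne']

/-- The relation R states which values v are admissible at n, given the earlier values in s.
Admissible values need to exist only if all earlier values were admissible, so correctness can be
maintained along the recursion. Choosing the least admissible value makes any two correct segments
agree, and Σ⁰₁-induction provides segments of every length. -/
theorem exists_course_of_values {R : M → M → M → Prop}
    (hR : Rec 𝒮 (fun q : M × M × M => R q.1 q.2.1 q.2.2))
    (hloc : ∀ n s s' v, (∀ i < n, app s i = app s' i) → R n s v → R n s' v)
    (htot : ∀ n s, (∀ i < n, R i s (app s i)) → ∃ v, R n s v) :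
    ∃ f : M → M, Rec 𝒮 f ∧ ∀ n, ∃ s, (∀ i < n, app s i = f i) ∧ R n s (f n) := by
  set good : M → M → Prop := fun n s => Ball n fun i =>
    R i s (app s i) ∧ Ball (app s i) fun w => ¬ R i s w with hgood
  have hrec : Rec 𝒮 (fun q : M × M => good q.1 q.2) := by
    have h1 : ∀ {γ : Type _} [Enc M γ] (a b c : γ → M), Rec 𝒮 a → Rec 𝒮 b → Rec 𝒮 c →
      Rec 𝒮 (fun x => R (a x) (b x) (c x)) := fun a b c ha hb hc => hR.comp (ha.prodMk (hb.prodMk hc))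
    simp only [hgood]
    refine Rec.ball (by fun_prop) (Rec.and (h1 _ _ _ (by fun_prop) (by fun_prop) (by fun_prop)) ?_)
    exact Rec.ball (by fun_prop) (h1 _ _ _ (by fun_prop) (by fun_prop) (by fun_prop)).not
  have hex : ∀ n, ∃ s, good n s := by
    refine sigma_induction (p := good) hrec
      ⟨0, fun i hi => absurd hi (not_lt.2 (num_nonneg i))⟩ ?_
    rintro n ⟨s, hs⟩
    have h1 : Rec 𝒮 (fun v => R n s v) := by fun_prop
    obtain ⟨v, hv, hv'⟩ := exists_least_of h1 (htot n s fun i hi => (hs i hi).1)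
    have h2 : Rec 𝒮 (fun i => Cond (i < n) (app s i) v) := by fun_prop
    obtain ⟨s', hs'⟩ := exists_code h2 (n + 1)
    have hlt : ∀ i < n, app s' i = app s i := fun i hi => by
      rw [hs' i (hi.trans (lt_add_one_iff'.2 le_rfl)), cond_pos hi]
    have heq : app s' n = v := by
      rw [hs' n (lt_add_one_iff'.2 le_rfl), cond_neg (lt_irrefl n)]
    refine ⟨s', fun i hi => ?_⟩
    rcases eq_or_lt_of_le (lt_add_one_iff'.1 hi) with rfl | hi
    · rw [heq]
      exact ⟨hloc _ _ _ _ (fun j hj => (hlt j hj).symm) hv, fun w hw h =>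
        hv' w hw (hloc _ _ _ _ hlt h)⟩
    · rw [hlt i hi]
      have h3 : ∀ j < i, app s' j = app s j := fun j hj => hlt j (hj.trans hi)
      exact ⟨hloc _ _ _ _ (fun j hj => (h3 j hj).symm) (hs i hi).1, fun w hw h =>
        (hs i hi).2 w hw (hloc _ _ _ _ h3 h)⟩
  -- Agreement of segments makes the final function independent of the code that the search happens
  -- to find.
  have huniq : ∀ n s n' s', good n s → good n' s' → ∀ i, i < n → i < n' → app s i = app s' i := by
    intro n s n' s' h h'
    have h1 : Rec 𝒮 (fun i => Imp (i < n) (Imp (i < n') (app s i = app s' i))) := by fun_prop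
    refine strong_induction h1 (fun i ih hi hi' => ?_)
    have hag : ∀ j < i, app s j = app s' j := fun j hj => ih j hj (hj.trans hi) (hj.trans hi')
    rcases lt_trichotomy (app s i) (app s' i) with h2 | h2 | h2
    · exact absurd (hloc _ _ _ _ hag (h i hi).1) ((h' i hi').2 _ h2)
    · exact h2
    · exact absurd (hloc _ _ _ _ (fun j hj => (hag j hj).symm) (h' i hi').1) ((h i hi).2 _ h2)
  have h1 : Rec 𝒮 (fun q : M × M => good (q.1 + 1) q.2) := by fun_prop
  obtain ⟨g, hg, hgs⟩ := Rec.exists_search (r := fun n s => good (n + 1) s) h1 (fun n => hex (n + 1))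
  refine ⟨fun n => app (g n) n, by fun_prop, fun n => ⟨g n, fun i hi => ?_, ?_⟩⟩
  · exact huniq _ _ _ _ (hgs n) (hgs i) i (hi.trans (lt_add_one_iff'.2 le_rfl))
      (lt_add_one_iff'.2 le_rfl)
  · exact (hgs n n (lt_add_one_iff'.2 le_rfl)).1

theorem exists_recursion {F : (M → M) → M → M} (hF : Rec 𝒮 (fun q : M × M => F (app q.1) q.2))
    (hloc : ∀ g g' n, (∀ i < n, g i = g' i) → F g n = F g' n) :
    ∃ f : M → M, Rec 𝒮 f ∧ ∀ n, f n = F f n := by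
  have h : Rec 𝒮 (fun q : M × M × M => q.2.2 = F (app q.2.1) q.1) := by
    have : Rec 𝒮 (fun q : M × M × M => F (app q.2.1) q.1) :=
      hF.comp (g := fun q : M × M × M => (q.2.1, q.1)) (by fun_prop)
    exact Rec.eq (by fun_prop) this
  obtain ⟨f, hf, h⟩ := exists_course_of_values (R := fun n s v => v = F (app s) n) h
    (fun n s s' v h1 h2 => by rw [h2]; exact hloc _ _ _ h1) (fun n s _ => ⟨_, rfl⟩)
  refine ⟨f, hf, fun n => ?_⟩
  obtain ⟨s, h1, h2⟩ := h n
  rw [h2]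
  exact hloc _ _ _ h1

theorem exists_recursion_two {F : (M → M → M) → M → M → M}
    (hF : Rec 𝒮 (fun q : M × M × M => F (fun i j => app q.1 (pair i j)) q.2.1 q.2.2))
    (hloc : ∀ g g' a b, (∀ i j, i + j < a + b → g i j = g' i j) → F g a b = F g' a b) :
    ∃ f : M → M → M, Rec 𝒮 (fun q : M × M => f q.1 q.2) ∧ ∀ a b, f a b = F f a b := by
  have hlt : ∀ {a b i j : M}, i + j < a + b → pair i j < pair a b := pair_lt_pair
  obtain ⟨f, hf, h⟩ := exists_recursion (𝒮 := 𝒮)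
    (F := fun g n => Cond (n = pair (unpairL n) (unpairR n))
      (F (fun i j => g (pair i j)) (unpairL n) (unpairR n)) 0)
    (by
      have := hF.comp (g := fun q : M × M => (q.1, unpairL q.2, unpairR q.2)) (by fun_prop)
      exact Rec.cond (by fun_prop) this (Rec.const 0))
    (fun g g' n h => by
      by_cases hn : n = pair (unpairL n) (unpairR n)
      · rw [cond_pos hn, cond_pos hn]
        refine hloc _ _ _ _ fun i j hij => h _ ?_
        rw [hn]
        exact hlt hij
      · rw [cond_neg hn, cond_neg hn])
  refine ⟨fun i j => f (pair i j), by fun_prop, fun a b => ?_⟩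
  beta_reduce
  conv_lhs => rw [h]
  simp only [unpairL_pair, unpairR_pair, cond_true']

/-- Recursive calls must lower the sum of the arguments. Truth values are stored as 1 and 0. Unary
predicates are treated below by adding a second argument that stays fixed. -/
theorem exists_relation {F : (M → M → Prop) → M → M → Prop}
    (hF : Rec 𝒮 (fun q : M × M × M => F (fun i j => app q.1 (pair i j) = 1) q.2.1 q.2.2))
    (hloc : ∀ g g' a b, (∀ i j, i + j < a + b → (g i j ↔ g' i j)) → F g a b → F g' a b) :
    ∃ f : M → M → Prop, Rec 𝒮 (fun q : M × M => f q.1 q.2) ∧ ∀ a b, f a b ↔ F f a b := by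
  obtain ⟨f, hf, h⟩ := exists_recursion_two (𝒮 := 𝒮)
    (F := fun g a b => Cond (F (fun i j => g i j = 1) a b) 1 0)
    (Rec.cond hF (Rec.const 1) (Rec.const 0))
    (fun g g' a b h => by
      have : F (fun i j => g i j = 1) a b = F (fun i j => g' i j = 1) a b :=
        propext ⟨hloc _ _ _ _ (fun i j hij => by rw [h i j hij]),
          hloc _ _ _ _ (fun i j hij => by rw [h i j hij])⟩
      rw [this])
  refine ⟨fun a b => f a b = 1, hf.eq (Rec.const 1), fun a b => ?_⟩
  beta_reduce
  conv_lhs => rw [h]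
  by_cases h1 : F (fun i j => f i j = 1) a b
  · simp [h1]
  · simp [h1]

end FiniteSets

/-! ### Coded sequences, supports, and lexicographic orders on Goodstein terms. -/

section Codes

variable {M : Type*} [CommSemiring M] [LinearOrder M] [IsStrictOrderedRing M]
    [CanonicallyOrderedAdd M] [DiscreteNumbers M] {𝒮 : Set (Set M)} [hS : Fact (ModelsRCA0 𝒮)]

open Classical in
/-- The predecessor function. -/
noncomputable def predecessor (s : M) : M := if h : ∃ c, s = c + 1 then h.choose else 0

@[simp] theorem predecessor_add_one (c : M) : predecessor (c + 1) = c := by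
  have h : ∃ c', c + 1 = c' + 1 := ⟨c, rfl⟩
  unfold predecessor
  rw [dif_pos h]
  exact (add_right_cancel h.choose_spec).symm

theorem rec_predecessor : Rec 𝒮 (predecessor : M → M) := by
  have h : Rec 𝒮 (fun x : M × M => x.1 = x.2 + 1 ∨ (x.1 = 0 ∧ x.2 = 0)) := by fun_prop
  obtain ⟨f, hf, hspec⟩ := Rec.exists_search (r := fun a v => a = v + 1 ∨ (a = 0 ∧ v = 0)) h
    (fun a => by
      by_cases h : a = 0
      · exact ⟨0, Or.inr ⟨h, rfl⟩⟩
      · obtain ⟨b, rfl⟩ := exists_eq_add_one h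
        exact ⟨b, Or.inl rfl⟩)
  have : f = predecessor := by
    funext a
    rcases hspec a with h | ⟨h1, h2⟩
    · conv_rhs => rw [h]
      simp
    · rw [h2, h1]
      unfold predecessor
      rw [dif_neg]
      rintro ⟨c, hc⟩
      exact absurd hc.symm (by simp [add_eq_zero])
  rwa [← this]

variable {α : Type*} [Enc M α]

@[fun_prop]
theorem Rec.predecessor {f : α → M} (hf : Rec 𝒮 f) : Rec 𝒮 (fun a => predecessor (f a)) :=
  rec_predecessor.comp hf

/-- First entry of a coded sequence. -/
noncomputable def car (l : M) : M := unpairL (predecessor l)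

/-- Tail of a coded sequence. -/
noncomputable def cdr (l : M) : M := unpairR (predecessor l)

@[simp] theorem car_cons (a l : M) : car (cons a l) = a := by simp [car, cons]
@[simp] theorem cdr_cons (a l : M) : cdr (cons a l) = l := by simp [cdr, cons]

@[simp] theorem cons_inj {a l b k : M} : cons a l = cons b k ↔ a = b ∧ l = k := by
  unfold cons
  rw [add_left_inj, pair_inj]

@[simp] theorem cons_ne_nil {a l : M} : cons a l ≠ nil := by simp [cons, nil, add_eq_zero]
@[simp] theorem nil_ne_cons {a l : M} : nil ≠ cons a l := cons_ne_nil.symm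

theorem add_lt_cons (a l : M) : a + l < cons a l := lt_add_one_iff'.2 (add_le_pair a l)
theorem lt_cons_left (a l : M) : a < cons a l := lt_of_le_of_lt le_self_add (add_lt_cons a l)
theorem lt_cons_right (a l : M) : l < cons a l := lt_of_le_of_lt le_add_self (add_lt_cons a l)

/-- Leading exponent of a Goodstein term. -/
noncomputable def gexp (s : M) : M := unpairL (car s)

/-- Leading coefficient of a Goodstein term. -/
noncomputable def gcoef (s : M) : M := unpairR (car s)

@[simp] theorem gexp_gcons (γ δ r : M) : gexp (gcons γ δ r) = γ := by simp [gexp, gcons]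
@[simp] theorem gcoef_gcons (γ δ r : M) : gcoef (gcons γ δ r) = δ := by simp [gcoef, gcons]
@[simp] theorem cdr_gcons (γ δ r : M) : cdr (gcons γ δ r) = r := by simp [gcons]

@[simp] theorem gcons_inj {γ δ r γ' δ' r' : M} :
    gcons γ δ r = gcons γ' δ' r' ↔ γ = γ' ∧ δ = δ' ∧ r = r' := by
  simp [gcons, pair_inj, and_assoc]

@[simp] theorem gcons_ne_nil {γ δ r : M} : gcons γ δ r ≠ nil := cons_ne_nil
@[simp] theorem nil_ne_gcons {γ δ r : M} : nil ≠ gcons γ δ r := nil_ne_cons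

theorem add_lt_gcons (γ δ r : M) : γ + δ + r < gcons γ δ r :=
  lt_of_le_of_lt (add_le_add_left (add_le_pair γ δ) r) (add_lt_cons _ _)

theorem exp_lt_gcons (γ δ r : M) : γ < gcons γ δ r :=
  lt_of_le_of_lt (by rw [add_assoc]; exact le_self_add) (add_lt_gcons γ δ r)
theorem coef_lt_gcons (γ δ r : M) : δ < gcons γ δ r :=
  lt_of_le_of_lt (by rw [add_comm γ, add_assoc]; exact le_self_add) (add_lt_gcons γ δ r)
theorem tail_lt_gcons (γ δ r : M) : r < gcons γ δ r :=
  lt_of_le_of_lt le_add_self (add_lt_gcons γ δ r)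

@[fun_prop]
theorem Rec.car {f : α → M} (hf : Rec 𝒮 f) : Rec 𝒮 (fun a => car (f a)) := by
  unfold InvGoodstein.car; fun_prop

@[fun_prop]
theorem Rec.cdr {f : α → M} (hf : Rec 𝒮 f) : Rec 𝒮 (fun a => cdr (f a)) := by
  unfold InvGoodstein.cdr; fun_prop

@[fun_prop]
theorem Rec.gexp {f : α → M} (hf : Rec 𝒮 f) : Rec 𝒮 (fun a => gexp (f a)) := by
  unfold InvGoodstein.gexp; fun_prop

@[fun_prop]
theorem Rec.gcoef {f : α → M} (hf : Rec 𝒮 f) : Rec 𝒮 (fun a => gcoef (f a)) := by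
  unfold InvGoodstein.gcoef; fun_prop

@[fun_prop]
theorem Rec.cons {f g : α → M} (hf : Rec 𝒮 f) (hg : Rec 𝒮 g) :
    Rec 𝒮 (fun a => cons (f a) (g a)) := by
  unfold InvGoodstein.cons; fun_prop

@[fun_prop]
theorem Rec.gcons {f g h : α → M} (hf : Rec 𝒮 f) (hg : Rec 𝒮 g) (hh : Rec 𝒮 h) :
    Rec 𝒮 (fun a => gcons (f a) (g a) (h a)) := by
  unfold InvGoodstein.gcons; fun_prop

/-- The number codes a nonempty sequence. -/
def IsCons (l : M) : Prop := l = cons (car l) (cdr l)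

theorem isCons_iff {l : M} : IsCons l ↔ ∃ a k, l = cons a k :=
  ⟨fun h => ⟨_, _, h⟩, by rintro ⟨a, k, rfl⟩; simp [IsCons]⟩

@[simp] theorem isCons_cons (a l : M) : IsCons (cons a l) := by simp [IsCons]
@[simp] theorem not_isCons_nil : ¬ IsCons (nil : M) := by simp [IsCons]

@[fun_prop]
theorem Rec.isCons {f : α → M} (hf : Rec 𝒮 f) : Rec 𝒮 (fun a => IsCons (f a)) := by
  unfold IsCons; fun_prop

/-- The number is of the form `gcons γ δ r`. -/
def IsG (s : M) : Prop := s = gcons (gexp s) (gcoef s) (cdr s)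

theorem isG_iff {s : M} : IsG s ↔ ∃ γ δ r, s = gcons γ δ r :=
  ⟨fun h => ⟨_, _, _, h⟩, by rintro ⟨a, k, r, rfl⟩; simp [IsG]⟩

@[simp] theorem isG_gcons (γ δ r : M) : IsG (gcons γ δ r) := by simp [IsG]
@[simp] theorem not_isG_nil : ¬ IsG (nil : M) := by simp [IsG]

theorem IsG.exp_lt {s : M} (h : IsG s) : gexp s < s := by
  conv_rhs => rw [h]
  exact exp_lt_gcons _ _ _
theorem IsG.coef_lt {s : M} (h : IsG s) : gcoef s < s := by
  conv_rhs => rw [h]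
  exact coef_lt_gcons _ _ _
theorem IsG.tail_lt {s : M} (h : IsG s) : cdr s < s := by
  conv_rhs => rw [h]
  exact tail_lt_gcons _ _ _
theorem IsCons.car_lt {s : M} (h : IsCons s) : car s < s := by
  conv_rhs => rw [h]
  exact lt_cons_left _ _

@[fun_prop]
theorem Rec.isG {f : α → M} (hf : Rec 𝒮 f) : Rec 𝒮 (fun a => IsG (f a)) := by
  unfold IsG; fun_prop

/-! ### Supports -/

theorem exists_supp : ∃ P : M → M → Prop, Rec 𝒮 (fun q : M × M => P q.1 q.2) ∧ IsSupp P := by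
  obtain ⟨P, hP, h⟩ := exists_relation (𝒮 := 𝒮)
    (F := fun g x s => IsG s ∧ (g x (gexp s) ∨ x = gcoef s ∨ g x (cdr s))) (by fun_prop)
    (fun g g' x s h => by
      rintro ⟨hs, h'⟩
      refine ⟨hs, ?_⟩
      rwa [← h x _ (by gcongr; exact hs.exp_lt), ← h x _ (by gcongr; exact hs.tail_lt)])
  refine ⟨P, hP, fun x s => ?_⟩
  rw [h]
  constructor
  · rintro ⟨h1, h2⟩; exact ⟨_, _, _, h1, h2⟩
  · rintro ⟨γ, δ, r, rfl, h2⟩; simpa using h2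

theorem codedRel_iff {R : M → M → Prop} : CodedRel 𝒮 R ↔ Rec 𝒮 (fun q : M × M => R q.1 q.2) := by
  constructor
  · intro h
    exact recP_of_mem h (fun q => by
      obtain ⟨a, b⟩ := q
      simp only [Set.mem_ofPred_eq, enc_prod, enc_num]
      constructor
      · intro h; exact ⟨_, _, rfl, h⟩
      · rintro ⟨a', b', h1, h⟩
        rw [pair_inj] at h1
        obtain ⟨rfl, rfl⟩ := h1
        exact h)
  · intro h
    have h1 : Rec 𝒮 (fun c : M => Bex (c + 1) fun a => Bex (c + 1) fun b => c = pair a b ∧ R a b) := by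
      fun_prop
    unfold CodedRel
    convert h1.mem using 1
    ext c
    constructor
    · rintro ⟨a, b, rfl, h⟩
      exact ⟨a, lt_add_one_iff'.2 (le_pair_left _ _), b, lt_add_one_iff'.2 (le_pair_right _ _), rfl, h⟩
    · rintro ⟨a, -, b, -, h⟩; exact ⟨a, b, h⟩

include hS in
theorem IsSupp.unique {P Q : M → M → Prop} (hP : Rec 𝒮 (fun q : M × M => P q.1 q.2))
    (hQ : Rec 𝒮 (fun q : M × M => Q q.1 q.2)) (h : IsSupp P) (h' : IsSupp Q) (x s : M) :
    P x s ↔ Q x s := by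
  have hr : Rec 𝒮 (fun s => P x s ↔ Q x s) := by fun_prop
  refine strong_induction hr (fun s ih => ?_) s
  rw [h, h']
  refine exists_congr fun γ => exists_congr fun δ => exists_congr fun r => and_congr_right fun hs => ?_
  subst hs
  rw [ih _ (exp_lt_gcons _ _ _), ih _ (tail_lt_gcons _ _ _)]

/-- The relation `x ∈ supp(s)`. -/
def InSupp (𝒮 : Set (Set M)) (x s : M) : Prop := x ∈ supp 𝒮 s

theorem inSupp_eq {P : M → M → Prop} (hP : Rec 𝒮 (fun q : M × M => P q.1 q.2)) (h : IsSupp P)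
    (x s : M) : InSupp 𝒮 x s ↔ P x s := by
  constructor
  · rintro ⟨Q, hQ, h', hx⟩
    exact (IsSupp.unique (codedRel_iff.1 hQ) hP h' h x s).1 hx
  · intro hx; exact ⟨P, codedRel_iff.2 hP, h, hx⟩

@[fun_prop]
theorem Rec.inSupp {f g : α → M} (hf : Rec 𝒮 f) (hg : Rec 𝒮 g) :
    Rec 𝒮 (fun a => InSupp 𝒮 (f a) (g a)) := by
  obtain ⟨P, hP, h⟩ := exists_supp (𝒮 := 𝒮)
  simp only [inSupp_eq hP h]
  fun_prop

theorem inSupp_iff {x s : M} : InSupp 𝒮 x s ↔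
    ∃ γ δ r, s = gcons γ δ r ∧ (InSupp 𝒮 x γ ∨ x = δ ∨ InSupp 𝒮 x r) := by
  obtain ⟨P, hP, h⟩ := exists_supp (𝒮 := 𝒮)
  simp only [inSupp_eq hP h]
  exact h x s

@[simp] theorem inSupp_gcons {x γ δ r : M} :
    InSupp 𝒮 x (gcons γ δ r) ↔ InSupp 𝒮 x γ ∨ x = δ ∨ InSupp 𝒮 x r := by
  rw [inSupp_iff]
  constructor
  · rintro ⟨_, _, _, h, h'⟩
    rw [gcons_inj] at h
    obtain ⟨rfl, rfl, rfl⟩ := h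
    exact h'
  · intro h; exact ⟨_, _, _, rfl, h⟩

@[simp] theorem not_inSupp_nil {x : M} : ¬ InSupp 𝒮 x nil := by
  rw [inSupp_iff]; simp

include hS in
theorem lt_of_inSupp {x s : M} (h : InSupp 𝒮 x s) : x < s := by
  have hr : Rec 𝒮 (fun s => Imp (InSupp 𝒮 x s) (x < s)) := by fun_prop
  refine strong_induction hr (fun s ih h => ?_) s h
  obtain ⟨γ, δ, r, rfl, h | rfl | h⟩ := inSupp_iff.1 h
  · exact (ih γ (exp_lt_gcons _ _ _) h).trans (exp_lt_gcons _ _ _)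
  · exact coef_lt_gcons _ _ _
  · exact (ih r (tail_lt_gcons _ _ _) h).trans (tail_lt_gcons _ _ _)

/-! ### Lexicographic orders on Goodstein terms -/

/-- The relation `L` is the lexicographic order on Goodstein terms induced by `R`. -/
structure IsLex (R L : M → M → Prop) : Prop where
  iff : ∀ s t, L s t ↔ (s = nil ∧ IsG t) ∨ ∃ γ δ r γ' δ' r', s = gcons γ δ r ∧ t = gcons γ' δ' r' ∧
    (L γ γ' ∨ (γ = γ' ∧ (R δ δ' ∨ (δ = δ' ∧ L r r'))))

section Lex

variable {R L : M → M → Prop} (hL : IsLex R L)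
include hL

theorem IsLex.nil_gcons (γ δ r : M) : L nil (gcons γ δ r) := (hL.iff _ _).2 (Or.inl ⟨rfl, by simp⟩)

theorem IsLex.not_nil (s : M) : ¬ L s nil := by
  rw [hL.iff]; simp

theorem IsLex.gcons_iff {γ δ r γ' δ' r' : M} : L (gcons γ δ r) (gcons γ' δ' r') ↔
    (L γ γ' ∨ (γ = γ' ∧ (R δ δ' ∨ (δ = δ' ∧ L r r')))) := by
  rw [hL.iff]
  constructor
  · rintro (⟨h, -⟩ | ⟨_, _, _, _, _, _, h1, h2, h3⟩)
    · exact absurd h (by simp)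
    · rw [gcons_inj] at h1 h2
      obtain ⟨rfl, rfl, rfl⟩ := h1
      obtain ⟨rfl, rfl, rfl⟩ := h2
      exact h3
  · intro h; exact Or.inr ⟨_, _, _, _, _, _, rfl, rfl, h⟩

theorem IsLex.exists_right {s t : M} (h : L s t) : ∃ γ δ r, t = gcons γ δ r := by
  rcases (hL.iff _ _).1 h with ⟨-, h⟩ | ⟨_, _, _, _, _, _, -, h, -⟩
  · exact isG_iff.1 h
  · exact ⟨_, _, _, h⟩

theorem IsLex.left_cases {s t : M} (h : L s t) : s = nil ∨ ∃ γ δ r, s = gcons γ δ r := by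
  rcases (hL.iff _ _).1 h with ⟨h, -⟩ | ⟨_, _, _, _, _, _, h, -, -⟩
  · exact Or.inl h
  · exact Or.inr ⟨_, _, _, h⟩

include hS
variable (hRr : Rec 𝒮 (fun q : M × M => R q.1 q.2)) (hLr : Rec 𝒮 (fun q : M × M => L q.1 q.2))
include hRr hLr

/-- In this and the next two results, R is only tested on supports. Hence they also apply when R is
the lexicographic order itself: coefficients have smaller codes, and the hypothesis is supplied by
induction. -/
theorem IsLex.irrefl {s : M} (h : ∀ z, InSupp 𝒮 z s → ¬ R z z) : ¬ L s s := by
  have hr : Rec 𝒮 (fun s => Imp (Ball s fun z => Imp (InSupp 𝒮 z s) (¬ R z z)) (¬ L s s)) := by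
    fun_prop
  refine strong_induction hr (fun s ih h hs => ?_) s (fun z _ => h z)
  obtain ⟨γ, δ, r, rfl⟩ := hL.exists_right hs
  have h' : ∀ z, InSupp 𝒮 z (gcons γ δ r) → ¬ R z z := fun z hz => h z (lt_of_inSupp hz) hz
  simp only [inSupp_gcons] at h'
  rcases hL.gcons_iff.1 hs with h1 | ⟨-, h1 | ⟨-, h1⟩⟩
  · exact ih _ (exp_lt_gcons _ _ _) (fun z _ hz => h' z (Or.inl hz)) h1
  · exact h' δ (Or.inr (Or.inl rfl)) h1
  · exact ih _ (tail_lt_gcons _ _ _) (fun z _ hz => h' z (Or.inr (Or.inr hz))) h1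

theorem IsLex.trans {s t u : M} (h : ∀ a b c, InSupp 𝒮 a s → InSupp 𝒮 b t → InSupp 𝒮 c u →
    R a b → R b c → R a c) (hst : L s t) (htu : L t u) : L s u := by
  have hr : Rec 𝒮 (fun q : M × M × M => Imp (Ball q.1 fun a => Ball q.2.1 fun b => Ball q.2.2 fun c =>
      Imp (InSupp 𝒮 a q.1) (Imp (InSupp 𝒮 b q.2.1) (Imp (InSupp 𝒮 c q.2.2)
        (Imp (R a b) (Imp (R b c) (R a c)))))) (Imp (L q.1 q.2.1) (Imp (L q.2.1 q.2.2)
          (L q.1 q.2.2)))) := by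
    fun_prop
  refine strong_induction_three hr (fun s t u ih h hst htu => ?_) s t u
    (fun a _ b _ c _ => h a b c) hst htu
  have h' : ∀ a b c, InSupp 𝒮 a s → InSupp 𝒮 b t → InSupp 𝒮 c u → R a b → R b c → R a c :=
    fun a b c ha hb hc => h a (lt_of_inSupp ha) b (lt_of_inSupp hb) c (lt_of_inSupp hc) ha hb hc
  obtain ⟨γ', δ', r', rfl⟩ := hL.exists_right hst
  obtain ⟨γ'', δ'', r'', rfl⟩ := hL.exists_right htu
  rcases hL.left_cases hst with rfl | ⟨γ, δ, r, rfl⟩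
  · exact hL.nil_gcons _ _ _
  rw [hL.gcons_iff] at hst htu ⊢
  simp only [inSupp_gcons] at h'
  rcases hst with h1 | ⟨rfl, h1⟩ <;> rcases htu with h2 | ⟨rfl, h2⟩
  · left
    exact ih _ _ _ (by gcongr <;> exact exp_lt_gcons _ _ _)
      (fun a _ b _ c _ ha hb hc => h' a b c (Or.inl ha) (Or.inl hb) (Or.inl hc)) h1 h2
  · exact Or.inl h1
  · exact Or.inl h2
  · refine Or.inr ⟨rfl, ?_⟩
    rcases h1 with h1 | ⟨rfl, h1⟩ <;> rcases h2 with h2 | ⟨rfl, h2⟩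
    · exact Or.inl (h' _ _ _ (Or.inr (Or.inl rfl)) (Or.inr (Or.inl rfl)) (Or.inr (Or.inl rfl)) h1 h2)
    · exact Or.inl h1
    · exact Or.inl h2
    · refine Or.inr ⟨rfl, ?_⟩
      exact ih _ _ _ (by gcongr <;> exact tail_lt_gcons _ _ _)
        (fun a _ b _ c _ ha hb hc => h' a b c (Or.inr (Or.inr ha)) (Or.inr (Or.inr hb))
          (Or.inr (Or.inr hc))) h1 h2

theorem IsLex.trichotomy {D : M → Prop} (hDr : Rec 𝒮 D)
    (hD : ∀ s, D s → s = nil ∨ ∃ γ δ r, s = gcons γ δ r ∧ D γ ∧ D r) {s t : M}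
    (h : ∀ a b, InSupp 𝒮 a s → InSupp 𝒮 b t → R a b ∨ a = b ∨ R b a) (hs : D s) (ht : D t) :
    L s t ∨ s = t ∨ L t s := by
  have hr : Rec 𝒮 (fun q : M × M => Imp (Ball q.1 fun a => Ball q.2 fun b =>
      Imp (InSupp 𝒮 a q.1) (Imp (InSupp 𝒮 b q.2) (R a b ∨ a = b ∨ R b a))) (Imp (D q.1) (Imp (D q.2)
          (L q.1 q.2 ∨ q.1 = q.2 ∨ L q.2 q.1)))) := by
    fun_prop
  refine strong_induction_two hr (fun s t ih h hs ht => ?_) s t (fun a _ b _ => h a b) hs ht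
  have h' : ∀ a b, InSupp 𝒮 a s → InSupp 𝒮 b t → R a b ∨ a = b ∨ R b a :=
    fun a b ha hb => h a (lt_of_inSupp ha) b (lt_of_inSupp hb) ha hb
  rcases hD s hs with rfl | ⟨γ, δ, r, rfl, hγ, hr⟩ <;>
    rcases hD t ht with rfl | ⟨γ', δ', r', rfl, hγ', hr'⟩
  · exact Or.inr (Or.inl rfl)
  · exact Or.inl (hL.nil_gcons _ _ _)
  · exact Or.inr (Or.inr (hL.nil_gcons _ _ _))
  simp only [inSupp_gcons] at h'
  rw [hL.gcons_iff, hL.gcons_iff, gcons_inj]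
  have h1 := ih γ γ' (by gcongr <;> exact exp_lt_gcons _ _ _)
    (fun a _ b _ ha hb => h' a b (Or.inl ha) (Or.inl hb)) hγ hγ'
  have h2 := h' δ δ' (Or.inr (Or.inl rfl)) (Or.inr (Or.inl rfl))
  have h3 := ih r r' (by gcongr <;> exact tail_lt_gcons _ _ _)
    (fun a _ b _ ha hb => h' a b (Or.inr (Or.inr ha)) (Or.inr (Or.inr hb))) hr hr'
  dsimp only at h1 h3
  rcases h1 with h1 | rfl | h1
  · exact Or.inl (Or.inl h1)
  · rcases h2 with h2 | rfl | h2
    · exact Or.inl (Or.inr ⟨rfl, Or.inl h2⟩)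
    · rcases h3 with h3 | rfl | h3
      · exact Or.inl (Or.inr ⟨rfl, Or.inr ⟨rfl, h3⟩⟩)
      · exact Or.inr (Or.inl ⟨rfl, rfl, rfl⟩)
      · exact Or.inr (Or.inr (Or.inr ⟨rfl, Or.inr ⟨rfl, h3⟩⟩))
    · exact Or.inr (Or.inr (Or.inr ⟨rfl, Or.inl h2⟩))
  · exact Or.inr (Or.inr (Or.inl h1))

end Lex

theorem exists_lex {R : M → M → Prop} (hR : Rec 𝒮 (fun q : M × M => R q.1 q.2)) :
    ∃ L : M → M → Prop, Rec 𝒮 (fun q : M × M => L q.1 q.2) ∧ IsLex R L := by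
  obtain ⟨P, hP, h⟩ := exists_relation (𝒮 := 𝒮)
    (F := fun g s t => (s = nil ∧ IsG t) ∨ (IsG s ∧ IsG t ∧ (g (gexp s) (gexp t) ∨
      (gexp s = gexp t ∧ (R (gcoef s) (gcoef t) ∨ (gcoef s = gcoef t ∧ g (cdr s) (cdr t)))))))
      (by fun_prop)
    (fun g g' s t h => by
      rintro (h' | ⟨hs, ht, h'⟩)
      · exact Or.inl h'
      refine Or.inr ⟨hs, ht, ?_⟩
      rwa [← h _ _ (add_lt_add hs.exp_lt ht.exp_lt), ← h _ _ (add_lt_add hs.tail_lt ht.tail_lt)])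
  refine ⟨P, hP, ⟨fun s t => ?_⟩⟩
  rw [h]
  refine or_congr_right ?_
  constructor
  · rintro ⟨h1, h2, h3⟩; exact ⟨_, _, _, _, _, _, h1, h2, h3⟩
  · rintro ⟨γ, δ, r, γ', δ', r', rfl, rfl, h2⟩; simpa using h2

/-- The lexicographic order as computed in the model. -/
noncomputable def glex (𝒮 : Set (Set M)) (R : M → M → Prop) : M → M → Prop :=
  Classical.epsilon fun L => Rec 𝒮 (fun q : M × M => L q.1 q.2) ∧ IsLex R L

theorem isLex_glex {R : M → M → Prop} (hR : Rec 𝒮 (fun q : M × M => R q.1 q.2)) :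
    IsLex R (glex 𝒮 R) := (Classical.epsilon_spec (exists_lex hR)).2

theorem rec_glex {R : M → M → Prop} (hR : Rec 𝒮 (fun q : M × M => R q.1 q.2)) :
    Rec 𝒮 (fun q : M × M => glex 𝒮 R q.1 q.2) := (Classical.epsilon_spec (exists_lex hR)).1

@[fun_prop]
theorem Rec.glex {R : M → M → Prop} (hR : Rec 𝒮 (fun q : M × M => R q.1 q.2)) {f g : α → M}
    (hf : Rec 𝒮 f) (hg : Rec 𝒮 g) : Rec 𝒮 (fun a => glex 𝒮 R (f a) (g a)) :=
  (rec_glex hR).comp (hf.prodMk hg)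

end Codes

/-! ### The orders G(X): existence, uniqueness and linearity. -/

section Goodstein

variable {M : Type*} [CommSemiring M] [LinearOrder M] [IsStrictOrderedRing M]
    [CanonicallyOrderedAdd M] [DiscreteNumbers M] {𝒮 : Set (Set M)} [hS : Fact (ModelsRCA0 𝒮)]

theorem Ord.Coded.rec_lt {X : Ord M} (h : X.Coded 𝒮) : Rec 𝒮 (fun q : M × M => X.lt q.1 q.2) :=
  codedRel_iff.1 h.2

theorem Ord.Coded.rec_dom {X : Ord M} (h : X.Coded 𝒮) : Rec 𝒮 (fun a => a ∈ X.dom) :=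
  rec_mem_set h.1

theorem coded_iff {X : Ord M} : X.Coded 𝒮 ↔
    Rec 𝒮 (fun a => a ∈ X.dom) ∧ Rec 𝒮 (fun q : M × M => X.lt q.1 q.2) :=
  ⟨fun h => ⟨h.rec_dom, h.rec_lt⟩, fun h => ⟨h.1.mem, codedRel_iff.2 h.2⟩⟩

theorem Ord.Coded.below {X : Ord M} (h : X.Coded 𝒮) (x : M) : (X.below x).Coded 𝒮 := by
  have h1 := h.rec_dom
  have h2 := h.rec_lt
  rw [coded_iff]
  refine ⟨?_, h2⟩
  change Rec 𝒮 (fun a => a ∈ X.dom ∧ X.lt a x)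
  fun_prop

/-- The recursive description of the domain of `G(X)`, in terms of the lexicographic order. -/
def IsGDom (𝒮 : Set (Set M)) (X : Ord M) (D : M → Prop) : Prop :=
  ∀ s, D s ↔ s = nil ∨ ∃ γ δ r, s = gcons γ δ r ∧ D γ ∧ δ ∈ X.dom ∧ D r ∧
    ∀ γ' δ' r', r = gcons γ' δ' r' → glex 𝒮 X.lt γ' γ

/-- The simultaneous recursion is untangled: the lexicographic order `glex` makes sense on all
codes, so that it can be constructed before the domain. -/
theorem exists_gdom {X : Ord M} (hX : X.Coded 𝒮) : ∃ D : M → Prop, Rec 𝒮 D ∧ IsGDom 𝒮 X D := by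
  have h1 := hX.rec_dom
  have h2 := hX.rec_lt
  obtain ⟨P, hP, h⟩ := exists_relation (𝒮 := 𝒮)
    (F := fun g s z => s = nil ∨ (IsG s ∧ g (gexp s) z ∧ gcoef s ∈ X.dom ∧ g (cdr s) z ∧
      Imp (IsG (cdr s)) (glex 𝒮 X.lt (gexp (cdr s)) (gexp s)))) (by fun_prop)
    (fun g g' s z h => by
      rintro (h' | ⟨hs, h'⟩)
      · exact Or.inl h'
      refine Or.inr ⟨hs, ?_⟩
      rwa [← h _ z (by gcongr; exact hs.exp_lt), ← h _ z (by gcongr; exact hs.tail_lt)])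
  refine ⟨fun s => P s 0, by fun_prop, fun s => ?_⟩
  beta_reduce
  rw [h]
  refine or_congr_right ?_
  constructor
  · rintro ⟨h1, h2, h3, h4, h5⟩
    refine ⟨_, _, _, h1, h2, h3, h4, fun γ' δ' r' hr => ?_⟩
    have := h5 (isG_iff.2 ⟨_, _, _, hr⟩)
    rwa [hr, gexp_gcons] at this
  · rintro ⟨γ, δ, r, rfl, h1, h2, h3, h4⟩
    simp only [isG_gcons, gexp_gcons, gcoef_gcons, cdr_gcons, true_and]
    refine ⟨h1, h2, h3, fun hr => ?_⟩
    exact h4 _ _ _ hr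

/-- For an arbitrary solution, domain and order cannot be separated, so agreement is proved for both
at once, by induction on the sum of two codes. -/
theorem goodstein_unique {X : Ord M} (hX : X.Coded 𝒮) {D : M → Prop} (hDr : Rec 𝒮 D)
    (hD : IsGDom 𝒮 X D) {G : Ord M} (hG : G.Coded 𝒮) (h : IsGoodstein X G) :
    (∀ s, s ∈ G.dom ↔ D s) ∧ ∀ s t, G.lt s t ↔ D s ∧ D t ∧ glex 𝒮 X.lt s t := by
  have h1 := hX.rec_dom
  have h2 := hX.rec_lt
  have h3 := hG.rec_dom
  have h4 := hG.rec_lt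
  have hL := isLex_glex h2
  have hr : Rec 𝒮 (fun q : M × M => (q.1 ∈ G.dom ↔ D q.1) ∧ (q.2 ∈ G.dom ↔ D q.2) ∧
    (G.lt q.1 q.2 ↔ D q.1 ∧ D q.2 ∧ glex 𝒮 X.lt q.1 q.2)) := by fun_prop
  have key : ∀ s t, (s ∈ G.dom ↔ D s) ∧ (t ∈ G.dom ↔ D t) ∧
      (G.lt s t ↔ D s ∧ D t ∧ glex 𝒮 X.lt s t) := by
    refine strong_induction_two hr (fun s t ih => ?_)
    -- Membership of a term consults the order only at two exponents whose codes add up to less than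
    -- the code of the term, so the joint induction hypothesis applies.
    have dom : ∀ s', s' ≤ s ∨ s' ≤ t → (s' ∈ G.dom ↔ D s') := by
      intro s' hs'
      have hdom : ∀ u < s', u ∈ G.dom ↔ D u := by
        intro u hu
        rcases hs' with hs' | hs'
        · exact (ih u t (by gcongr; exact hu.trans_le hs')).1
        · exact (ih s u (by gcongr; exact hu.trans_le hs')).2.1
      have hlt : ∀ u v, u + v < s' → (G.lt u v ↔ D u ∧ D v ∧ glex 𝒮 X.lt u v) := by
        intro u v huv
        refine (ih u v (huv.trans_le ?_)).2.2
        rcases hs' with hs' | hs'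
        · exact hs'.trans le_self_add
        · exact hs'.trans le_add_self
      rw [h.mem_iff, hD]
      refine or_congr_right (exists_congr fun γ => exists_congr fun δ => exists_congr fun r =>
        and_congr_right ?_)
      rintro rfl
      rw [hdom γ (exp_lt_gcons _ _ _), hdom r (tail_lt_gcons _ _ _)]
      refine and_congr_right fun hγ => and_congr_right fun hδ => and_congr_right fun hr' => ?_
      refine forall_congr' fun γ' => forall_congr' fun δ' => forall_congr' fun r' =>
        imp_congr_right ?_
      rintro rfl
      rw [hlt γ' γ ?_]
      · have : D γ' := by
          rcases (hD _).1 hr' with h0 | ⟨_, _, _, h0, h5, -⟩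
          · exact absurd h0 (by simp)
          · rw [gcons_inj] at h0; rw [h0.1]; exact h5
        simp [this, hγ]
      · refine lt_of_lt_of_le ?_ (add_lt_gcons _ _ _).le
        rw [add_comm]
        exact add_lt_add_of_le_of_lt le_self_add (exp_lt_gcons _ _ _)
    have hs := dom s (Or.inl le_rfl)
    have ht := dom t (Or.inr le_rfl)
    refine ⟨hs, ht, ?_⟩
    have hdom' : ∀ {γ δ r}, D (gcons γ δ r) → D γ ∧ D r := by
      intro γ δ r h0
      rcases (hD _).1 h0 with h0 | ⟨_, _, _, h0, h5, -, h6, -⟩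
      · exact absurd h0 (by simp)
      · rw [gcons_inj] at h0
        obtain ⟨rfl, rfl, rfl⟩ := h0
        exact ⟨h5, h6⟩
    rw [h.lt_iff, hL.iff, hs, ht]
    refine and_congr_right fun hs' => and_congr_right fun ht' => or_congr ?_ ?_
    · refine and_congr_right fun _ => ?_
      constructor
      · intro h0
        rcases (hD _).1 ht' with h5 | ⟨_, _, _, h5, -⟩
        · exact absurd h5 h0
        · exact isG_iff.2 ⟨_, _, _, h5⟩
      · rintro h0 rfl
        simp at h0
    · refine exists_congr fun γ => exists_congr fun δ => exists_congr fun r =>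
        exists_congr fun γ' => exists_congr fun δ' => exists_congr fun r' =>
        and_congr_right ?_
      rintro rfl
      refine and_congr_right ?_
      rintro rfl
      have e1 := (ih γ γ' (add_lt_add (exp_lt_gcons _ _ _) (exp_lt_gcons _ _ _))).2.2
      have e2 := (ih r r' (add_lt_add (tail_lt_gcons _ _ _) (tail_lt_gcons _ _ _))).2.2
      dsimp only at e1 e2
      rw [e1, e2]
      simp [hdom' hs', hdom' ht']
  exact ⟨fun s => (key s s).1, fun s t => (key s t).2.2⟩

theorem isGoodstein_of_gdom {X : Ord M} (hX : X.Coded 𝒮) {D : M → Prop}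
    (hD : IsGDom 𝒮 X D) : IsGoodstein X ⟨{s | D s}, fun s t => D s ∧ D t ∧ glex 𝒮 X.lt s t⟩ := by
  have hL := isLex_glex hX.rec_lt
  have hdom' : ∀ {γ δ r}, D (gcons γ δ r) → D γ ∧ D r := by
    intro γ δ r h0
    rcases (hD _).1 h0 with h0 | ⟨_, _, _, h0, h5, -, h6, -⟩
    · exact absurd h0 (by simp)
    · rw [gcons_inj] at h0
      obtain ⟨rfl, rfl, rfl⟩ := h0
      exact ⟨h5, h6⟩
  constructor
  · intro s
    simp only [Set.mem_ofPred_eq]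
    rw [hD]
    refine or_congr_right (exists_congr fun γ => exists_congr fun δ => exists_congr fun r =>
      and_congr_right fun _ => and_congr_right fun hγ => and_congr_right fun _ =>
      and_congr_right fun hr => ?_)
    refine forall_congr' fun γ' => forall_congr' fun δ' => forall_congr' fun r' =>
      imp_congr_right ?_
    rintro rfl
    simp [hdom' hr, hγ]
  · intro s t
    simp only [Set.mem_ofPred_eq]
    refine and_congr_right fun hs' => and_congr_right fun ht' => ?_
    rw [hL.iff]
    refine or_congr ?_ ?_
    · refine and_congr_right fun _ => ?_
      constructor
      · rintro h0 rfl
        simp at h0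
      · intro h0
        rcases (hD _).1 ht' with h5 | ⟨_, _, _, h5, -⟩
        · exact absurd h5 h0
        · exact isG_iff.2 ⟨_, _, _, h5⟩
    · refine exists_congr fun γ => exists_congr fun δ => exists_congr fun r =>
        exists_congr fun γ' => exists_congr fun δ' => exists_congr fun r' =>
        and_congr_right ?_
      rintro rfl
      refine and_congr_right ?_
      rintro rfl
      simp [hdom' hs', hdom' ht']

theorem goodstein_eq {X : Ord M} (hX : X.Coded 𝒮) {D : M → Prop} (hDr : Rec 𝒮 D)
    (hD : IsGDom 𝒮 X D) :
    (∀ s, s ∈ (goodstein 𝒮 X).dom ↔ D s) ∧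
      ∀ s t, (goodstein 𝒮 X).lt s t ↔ D s ∧ D t ∧ glex 𝒮 X.lt s t := by
  have h2 := hX.rec_lt
  have hco : Ord.Coded 𝒮 (⟨{s | D s}, fun s t => D s ∧ D t ∧ glex 𝒮 X.lt s t⟩ : Ord M) := by
    rw [coded_iff]
    exact ⟨by simpa using hDr, by fun_prop⟩
  have hg := isGoodstein_of_gdom hX hD
  constructor
  · intro s
    constructor
    · rintro ⟨G, hG, h, hs⟩
      exact ((goodstein_unique hX hDr hD hG h).1 s).1 hs
    · intro hs; exact ⟨_, hco, hg, hs⟩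
  · intro s t
    constructor
    · rintro ⟨G, hG, h, hs⟩
      exact ((goodstein_unique hX hDr hD hG h).2 s t).1 hs
    · intro hs; exact ⟨_, hco, hg, hs⟩

/-- Membership in `G(X)`. -/
def GMem (𝒮 : Set (Set M)) (X : Ord M) (s : M) : Prop := s ∈ (goodstein 𝒮 X).dom

theorem rec_gMem {X : Ord M} (hX : X.Coded 𝒮) : Rec 𝒮 (GMem 𝒮 X) := by
  obtain ⟨D, hDr, hD⟩ := exists_gdom hX
  exact hDr.of_iff (goodstein_eq hX hDr hD).1

theorem isGDom_gMem {X : Ord M} (hX : X.Coded 𝒮) : IsGDom 𝒮 X (GMem 𝒮 X) := by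
  obtain ⟨D, hDr, hD⟩ := exists_gdom hX
  have : GMem 𝒮 X = D := funext fun s => propext ((goodstein_eq hX hDr hD).1 s)
  rwa [this]

theorem goodstein_lt_iff {X : Ord M} (hX : X.Coded 𝒮) {s t : M} :
    (goodstein 𝒮 X).lt s t ↔ GMem 𝒮 X s ∧ GMem 𝒮 X t ∧ glex 𝒮 X.lt s t :=
  (goodstein_eq hX (rec_gMem hX) (isGDom_gMem hX)).2 s t

theorem gMem_nil {X : Ord M} (hX : X.Coded 𝒮) : GMem 𝒮 X nil :=
  (isGDom_gMem hX _).2 (Or.inl rfl)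

theorem gMem_gcons {X : Ord M} (hX : X.Coded 𝒮) {γ δ r : M} : GMem 𝒮 X (gcons γ δ r) ↔
    GMem 𝒮 X γ ∧ δ ∈ X.dom ∧ GMem 𝒮 X r ∧
      ∀ γ' δ' r', r = gcons γ' δ' r' → glex 𝒮 X.lt γ' γ := by
  rw [isGDom_gMem hX]
  constructor
  · rintro (h | ⟨_, _, _, h, h'⟩)
    · exact absurd h (by simp)
    · rw [gcons_inj] at h
      obtain ⟨rfl, rfl, rfl⟩ := h
      exact h'
  · intro h; exact Or.inr ⟨_, _, _, rfl, h⟩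

theorem gMem_cases {X : Ord M} (hX : X.Coded 𝒮) {s : M} (h : GMem 𝒮 X s) :
    s = nil ∨ ∃ γ δ r, s = gcons γ δ r ∧ GMem 𝒮 X γ ∧ GMem 𝒮 X r := by
  rcases (isGDom_gMem hX _).1 h with h | ⟨_, _, _, h, h1, -, h2, -⟩
  · exact Or.inl h
  · exact Or.inr ⟨_, _, _, h, h1, h2⟩

theorem mem_dom_of_inSupp {X : Ord M} (hX : X.Coded 𝒮) {s z : M} (hs : GMem 𝒮 X s)
    (hz : InSupp 𝒮 z s) : z ∈ X.dom := by
  have h1 := hX.rec_dom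
  have h2 := rec_gMem hX
  have hr : Rec 𝒮 (fun s => Imp (GMem 𝒮 X s) (Imp (InSupp 𝒮 z s) (z ∈ X.dom))) := by fun_prop
  refine strong_induction hr (fun s ih hs hz => ?_) s hs hz
  obtain ⟨γ, δ, r, rfl, h⟩ := inSupp_iff.1 hz
  obtain ⟨h3, h4, h5, -⟩ := (gMem_gcons hX).1 hs
  rcases h with h | rfl | h
  · exact ih _ (exp_lt_gcons _ _ _) h3 h
  · exact h4
  · exact ih _ (tail_lt_gcons _ _ _) h5 h

/-- Codes of terms do not mention X. Therefore G(X↾x) literally is the part of G(X) with support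
below x. -/
theorem gMem_below_iff {X : Ord M} (hX : X.Coded 𝒮) {x s : M} :
    GMem 𝒮 (X.below x) s ↔ GMem 𝒮 X s ∧ ∀ z, InSupp 𝒮 z s → X.lt z x := by
  have h1 := hX.rec_dom
  have h2 := hX.rec_lt
  have h3 := rec_gMem hX
  have h4 := rec_gMem (hX.below x)
  have hr : Rec 𝒮 (fun s => GMem 𝒮 (X.below x) s ↔
      GMem 𝒮 X s ∧ Ball s fun z => Imp (InSupp 𝒮 z s) (X.lt z x)) := by fun_prop
  have key : ∀ s, GMem 𝒮 (X.below x) s ↔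
      GMem 𝒮 X s ∧ Ball s fun z => Imp (InSupp 𝒮 z s) (X.lt z x) := by
    refine strong_induction hr (fun s ih => ?_)
    have ih' : ∀ u < s, GMem 𝒮 (X.below x) u ↔ GMem 𝒮 X u ∧ ∀ z, InSupp 𝒮 z u → X.lt z x := by
      intro u hu
      rw [ih u hu]
      exact and_congr_right fun _ => ⟨fun h z hz => h z (lt_of_inSupp hz) hz, fun h z _ hz => h z hz⟩
    constructor
    · intro h
      rcases gMem_cases (hX.below x) h with rfl | ⟨γ, δ, r, rfl, -⟩
      · exact ⟨gMem_nil hX, fun z _ hz => absurd hz not_inSupp_nil⟩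
      · rw [gMem_gcons (hX.below x), ih' _ (exp_lt_gcons _ _ _), ih' _ (tail_lt_gcons _ _ _)] at h
        obtain ⟨⟨h5, h6⟩, ⟨h7, h8⟩, ⟨h9, h10⟩, h11⟩ := h
        refine ⟨(gMem_gcons hX).2 ⟨h5, h7, h9, h11⟩, fun z _ hz => ?_⟩
        rcases inSupp_gcons.1 hz with hz | rfl | hz
        · exact h6 z hz
        · exact h8
        · exact h10 z hz
    · rintro ⟨h, h'⟩
      rcases gMem_cases hX h with rfl | ⟨γ, δ, r, rfl, -⟩
      · exact gMem_nil (hX.below x)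
      · have h'' : ∀ z, InSupp 𝒮 z (gcons γ δ r) → X.lt z x := fun z hz => h' z (lt_of_inSupp hz) hz
        simp only [inSupp_gcons] at h''
        rw [gMem_gcons hX] at h
        obtain ⟨h5, h6, h7, h8⟩ := h
        rw [gMem_gcons (hX.below x), ih' _ (exp_lt_gcons _ _ _), ih' _ (tail_lt_gcons _ _ _)]
        exact ⟨⟨h5, fun z hz => h'' z (Or.inl hz)⟩, ⟨h6, h'' δ (Or.inr (Or.inl rfl))⟩,
          ⟨h7, fun z hz => h'' z (Or.inr (Or.inr hz))⟩, h8⟩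
  rw [key]
  exact and_congr_right fun _ => ⟨fun h z hz => h z (lt_of_inSupp hz) hz, fun h z _ hz => h z hz⟩

section Linear

variable {X : Ord M} (hX : X.Coded 𝒮) (hl : X.IsLinear)
include hX hl

theorem glex_irrefl {s : M} (hs : GMem 𝒮 X s) : ¬ glex 𝒮 X.lt s s :=
  (isLex_glex hX.rec_lt).irrefl hX.rec_lt (rec_glex hX.rec_lt)
    (fun z hz => hl.irrefl z (mem_dom_of_inSupp hX hs hz))

theorem glex_trans {s t u : M} (hs : GMem 𝒮 X s) (ht : GMem 𝒮 X t) (hu : GMem 𝒮 X u) :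
    glex 𝒮 X.lt s t → glex 𝒮 X.lt t u → glex 𝒮 X.lt s u :=
  (isLex_glex hX.rec_lt).trans hX.rec_lt (rec_glex hX.rec_lt)
    (fun a b c ha hb hc => hl.trans a (mem_dom_of_inSupp hX hs ha) b (mem_dom_of_inSupp hX ht hb)
      c (mem_dom_of_inSupp hX hu hc))

theorem glex_asymm {s t : M} (hs : GMem 𝒮 X s) (ht : GMem 𝒮 X t) (h : glex 𝒮 X.lt s t) :
    ¬ glex 𝒮 X.lt t s :=
  fun h' => glex_irrefl hX hl hs (glex_trans hX hl hs ht hs h h')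

theorem glex_trichotomy {s t : M} (hs : GMem 𝒮 X s) (ht : GMem 𝒮 X t) :
    glex 𝒮 X.lt s t ∨ s = t ∨ glex 𝒮 X.lt t s :=
  (isLex_glex hX.rec_lt).trichotomy hX.rec_lt (rec_glex hX.rec_lt) (rec_gMem hX)
    (fun s hs => gMem_cases hX hs)
    (fun a b ha hb => hl.trichotomy a (mem_dom_of_inSupp hX hs ha) b (mem_dom_of_inSupp hX ht hb))
    hs ht

end Linear

theorem goodstein_le_iff {X : Ord M} (hX : X.Coded 𝒮) {s t : M} (hs : GMem 𝒮 X s)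
    (ht : GMem 𝒮 X t) : (goodstein 𝒮 X).le s t ↔ s = t ∨ glex 𝒮 X.lt s t := by
  unfold Ord.le
  rw [goodstein_lt_iff hX]
  simp [hs, ht]

end Goodstein

/-! ### Embeddings between coded orders. -/

section Embeddings

variable {M : Type*} [CommSemiring M] [LinearOrder M] [IsStrictOrderedRing M]
    [CanonicallyOrderedAdd M] [DiscreteNumbers M] {𝒮 : Set (Set M)} [hS : Fact (ModelsRCA0 𝒮)]

theorem Rec.codedFun {f : M → M} (hf : Rec 𝒮 f) {D : Set M} (hD : D ∈ 𝒮) : CodedFun 𝒮 D f := by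
  have h1 := rec_mem_set hD
  have h : Rec 𝒮 (fun c => c ∈ graph f ∧ unpairL c ∈ D) := (rec_mem_set hf.total).and (by fun_prop)
  unfold CodedFun
  convert h.mem using 1
  ext c
  simp only [graph, Set.mem_ofPred_eq, Set.mem_univ, true_and]
  constructor
  · rintro ⟨a, ha, rfl⟩; exact ⟨⟨a, rfl⟩, by simpa⟩
  · rintro ⟨⟨a, rfl⟩, h⟩; exact ⟨a, by simpa using h, rfl⟩

/-- A function that is coded only on D is extended by the value 0, so that the calculus of total
functions applies to it. -/
theorem exists_rec_of_codedFun {f : M → M} {D : Set M} (hD : D ∈ 𝒮) (hf : CodedFun 𝒮 D f) :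
    ∃ g, Rec 𝒮 g ∧ ∀ a ∈ D, g a = f a := by
  have h1 := rec_mem_set hD
  have h2 := rec_mem_set hf
  have h : Rec 𝒮 (fun q : M × M => (q.1 ∈ D ∧ pair q.1 q.2 ∈ {c | ∃ a ∈ D, c = pair a (f a)}) ∨
    (¬ q.1 ∈ D ∧ q.2 = 0)) := by fun_prop
  obtain ⟨g, hg, hgs⟩ := Rec.exists_search (r := fun a v =>
    (a ∈ D ∧ pair a v ∈ {c | ∃ a ∈ D, c = pair a (f a)}) ∨ (¬ a ∈ D ∧ v = 0)) h (fun a => by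
      by_cases ha : a ∈ D
      · exact ⟨f a, Or.inl ⟨ha, a, ha, rfl⟩⟩
      · exact ⟨0, Or.inr ⟨ha, rfl⟩⟩)
  refine ⟨g, hg, fun a ha => ?_⟩
  rcases hgs a with ⟨-, b, hb, h⟩ | ⟨h, -⟩
  · rw [pair_inj] at h
    rw [h.2, h.1]
  · exact absurd ha h

theorem embeds_of_mono {X Y : Ord M} (hX : X.Coded 𝒮) (hl : X.IsLinear)
    (hY : ∀ a ∈ Y.dom, ∀ b ∈ Y.dom, Y.lt a b → ¬ Y.lt b a) {f : M → M} (hf : Rec 𝒮 f)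
    (hm : ∀ a ∈ X.dom, f a ∈ Y.dom)
    (h : ∀ a ∈ X.dom, ∀ b ∈ X.dom, X.lt a b → Y.lt (f a) (f b)) : X.Embeds 𝒮 Y := by
  refine ⟨f, hf.codedFun hX.1, hm, fun a ha b hb => ⟨h a ha b hb, fun hab => ?_⟩⟩
  have has := hY _ (hm a ha) _ (hm b hb) hab
  rcases hl.trichotomy a ha b hb with h1 | rfl | h1
  · exact h1
  · exact absurd hab has
  · exact absurd (h b hb a ha h1) has

theorem Ord.Embeds.trans {X Y Z : Ord M} (hX : X.dom ∈ 𝒮) (hYd : Y.dom ∈ 𝒮)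
    (hXY : X.Embeds 𝒮 Y) (hYZ : Y.Embeds 𝒮 Z) : X.Embeds 𝒮 Z := by
  obtain ⟨f, hf, hfm, hfl⟩ := hXY
  obtain ⟨g, hg, hgm, hgl⟩ := hYZ
  obtain ⟨F, hF, hFf⟩ := exists_rec_of_codedFun hX hf
  obtain ⟨G, hG, hGg⟩ := exists_rec_of_codedFun hYd hg
  have e : ∀ a ∈ X.dom, G (F a) = g (f a) := fun a ha => by
    rw [hFf a ha, hGg _ (hfm a ha)]
  refine ⟨fun a => G (F a), Rec.codedFun (by fun_prop) hX, fun a ha => ?_, fun a ha b hb => ?_⟩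
  · beta_reduce; rw [e a ha]; exact hgm _ (hfm a ha)
  · beta_reduce; rw [e a ha, e b hb, hfl a ha b hb, hgl _ (hfm a ha) _ (hfm b hb)]

theorem Ord.Embeds.wellFounded {X Y : Ord M} (hX : X.dom ∈ 𝒮) (hXY : X.Embeds 𝒮 Y)
    (hY : Y.WellFounded 𝒮) : X.WellFounded 𝒮 := by
  obtain ⟨f, hf, hfm, hfl⟩ := hXY
  obtain ⟨F, hF, hFf⟩ := exists_rec_of_codedFun hX hf
  rintro ⟨g, hg, hgm, hgd⟩
  have hg' := rec_of_total hg
  have hu : (Set.univ : Set M) ∈ 𝒮 := by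
    have h : Rec 𝒮 (fun _ : M => True) := by fun_prop
    convert h.mem
    ext; simp
  refine hY ⟨fun n => F (g n), Rec.codedFun (by fun_prop) hu, fun n => ?_, fun n => ?_⟩
  · beta_reduce; rw [hFf _ (hgm n)]; exact hfm _ (hgm n)
  · beta_reduce; rw [hFf _ (hgm n), hFf _ (hgm _)]
    exact (hfl _ (hgm _) _ (hgm n)).1 (hgd n)

end Embeddings

/-! ### The canonical termination point T. -/

section Canonical

variable {M : Type*} [CommSemiring M] [LinearOrder M] [IsStrictOrderedRing M]
    [CanonicallyOrderedAdd M] [DiscreteNumbers M] {𝒮 : Set (Set M)} [hS : Fact (ModelsRCA0 𝒮)]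

include hS in
theorem IsLex.unique {R L L' : M → M → Prop} (h : IsLex R L) (h' : IsLex R L')
    (hr : Rec 𝒮 (fun q : M × M => L q.1 q.2)) (hr' : Rec 𝒮 (fun q : M × M => L' q.1 q.2)) (s t : M) :
    L s t ↔ L' s t := by
  have hrec : Rec 𝒮 (fun q : M × M => L q.1 q.2 ↔ L' q.1 q.2) := by fun_prop
  refine strong_induction_two hrec (fun s t ih => ?_) s t
  have ih' : ∀ a b, a + b < s + t → (L a b ↔ L' a b) := ih
  rw [h.iff, h'.iff]
  refine or_congr_right ?_
  refine exists_congr fun γ => exists_congr fun δ => exists_congr fun r =>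
    exists_congr fun γ' => exists_congr fun δ' => exists_congr fun r' => and_congr_right ?_
  rintro rfl
  refine and_congr_right ?_
  rintro rfl
  rw [ih' γ γ' (add_lt_add (exp_lt_gcons _ _ _) (exp_lt_gcons _ _ _)),
    ih' r r' (add_lt_add (tail_lt_gcons _ _ _) (tail_lt_gcons _ _ _))]

/-- The order of T must be the one that G induces from T itself. This circle is harmless, since
coefficients have smaller codes than the terms in which they occur. -/
theorem exists_self_lex :
    ∃ L : M → M → Prop, Rec 𝒮 (fun q : M × M => L q.1 q.2) ∧ IsLex L L := by
  obtain ⟨P, hP, h⟩ := exists_relation (𝒮 := 𝒮)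
    (F := fun g s t => (s = nil ∧ IsG t) ∨ (IsG s ∧ IsG t ∧ (g (gexp s) (gexp t) ∨
      (gexp s = gexp t ∧ (g (gcoef s) (gcoef t) ∨ (gcoef s = gcoef t ∧ g (cdr s) (cdr t)))))))
      (by fun_prop)
    (fun g g' s t h => by
      rintro (h' | ⟨hs, ht, h'⟩)
      · exact Or.inl h'
      refine Or.inr ⟨hs, ht, ?_⟩
      rwa [← h _ _ (add_lt_add hs.exp_lt ht.exp_lt), ← h _ _ (add_lt_add hs.coef_lt ht.coef_lt),
        ← h _ _ (add_lt_add hs.tail_lt ht.tail_lt)])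
  refine ⟨P, hP, ⟨fun s t => ?_⟩⟩
  rw [h]
  refine or_congr_right ?_
  constructor
  · rintro ⟨h1, h2, h3⟩; exact ⟨_, _, _, _, _, _, h1, h2, h3⟩
  · rintro ⟨γ, δ, r, γ', δ', r', rfl, rfl, h2⟩; simpa using h2

/-- The hereditarily lexicographic order on Goodstein terms whose coefficients are again such
terms. -/
noncomputable def tlt (𝒮 : Set (Set M)) : M → M → Prop :=
  Classical.epsilon fun L => Rec 𝒮 (fun q : M × M => L q.1 q.2) ∧ IsLex L L

theorem isLex_tlt : IsLex (tlt 𝒮) (tlt 𝒮) := (Classical.epsilon_spec exists_self_lex).2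

theorem rec_tlt : Rec 𝒮 (fun q : M × M => tlt 𝒮 q.1 q.2) :=
  (Classical.epsilon_spec (exists_self_lex (𝒮 := 𝒮))).1

variable {α : Type*} [Enc M α]

@[fun_prop]
theorem Rec.tlt {f g : α → M} (hf : Rec 𝒮 f) (hg : Rec 𝒮 g) :
    Rec 𝒮 (fun a => tlt 𝒮 (f a) (g a)) := rec_tlt.comp (hf.prodMk hg)

theorem tlt_irrefl (s : M) : ¬ tlt 𝒮 s s := by
  have hr : Rec 𝒮 (fun s => ¬ tlt 𝒮 s s) := by fun_prop
  exact strong_induction hr (fun s ih => isLex_tlt.irrefl rec_tlt rec_tlt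
    (fun z hz => ih z (lt_of_inSupp hz))) s

theorem tlt_trans {s t u : M} : tlt 𝒮 s t → tlt 𝒮 t u → tlt 𝒮 s u := by
  have hr : Rec 𝒮 (fun q : M × M × M => Imp (tlt 𝒮 q.1 q.2.1) (Imp (tlt 𝒮 q.2.1 q.2.2)
    (tlt 𝒮 q.1 q.2.2))) := by fun_prop
  exact strong_induction_three hr (fun s t u ih => isLex_tlt.trans rec_tlt rec_tlt
    (fun a b c ha hb hc => ih a b c (by
      gcongr <;> first | exact lt_of_inSupp ha | exact lt_of_inSupp hb | exact lt_of_inSupp hc)))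
    s t u

theorem tlt_asymm {s t : M} (h : tlt 𝒮 s t) : ¬ tlt 𝒮 t s := fun h' => tlt_irrefl s (tlt_trans h h')

/-- Elements of the canonical termination point, relative to the set `D` of terms. -/
theorem exists_canonical_terms : ∃ D : M → Prop, Rec 𝒮 D ∧ ∀ s, D s ↔ s = nil ∨
    ∃ γ δ r, s = gcons γ δ r ∧ D γ ∧ (D δ ∧ ∀ z, InSupp 𝒮 z δ → tlt 𝒮 z δ) ∧ D r ∧
      ∀ γ' δ' r', r = gcons γ' δ' r' → tlt 𝒮 γ' γ := by
  obtain ⟨P, hP, h⟩ := exists_relation (𝒮 := 𝒮)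
    (F := fun g s z => s = nil ∨ (IsG s ∧ g (gexp s) z ∧ (g (gcoef s) z ∧
      Ball (gcoef s) fun w => Imp (InSupp 𝒮 w (gcoef s)) (tlt 𝒮 w (gcoef s))) ∧ g (cdr s) z ∧
      Imp (IsG (cdr s)) (tlt 𝒮 (gexp (cdr s)) (gexp s)))) (by fun_prop)
    (fun g g' s z h => by
      rintro (h' | ⟨hs, h'⟩)
      · exact Or.inl h'
      refine Or.inr ⟨hs, ?_⟩
      rwa [← h _ z (by gcongr; exact hs.exp_lt), ← h _ z (by gcongr; exact hs.coef_lt),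
        ← h _ z (by gcongr; exact hs.tail_lt)])
  refine ⟨fun s => P s 0, by fun_prop, fun s => ?_⟩
  beta_reduce
  rw [h]
  refine or_congr_right ?_
  constructor
  · rintro ⟨h1, h2, h3, h4, h5⟩
    refine ⟨_, _, _, h1, h2, ⟨h3.1, fun z hz => h3.2 z (lt_of_inSupp hz) hz⟩, h4,
      fun γ' δ' r' hr => ?_⟩
    have := h5 (isG_iff.2 ⟨_, _, _, hr⟩)
    rwa [hr, gexp_gcons] at this
  · rintro ⟨γ, δ, r, rfl, h1, h2, h3, h4⟩
    simp only [isG_gcons, gexp_gcons, gcoef_gcons, cdr_gcons, true_and]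
    exact ⟨h1, ⟨h2.1, fun z _ hz => h2.2 z hz⟩, h3, fun hr => h4 _ _ _ hr⟩

/-- The terms of the Goodstein predilator applied to the canonical termination point. -/
noncomputable def GT (𝒮 : Set (Set M)) : M → Prop :=
  Classical.epsilon fun D => Rec 𝒮 D ∧ ∀ s, D s ↔ s = nil ∨
    ∃ γ δ r, s = gcons γ δ r ∧ D γ ∧ (D δ ∧ ∀ z, InSupp 𝒮 z δ → tlt 𝒮 z δ) ∧ D r ∧
      ∀ γ' δ' r', r = gcons γ' δ' r' → tlt 𝒮 γ' γ

/-- The elements of the canonical termination point. -/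
def TT (𝒮 : Set (Set M)) (s : M) : Prop := GT 𝒮 s ∧ ∀ z, InSupp 𝒮 z s → tlt 𝒮 z s

theorem rec_GT : Rec 𝒮 (GT 𝒮) := (Classical.epsilon_spec (exists_canonical_terms (𝒮 := 𝒮))).1

theorem GT_iff {s : M} : GT 𝒮 s ↔ s = nil ∨ ∃ γ δ r, s = gcons γ δ r ∧ GT 𝒮 γ ∧ TT 𝒮 δ ∧
    GT 𝒮 r ∧ ∀ γ' δ' r', r = gcons γ' δ' r' → tlt 𝒮 γ' γ :=
  (Classical.epsilon_spec (exists_canonical_terms (𝒮 := 𝒮))).2 s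

@[fun_prop]
theorem Rec.GT {f : α → M} (hf : Rec 𝒮 f) : Rec 𝒮 (fun a => GT 𝒮 (f a)) := rec_GT.comp hf

@[fun_prop]
theorem Rec.TT {f : α → M} (hf : Rec 𝒮 f) : Rec 𝒮 (fun a => TT 𝒮 (f a)) := by
  have : Rec 𝒮 (fun a => InvGoodstein.GT 𝒮 (f a) ∧ Ball (f a) fun z =>
      Imp (InSupp 𝒮 z (f a)) (InvGoodstein.tlt 𝒮 z (f a))) := by fun_prop
  exact this.of_iff fun a => and_congr_right fun _ =>
    ⟨fun h z _ hz => h z hz, fun h z hz => h z (lt_of_inSupp hz) hz⟩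

theorem GT_nil : GT 𝒮 nil := GT_iff.2 (Or.inl rfl)

theorem TT_nil : TT 𝒮 nil := ⟨GT_nil, fun z hz => absurd hz not_inSupp_nil⟩

theorem GT_gcons {γ δ r : M} : GT 𝒮 (gcons γ δ r) ↔ GT 𝒮 γ ∧ TT 𝒮 δ ∧
    GT 𝒮 r ∧ ∀ γ' δ' r', r = gcons γ' δ' r' → tlt 𝒮 γ' γ := by
  rw [GT_iff]
  constructor
  · rintro (h | ⟨_, _, _, h, h'⟩)
    · exact absurd h (by simp)
    · rw [gcons_inj] at h
      obtain ⟨rfl, rfl, rfl⟩ := h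
      exact h'
  · intro h; exact Or.inr ⟨_, _, _, rfl, h⟩

theorem GT_cases {s : M} (h : GT 𝒮 s) : s = nil ∨ ∃ γ δ r, s = gcons γ δ r ∧ GT 𝒮 γ ∧ GT 𝒮 r := by
  rcases GT_iff.1 h with h | ⟨_, _, _, h, h1, -, h2, -⟩
  · exact Or.inl h
  · exact Or.inr ⟨_, _, _, h, h1, h2⟩

theorem TT_of_inSupp {s z : M} (hs : GT 𝒮 s) (hz : InSupp 𝒮 z s) : TT 𝒮 z := by
  have hr : Rec 𝒮 (fun s => Imp (GT 𝒮 s) (Imp (InSupp 𝒮 z s) (TT 𝒮 z))) := by fun_prop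
  refine strong_induction hr (fun s ih hs hz => ?_) s hs hz
  obtain ⟨γ, δ, r, rfl, h⟩ := inSupp_iff.1 hz
  obtain ⟨h3, h4, h5, -⟩ := GT_gcons.1 hs
  rcases h with h | rfl | h
  · exact ih _ (exp_lt_gcons _ _ _) h3 h
  · exact h4
  · exact ih _ (tail_lt_gcons _ _ _) h5 h

theorem tlt_trichotomy {s t : M} : GT 𝒮 s → GT 𝒮 t → tlt 𝒮 s t ∨ s = t ∨ tlt 𝒮 t s := by
  have hr : Rec 𝒮 (fun q : M × M => Imp (GT 𝒮 q.1) (Imp (GT 𝒮 q.2)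
    (tlt 𝒮 q.1 q.2 ∨ q.1 = q.2 ∨ tlt 𝒮 q.2 q.1))) := by fun_prop
  refine strong_induction_two hr (fun s t ih hs ht => ?_) s t
  exact isLex_tlt.trichotomy rec_tlt rec_tlt rec_GT (fun s hs => GT_cases hs)
    (fun a b ha hb => ih a b (add_lt_add (lt_of_inSupp ha) (lt_of_inSupp hb))
      (TT_of_inSupp hs ha).1 (TT_of_inSupp ht hb).1) hs ht

/-- The canonical termination point. -/
def canonical (𝒮 : Set (Set M)) : Ord M := ⟨{x | TT 𝒮 x}, tlt 𝒮⟩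

theorem canonical_coded : (canonical 𝒮).Coded 𝒮 := by
  rw [coded_iff]
  exact ⟨show Rec 𝒮 (TT 𝒮) by fun_prop, rec_tlt⟩

theorem canonical_linear : (canonical 𝒮).IsLinear where
  irrefl a _ := tlt_irrefl a
  trans a _ b _ c _ := tlt_trans
  trichotomy a ha b hb := tlt_trichotomy ha.1 hb.1

theorem glex_canonical (s t : M) : glex 𝒮 (tlt 𝒮) s t ↔ tlt 𝒮 s t :=
  (isLex_glex rec_tlt).unique isLex_tlt (rec_glex rec_tlt) rec_tlt s t

/-- Together with `glex_canonical` this identifies G(T) with `GT`, domain and order alike. -/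
theorem gMem_canonical (s : M) : GMem 𝒮 (canonical 𝒮) s ↔ GT 𝒮 s := by
  have h := rec_gMem (canonical_coded (𝒮 := 𝒮))
  have hr : Rec 𝒮 (fun s => GMem 𝒮 (canonical 𝒮) s ↔ GT 𝒮 s) := by fun_prop
  refine strong_induction hr (fun s ih => ?_) s
  rw [isGDom_gMem canonical_coded, GT_iff]
  refine or_congr_right (exists_congr fun γ => exists_congr fun δ => exists_congr fun r =>
        and_congr_right ?_)
  rintro rfl
  rw [ih _ (exp_lt_gcons _ _ _), ih _ (tail_lt_gcons _ _ _)]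
  have : ∀ a b, glex 𝒮 (canonical 𝒮).lt a b ↔ tlt 𝒮 a b := glex_canonical
  simp only [this]
  rfl

/-- Membership of x in T amounts to x ∈ G(T↾x), so A_x = x is admissible. Both minimality and
cofinality rest on one dichotomy: a term σ of G(T) either lies in T, or some z in its support
satisfies σ ≤ z, and this z lies in T. -/
theorem canonical_isTerminationPoint :
    IsTerminationPoint 𝒮 (canonical 𝒮) (fun x : M => x) := by
  have hco := canonical_coded (𝒮 := 𝒮)
  have hlex : ∀ a b, glex 𝒮 (canonical 𝒮).lt a b ↔ tlt 𝒮 a b := glex_canonical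
  have hlex' : ∀ x a b, glex 𝒮 ((canonical 𝒮).below x).lt a b ↔ tlt 𝒮 a b :=
    fun _ => glex_canonical
  have hbelow : ∀ x s, GMem 𝒮 ((canonical 𝒮).below x) s ↔
      GT 𝒮 s ∧ ∀ z, InSupp 𝒮 z s → tlt 𝒮 z x := fun x s => by
    rw [gMem_below_iff hco, gMem_canonical]; rfl
  constructor
  · exact hco
  · exact canonical_linear
  · exact Rec.id.codedFun hco.1
  · intro x hx
    exact (hbelow x x).2 hx
  · intro x hx y hy
    rw [goodstein_lt_iff (hco.below x), hlex', hbelow, hbelow]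
    exact ⟨⟨hy.1.1, fun z hz => tlt_trans (hy.1.2 z hz) hy.2⟩, hx, hy.2⟩
  · intro x hx σ hσ h
    have hσ' := (hbelow x σ).1 hσ
    rw [goodstein_le_iff (hco.below x) ((hbelow x x).2 hx) hσ, hlex']
    rcases tlt_trichotomy hx.1 hσ'.1 with h1 | h1 | h1
    · exact Or.inr h1
    · exact Or.inl h1
    · exfalso
      -- Suppose σ < x. If σ ∈ T, then σ is one of the y < x and would be below itself. Otherwise a
      -- support element z of σ with σ ≤ z is one of the y < x, although σ should be above it.
      by_cases hT : ∀ z, InSupp 𝒮 z σ → tlt 𝒮 z σ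
      · have := h σ ⟨⟨hσ'.1, hT⟩, h1⟩
        rw [goodstein_lt_iff (hco.below x), hlex'] at this
        exact tlt_irrefl _ this.2.2
      · push Not at hT
        obtain ⟨z, hz, hz'⟩ := hT
        have := h z ⟨TT_of_inSupp hσ'.1 hz, hσ'.2 z hz⟩
        rw [goodstein_lt_iff (hco.below x), hlex'] at this
        exact hz' this.2.2
  · intro σ hσ
    have hσ' := (gMem_canonical σ).1 hσ
    have hle : ∀ x, TT 𝒮 x → (σ = x ∨ tlt 𝒮 σ x) → (goodstein 𝒮 (canonical 𝒮)).le σ x :=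
      fun x hx h => (goodstein_le_iff hco hσ ((gMem_canonical x).2 hx.1)).2 (by rwa [hlex])
    by_cases hT : ∀ z, InSupp 𝒮 z σ → tlt 𝒮 z σ
    · exact ⟨σ, ⟨hσ', hT⟩, Or.inl rfl⟩
    · push Not at hT
      obtain ⟨z, hz, hz'⟩ := hT
      have hzT := TT_of_inSupp hσ' hz
      refine ⟨z, hzT, hle z hzT ?_⟩
      rcases tlt_trichotomy hσ' hzT.1 with h1 | h1 | h1
      · exact Or.inr h1
      · exact Or.inl h1
      · exact absurd h1 hz'

theorem canonical_isRegular : IsRegularTerminationPoint 𝒮 (canonical 𝒮) (fun x : M => x) where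
  toIsTerminationPoint := canonical_isTerminationPoint
  height := ⟨fun x => x, Rec.id.codedFun canonical_coded.1, fun x _ y _ h => lt_of_inSupp h⟩

end Canonical

/-! ### Simultaneous recursion for two relations. -/

section Mutual

variable {M : Type*} [CommSemiring M] [LinearOrder M] [IsStrictOrderedRing M]
    [CanonicallyOrderedAdd M] [DiscreteNumbers M] {𝒮 : Set (Set M)} [hS : Fact (ModelsRCA0 𝒮)]

/-- Both truth values are stored in one number. The guard i + j < a + b is built into the relations
that F and G receive, which makes a separate locality hypothesis superfluous. -/
theorem exists_mutual_relations {F G : (M → M → Prop) → (M → M → Prop) → M → M → Prop}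
    (hF : Rec 𝒮 (fun q : M × M × M =>
      F (fun i j => i + j < q.2.1 + q.2.2 ∧ unpairL (app q.1 (pair i j)) = 1)
        (fun i j => i + j < q.2.1 + q.2.2 ∧ unpairR (app q.1 (pair i j)) = 1) q.2.1 q.2.2))
    (hG : Rec 𝒮 (fun q : M × M × M =>
      G (fun i j => i + j < q.2.1 + q.2.2 ∧ unpairL (app q.1 (pair i j)) = 1)
        (fun i j => i + j < q.2.1 + q.2.2 ∧ unpairR (app q.1 (pair i j)) = 1) q.2.1 q.2.2)) :
    ∃ P Q : M → M → Prop, Rec 𝒮 (fun q : M × M => P q.1 q.2) ∧ Rec 𝒮 (fun q : M × M => Q q.1 q.2) ∧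
      (∀ a b, P a b ↔ F (fun i j => i + j < a + b ∧ P i j) (fun i j => i + j < a + b ∧ Q i j) a b) ∧
      (∀ a b, Q a b ↔ G (fun i j => i + j < a + b ∧ P i j) (fun i j => i + j < a + b ∧ Q i j) a b) := by
  obtain ⟨f, hf, h⟩ := exists_recursion_two (𝒮 := 𝒮)
    (F := fun g a b => pair
      (Cond (F (fun i j => i + j < a + b ∧ unpairL (g i j) = 1)
        (fun i j => i + j < a + b ∧ unpairR (g i j) = 1) a b) 1 0)
      (Cond (G (fun i j => i + j < a + b ∧ unpairL (g i j) = 1)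
        (fun i j => i + j < a + b ∧ unpairR (g i j) = 1) a b) 1 0))
    (Rec.pair (Rec.cond hF (Rec.const 1) (Rec.const 0)) (Rec.cond hG (Rec.const 1) (Rec.const 0)))
    (fun g g' a b h => by
      have e1 : (fun i j => i + j < a + b ∧ unpairL (g i j) = 1) =
          (fun i j => i + j < a + b ∧ unpairL (g' i j) = 1) := by
        funext i j
        exact propext (and_congr_right fun hij => by rw [h i j hij])
      have e2 : (fun i j => i + j < a + b ∧ unpairR (g i j) = 1) =
          (fun i j => i + j < a + b ∧ unpairR (g' i j) = 1) := by
        funext i j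
        exact propext (and_congr_right fun hij => by rw [h i j hij])
      rw [e1, e2])
  have aux : ∀ p : Prop, (Cond p (1 : M) 0 = 1) ↔ p := fun p => by
    by_cases hp : p
    · simp [hp]
    · simp [hp]
  refine ⟨fun a b => unpairL (f a b) = 1, fun a b => unpairR (f a b) = 1, by fun_prop, by fun_prop,
    fun a b => ?_, fun a b => ?_⟩
  · beta_reduce
    conv_lhs => rw [h]
    rw [unpairL_pair, aux]
  · beta_reduce
    conv_lhs => rw [h]
    rw [unpairR_pair, aux]

end Mutual

/-! ### Existence of the notation system. -/

section Terms

variable {M : Type*} [CommSemiring M] [LinearOrder M] [IsStrictOrderedRing M]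
    [CanonicallyOrderedAdd M] [DiscreteNumbers M] {𝒮 : Set (Set M)} [hS : Fact (ModelsRCA0 𝒮)]

@[simp] theorem tTheta_inj {s t : M} : tTheta s = tTheta t ↔ s = t := by simp [tTheta, pair_inj]
@[simp] theorem tSum_inj {s t : M} : tSum s = tSum t ↔ s = t := by simp [tSum, pair_inj]
@[simp] theorem tOmega_ne_tTheta {s : M} : tOmega ≠ tTheta s := by
  simp [tOmega, tTheta, pair_inj]
@[simp] theorem tTheta_ne_tOmega {s : M} : tTheta s ≠ tOmega := tOmega_ne_tTheta.symm
@[simp] theorem tOmega_ne_tSum {s : M} : tOmega ≠ tSum s := by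
  simp [tOmega, tSum, pair_inj]
@[simp] theorem tSum_ne_tOmega {s : M} : tSum s ≠ tOmega := tOmega_ne_tSum.symm
@[simp] theorem tTheta_ne_tSum {s t : M} : tTheta s ≠ tSum t := by
  simp [tTheta, tSum, pair_inj]
@[simp] theorem tSum_ne_tTheta {s t : M} : tSum s ≠ tTheta t := tTheta_ne_tSum.symm

theorem lt_tTheta (s : M) : s < tTheta s := lt_pair_of_pos s zero_lt_one
theorem lt_tSum (s : M) : s < tSum s := lt_pair_of_pos s zero_lt_two

/-- The number is of the form `tTheta s`. -/
def IsTheta (s : M) : Prop := s = tTheta (unpairR s)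

/-- The number is of the form `tSum l`. -/
def IsSum (s : M) : Prop := s = tSum (unpairR s)

@[simp] theorem unpairR_tTheta (s : M) : unpairR (tTheta s) = s := unpairR_pair _ _
@[simp] theorem unpairR_tSum (s : M) : unpairR (tSum s) = s := unpairR_pair _ _
@[simp] theorem isTheta_tTheta (s : M) : IsTheta (tTheta s) := by simp [IsTheta]
@[simp] theorem isSum_tSum (s : M) : IsSum (tSum s) := by simp [IsSum]
@[simp] theorem not_isTheta_tSum (s : M) : ¬ IsTheta (tSum s) := by simp [IsTheta]
@[simp] theorem not_isTheta_tOmega : ¬ IsTheta (tOmega : M) := by simp [IsTheta]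

theorem isTheta_iff {s : M} : IsTheta s ↔ ∃ σ, s = tTheta σ :=
  ⟨fun h => ⟨_, h⟩, by rintro ⟨σ, rfl⟩; simp⟩

variable {α : Type*} [Enc M α]

@[fun_prop]
theorem Rec.tTheta {f : α → M} (hf : Rec 𝒮 f) : Rec 𝒮 (fun a => tTheta (f a)) := by
  unfold InvGoodstein.tTheta; fun_prop

@[fun_prop]
theorem Rec.tSum {f : α → M} (hf : Rec 𝒮 f) : Rec 𝒮 (fun a => tSum (f a)) := by
  unfold InvGoodstein.tSum; fun_prop

@[fun_prop]
theorem Rec.isTheta {f : α → M} (hf : Rec 𝒮 f) : Rec 𝒮 (fun a => IsTheta (f a)) := by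
  unfold IsTheta; fun_prop

@[fun_prop]
theorem Rec.isSum {f : α → M} (hf : Rec 𝒮 f) : Rec 𝒮 (fun a => IsSum (f a)) := by
  unfold IsSum; fun_prop

/-- The right hand side of the recursion equation for the order on terms. -/
def OTData.LtRhs (O : OTData M) (s t : M) : Prop :=
  (s = tOmega ∧ O.OmegaLt t) ∨ (∃ σ, s = tTheta σ ∧ O.ThetaLt σ t) ∨ (∃ k, s = tSum k ∧ O.SumLt k t)

/-- The right hand side of the recursion equation for the lexicographic order on sequences. -/
def OTData.SeqLtRhs (O : OTData M) (k l : M) : Prop :=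
  (k = nil ∧ l ≠ nil) ∨
    ∃ γ k' δ l', k = cons γ k' ∧ l = cons δ l' ∧ (O.lt γ δ ∨ (γ = δ ∧ O.seqLt k' l'))

/-- A version of the recursion equations in which the relations are not restricted to terms. -/
structure IsRawOT (O : OTData M) : Prop where
  term_iff : ∀ s, s ∈ O.term ↔ s = tOmega ∨ (∃ σ ∈ O.term, s = tTheta σ) ∨
    ∃ l ∈ O.seq, s = tSum l ∧
      ∀ γ, l = cons γ nil → ¬ (γ = tOmega ∨ ∃ σ ∈ O.term, γ = tTheta σ)
  seq_iff : ∀ l, l ∈ O.seq ↔ l = nil ∨ ∃ γ k, l = cons γ k ∧ γ ∈ O.term ∧ k ∈ O.seq ∧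
    ∀ γ' k', k = cons γ' k' → O.le γ' γ
  lt_iff : ∀ s t, O.lt s t ↔ O.LtRhs s t
  seqLt_iff : ∀ k l, O.seqLt k l ↔ O.SeqLtRhs k l
  memE_iff : ∀ x s, O.memE x s ↔
    ((∃ σ, s = tTheta σ ∧ x = s) ∨ ∃ l, s = tSum l ∧ O.seqMemE x l)
  seqMemE_iff : ∀ x l, O.seqMemE x l ↔ ∃ γ k, l = cons γ k ∧ (O.memE x γ ∨ O.seqMemE x k)

/-- All components are computable. -/
structure OTData.IsRec (𝒮 : Set (Set M)) (O : OTData M) : Prop where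
  term : Rec 𝒮 (fun s => s ∈ O.term)
  seq : Rec 𝒮 (fun s => s ∈ O.seq)
  lt : Rec 𝒮 (fun q : M × M => O.lt q.1 q.2)
  seqLt : Rec 𝒮 (fun q : M × M => O.seqLt q.1 q.2)
  memE : Rec 𝒮 (fun q : M × M => O.memE q.1 q.2)
  seqMemE : Rec 𝒮 (fun q : M × M => O.seqMemE q.1 q.2)

theorem OTData.coded_iff {O : OTData M} : O.Coded 𝒮 ↔ O.IsRec 𝒮 :=
  ⟨fun h => ⟨rec_mem_set h.1, rec_mem_set h.2, codedRel_iff.1 h.3, codedRel_iff.1 h.4,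
    codedRel_iff.1 h.5, codedRel_iff.1 h.6⟩,
   fun h => ⟨h.1.mem, h.2.mem, codedRel_iff.2 h.3, codedRel_iff.2 h.4, codedRel_iff.2 h.5,
    codedRel_iff.2 h.6⟩⟩

theorem exists_memE : ∃ E E' : M → M → Prop, Rec 𝒮 (fun q : M × M => E q.1 q.2) ∧
    Rec 𝒮 (fun q : M × M => E' q.1 q.2) ∧
    (∀ x s, E x s ↔ ((∃ σ, s = tTheta σ ∧ x = s) ∨ ∃ l, s = tSum l ∧ E' x l)) ∧
    (∀ x l, E' x l ↔ ∃ γ k, l = cons γ k ∧ (E x γ ∨ E' x k)) := by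
  obtain ⟨P, Q, hP, hQ, h1, h2⟩ := exists_mutual_relations (𝒮 := 𝒮)
    (F := fun p q x s => (IsTheta s ∧ x = s) ∨ (IsSum s ∧ q x (unpairR s)))
    (G := fun p q x l => IsCons l ∧ (p x (car l) ∨ q x (cdr l))) (by fun_prop) (by fun_prop)
  refine ⟨P, Q, hP, hQ, fun x s => ?_, fun x l => ?_⟩
  · rw [h1]
    constructor
    · rintro (⟨h, h'⟩ | ⟨h, -, h'⟩)
      · exact Or.inl ⟨_, h, h'⟩
      · exact Or.inr ⟨_, h, h'⟩
    · rintro (⟨σ, rfl, h'⟩ | ⟨l, rfl, h'⟩)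
      · exact Or.inl ⟨by simp, h'⟩
      · exact Or.inr ⟨by simp, by simpa using lt_tSum l, by simpa⟩
  · rw [h2]
    constructor
    · rintro ⟨h, h'⟩
      exact ⟨_, _, h, h'.imp And.right And.right⟩
    · rintro ⟨γ, k, rfl, h⟩
      simpa [lt_cons_left, lt_cons_right] using h

/-- This bounds the quantifiers over E(σ) in the definition of the order, and it shows that the
recursive calls at elements of E(σ) are legitimate. -/
theorem memE_le {E E' : M → M → Prop} (hr : Rec 𝒮 (fun q : M × M => E q.1 q.2))
    (hr' : Rec 𝒮 (fun q : M × M => E' q.1 q.2))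
    (h1 : ∀ x s, E x s ↔ ((∃ σ, s = tTheta σ ∧ x = s) ∨ ∃ l, s = tSum l ∧ E' x l))
    (h2 : ∀ x l, E' x l ↔ ∃ γ k, l = cons γ k ∧ (E x γ ∨ E' x k)) {x s : M} (h : E x s) : x ≤ s := by
  have h3 : Rec 𝒮 (fun s => Imp (E x s ∨ E' x s) (x ≤ s)) := by fun_prop
  refine strong_induction h3 (fun s ih h => ?_) s (Or.inl h)
  rcases h with h | h
  · rcases (h1 x s).1 h with ⟨-, -, h'⟩ | ⟨l, rfl, h'⟩
    · exact h'.le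
    · exact (ih l (lt_tSum l) (Or.inr h')).trans (lt_tSum l).le
  · obtain ⟨γ, k, rfl, h' | h'⟩ := (h2 x s).1 h
    · exact (ih γ (lt_cons_left _ _) (Or.inl h')).trans (lt_cons_left _ _).le
    · exact (ih k (lt_cons_right _ _) (Or.inr h')).trans (lt_cons_right _ _).le

/-- If the relations are not restricted to terms, the simultaneous recursion falls apart into three:
one for E, one for the orders on arbitrary codes, and one for terms and descending sequences. -/
theorem exists_rawOT : ∃ O : OTData M, O.IsRec 𝒮 ∧ IsRawOT O := by
  obtain ⟨E, E', hE, hE', hE1, hE2⟩ := exists_memE (𝒮 := 𝒮)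
  have hle : ∀ {x s}, E x s → x ≤ s := fun h => memE_le hE hE' hE1 hE2 h
  obtain ⟨L, S, hL, hS', h1, h2⟩ := exists_mutual_relations (𝒮 := 𝒮)
    (F := fun p q s t =>
      (s = tOmega ∧ IsSum t ∧ IsCons (unpairR t) ∧
        (tOmega = car (unpairR t) ∨ p tOmega (car (unpairR t)))) ∨
      (IsTheta s ∧ (t = tOmega ∨
        (IsTheta t ∧ ((Bex t fun x => E x (unpairR t) ∧ (s = x ∨ p s x)) ∨
          (p (unpairR s) (unpairR t) ∧ Ball s fun x => Imp (E x (unpairR s)) (p x t)))) ∨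
        (IsSum t ∧ IsCons (unpairR t) ∧ (s = car (unpairR t) ∨ p s (car (unpairR t)))))) ∨
      (IsSum s ∧ ((t = tOmega ∧ Imp (IsCons (unpairR s)) (p (car (unpairR s)) tOmega)) ∨
        (IsTheta t ∧ Imp (IsCons (unpairR s)) (p (car (unpairR s)) t)) ∨
        (IsSum t ∧ q (unpairR s) (unpairR t)))))
    (G := fun p q k l => (k = nil ∧ l ≠ nil) ∨ (IsCons k ∧ IsCons l ∧
      (p (car k) (car l) ∨ (car k = car l ∧ q (cdr k) (cdr l)))))
    (by fun_prop) (by simp only [ne_eq]; fun_prop)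
  -- These predicates are unary; the argument z is a dummy that is set to 0 in the end.
  obtain ⟨P, Q, hP, hQ, h3, h4⟩ := exists_mutual_relations (𝒮 := 𝒮)
    (F := fun p q s z => s = tOmega ∨ (IsTheta s ∧ p (unpairR s) z) ∨
      (IsSum s ∧ q (unpairR s) z ∧ Imp (IsCons (unpairR s) ∧ cdr (unpairR s) = nil)
        (¬ (car (unpairR s) = tOmega ∨ (IsTheta (car (unpairR s)) ∧
          p (unpairR (car (unpairR s))) z)))))
    (G := fun p q l z => l = nil ∨ (IsCons l ∧ p (car l) z ∧ q (cdr l) z ∧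
      Imp (IsCons (cdr l)) (car (cdr l) = car l ∨ L (car (cdr l)) (car l))))
    (by fun_prop) (by fun_prop)
  refine ⟨⟨{s | P s 0}, {s | Q s 0}, L, S, E, E'⟩, ⟨?_, ?_, hL, hS', hE, hE'⟩, ⟨?_, ?_, ?_, ?_, hE1, hE2⟩⟩
  · change Rec 𝒮 (fun s => P s 0)
    fun_prop
  · change Rec 𝒮 (fun s => Q s 0)
    fun_prop
  · intro s
    simp only [Set.mem_ofPred_eq]
    rw [h3]
    refine or_congr_right (or_congr ?_ ?_)
    · constructor
      · rintro ⟨h, -, h'⟩; exact ⟨_, h', h⟩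
      · rintro ⟨σ, h', rfl⟩; simpa [lt_tTheta] using h'
    · constructor
      · rintro ⟨h, ⟨-, h'⟩, h''⟩
        refine ⟨_, h', h, fun γ hγ => ?_⟩
        have h5 := h'' ⟨isCons_iff.2 ⟨_, _, hγ⟩, by rw [hγ]; simp⟩
        rw [hγ, car_cons] at h5
        rintro (h6 | ⟨σ, hσ, rfl⟩)
        · exact h5 (Or.inl h6)
        · refine h5 (Or.inr ⟨by simp, ?_, by simpa⟩)
          rw [unpairR_tTheta, add_zero, add_zero, h, hγ]
          exact (lt_tTheta σ).trans ((lt_cons_left _ _).trans (lt_tSum _))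
      · rintro ⟨l, hl, rfl, h⟩
        refine ⟨by simp, ⟨by simpa using lt_tSum l, by simpa⟩, ?_⟩
        rw [unpairR_tSum]
        rintro ⟨h5, h6⟩ h7
        have h8 : l = cons (car l) nil := by rw [← h6]; exact h5
        refine h _ h8 (h7.imp_right ?_)
        rintro ⟨h9, -, h10⟩
        exact ⟨_, h10, h9⟩
  · intro l
    simp only [Set.mem_ofPred_eq]
    rw [h4]
    refine or_congr_right ?_
    constructor
    · rintro ⟨h5, ⟨-, h6⟩, ⟨-, h7⟩, h8⟩
      refine ⟨_, _, h5, h6, h7, fun γ' k' hk => ?_⟩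
      have := h8 (isCons_iff.2 ⟨_, _, hk⟩)
      rw [hk, car_cons] at this
      exact this
    · rintro ⟨γ, k, rfl, h5, h6, h7⟩
      refine ⟨by simp, by simpa [lt_cons_left] using h5, by simpa [lt_cons_right] using h6, ?_⟩
      rw [cdr_cons, car_cons]
      exact fun hk => h7 _ _ hk
  · intro s t
    change L s t ↔ _
    rw [h1]
    refine or_congr ?_ (or_congr ?_ ?_)
    · refine and_congr_right ?_
      rintro rfl
      constructor
      · rintro ⟨h5, h6, h7⟩
        exact ⟨_, _, by rw [← h6]; exact h5, h7.imp_right And.right⟩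
      · rintro ⟨γ, l, rfl, h⟩
        have : γ < tSum (cons γ l) := (lt_cons_left _ _).trans (lt_tSum _)
        refine ⟨by simp, by simp, ?_⟩
        simpa [this, OTData.le] using h
    · constructor
      · rintro ⟨h, h'⟩
        obtain ⟨σ, rfl⟩ := isTheta_iff.1 h
        refine ⟨σ, rfl, ?_⟩
        simp only [unpairR_tTheta] at h'
        rcases h' with h' | ⟨h5, h'⟩ | ⟨h5, h6, h'⟩
        · exact Or.inl h'
        · obtain ⟨τ, rfl⟩ := isTheta_iff.1 h5
          simp only [unpairR_tTheta] at h'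
          refine Or.inr (Or.inl ⟨τ, rfl, ?_⟩)
          rcases h' with ⟨x, -, hx, h'⟩ | ⟨⟨-, h'⟩, h6⟩
          · exact Or.inl ⟨x, hx, h'.imp_right And.right⟩
          · exact Or.inr ⟨h', fun x hx => (h6 x (lt_of_le_of_lt (hle hx) (lt_tTheta _)) hx).2⟩
        · exact Or.inr (Or.inr ⟨_, _, by rw [← h6]; exact h5, h'.imp_right And.right⟩)
      · rintro ⟨σ, rfl, h⟩
        refine ⟨by simp, ?_⟩
        rcases h with h | ⟨τ, rfl, h⟩ | ⟨γ, l, rfl, h⟩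
        · exact Or.inl h
        · refine Or.inr (Or.inl ⟨by simp, ?_⟩)
          simp only [unpairR_tTheta]
          rcases h with ⟨x, hx, h⟩ | ⟨h, h'⟩
          · have hxt : x < tTheta τ := lt_of_le_of_lt (hle hx) (lt_tTheta _)
            exact Or.inl ⟨x, hxt, hx, h.imp_right fun h => ⟨by gcongr, h⟩⟩
          · refine Or.inr ⟨⟨add_lt_add (lt_tTheta _) (lt_tTheta _), h⟩, fun x hxs hx => ⟨?_, h' x hx⟩⟩
            gcongr
        · refine Or.inr (Or.inr ⟨by simp, by simp, ?_⟩)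
          have : γ < tSum (cons γ l) := (lt_cons_left _ _).trans (lt_tSum _)
          simp only [unpairR_tSum, car_cons]
          exact h.imp_right fun h => ⟨by gcongr, h⟩
    · constructor
      · rintro ⟨h, h'⟩
        refine ⟨_, h, ?_⟩
        rcases h' with ⟨h5, h'⟩ | ⟨h5, h'⟩ | ⟨h5, -, h'⟩
        · refine Or.inl ⟨h5, fun γ l hk => ?_⟩
          have := h' (isCons_iff.2 ⟨_, _, hk⟩)
          rw [hk, car_cons] at this
          exact this.2
        · refine Or.inr (Or.inl ⟨⟨_, h5⟩, fun γ l hk => ?_⟩)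
          have := h' (isCons_iff.2 ⟨_, _, hk⟩)
          rw [hk, car_cons] at this
          exact this.2
        · exact Or.inr (Or.inr ⟨_, h5, h'⟩)
      · rintro ⟨k, rfl, h⟩
        refine ⟨by simp, ?_⟩
        simp only [unpairR_tSum]
        rcases h with ⟨rfl, h⟩ | ⟨⟨τ, rfl⟩, h⟩ | ⟨m, rfl, h⟩
        · exact Or.inl ⟨rfl, fun hk => ⟨add_lt_add_left (hk.car_lt.trans (lt_tSum _)) _, h _ _ hk⟩⟩
        · exact Or.inr (Or.inl ⟨by simp,
            fun hk => ⟨add_lt_add_left (hk.car_lt.trans (lt_tSum _)) _, h _ _ hk⟩⟩)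
        · refine Or.inr (Or.inr ⟨by simp, ?_, by simpa⟩)
          simpa using add_lt_add (lt_tSum k) (lt_tSum m)
  · intro k l
    change S k l ↔ _
    rw [h2]
    refine or_congr_right ?_
    constructor
    · rintro ⟨h5, h6, h⟩
      exact ⟨_, _, _, _, h5, h6, h.imp And.right (And.imp_right And.right)⟩
    · rintro ⟨γ, k', δ, l', rfl, rfl, h⟩
      refine ⟨by simp, by simp, ?_⟩
      simp only [car_cons, cdr_cons]
      exact h.imp (fun h => ⟨add_lt_add (lt_cons_left _ _) (lt_cons_left _ _), h⟩)
        (And.imp_right fun h => ⟨add_lt_add (lt_cons_right _ _) (lt_cons_right _ _), h⟩)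

end Terms

/-! ### Evaluation, uniqueness and trichotomy of the notation system. -/

section NotationSystem

variable {M : Type*} [CommSemiring M] [LinearOrder M] [IsStrictOrderedRing M]
    [CanonicallyOrderedAdd M] [DiscreteNumbers M] {𝒮 : Set (Set M)} [hS : Fact (ModelsRCA0 𝒮)]

variable (𝒮) in
/-- The unrestricted solution of the recursion equations for the notation system. -/
noncomputable def rawOT : OTData M :=
  @Classical.epsilon _ ⟨⟨∅, ∅, fun _ _ => False, fun _ _ => False, fun _ _ => False, fun _ _ => False⟩⟩
    (fun O : OTData M => O.IsRec 𝒮 ∧ IsRawOT O)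

theorem rawOT_spec : (rawOT 𝒮).IsRec 𝒮 ∧ IsRawOT (rawOT 𝒮) := Classical.epsilon_spec exists_rawOT

variable (𝒮) in
/-- The number is a term of the notation system. -/
def IsTerm (s : M) : Prop := s ∈ (rawOT 𝒮).term
variable (𝒮) in
/-- The number is a weakly descending sequence of terms. -/
def IsSeq (l : M) : Prop := l ∈ (rawOT 𝒮).seq
variable (𝒮) in
/-- The unrestricted order on terms. -/
def olt (s t : M) : Prop := (rawOT 𝒮).lt s t
variable (𝒮) in
/-- The unrestricted lexicographic order on sequences. -/
def oseqLt (s t : M) : Prop := (rawOT 𝒮).seqLt s t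
variable (𝒮) in
/-- The unrestricted relation `x ∈ E(s)`. -/
def omemE (x s : M) : Prop := (rawOT 𝒮).memE x s
variable (𝒮) in
/-- The unrestricted relation `x ∈ E(γ₀) ∪ ⋯ ∪ E(γₙ₋₁)`. -/
def oseqMemE (x l : M) : Prop := (rawOT 𝒮).seqMemE x l
variable (𝒮) in
/-- The non-strict order on terms. -/
def ole (s t : M) : Prop := s = t ∨ olt 𝒮 s t

section RecLemmas
variable {α : Type*} [Enc M α] {f g : α → M}

@[fun_prop]
theorem Rec.isTerm (hf : Rec 𝒮 f) : Rec 𝒮 (fun a => IsTerm 𝒮 (f a)) := rawOT_spec.1.term.comp hf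
@[fun_prop]
theorem Rec.isSeq (hf : Rec 𝒮 f) : Rec 𝒮 (fun a => IsSeq 𝒮 (f a)) := rawOT_spec.1.seq.comp hf
@[fun_prop]
theorem Rec.olt (hf : Rec 𝒮 f) (hg : Rec 𝒮 g) : Rec 𝒮 (fun a => olt 𝒮 (f a) (g a)) :=
  rawOT_spec.1.lt.comp (hf.prodMk hg)
@[fun_prop]
theorem Rec.oseqLt (hf : Rec 𝒮 f) (hg : Rec 𝒮 g) : Rec 𝒮 (fun a => oseqLt 𝒮 (f a) (g a)) :=
  rawOT_spec.1.seqLt.comp (hf.prodMk hg)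
@[fun_prop]
theorem Rec.omemE (hf : Rec 𝒮 f) (hg : Rec 𝒮 g) : Rec 𝒮 (fun a => omemE 𝒮 (f a) (g a)) :=
  rawOT_spec.1.memE.comp (hf.prodMk hg)
@[fun_prop]
theorem Rec.oseqMemE (hf : Rec 𝒮 f) (hg : Rec 𝒮 g) : Rec 𝒮 (fun a => oseqMemE 𝒮 (f a) (g a)) :=
  rawOT_spec.1.seqMemE.comp (hf.prodMk hg)

end RecLemmas

/-! #### Evaluation of the recursion equations -/

theorem isTerm_tOmega : IsTerm 𝒮 (tOmega : M) := (rawOT_spec.2.term_iff _).2 (Or.inl rfl)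

theorem isTerm_tTheta {s : M} : IsTerm 𝒮 (tTheta s) ↔ IsTerm 𝒮 s := by
  refine (rawOT_spec.2.term_iff _).trans ⟨?_, fun h => Or.inr (Or.inl ⟨s, h, rfl⟩)⟩
  rintro (h | ⟨σ, h, e⟩ | ⟨l, h, e, -⟩)
  · simp at h
  · rw [tTheta_inj] at e; rwa [e]
  · simp at e

theorem isSeq_nil : IsSeq 𝒮 (nil : M) := (rawOT_spec.2.seq_iff _).2 (Or.inl rfl)

theorem isSeq_cons {a l : M} : IsSeq 𝒮 (cons a l) ↔ IsTerm 𝒮 a ∧ IsSeq 𝒮 l ∧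
    ∀ b k, l = cons b k → ole 𝒮 b a := by
  refine (rawOT_spec.2.seq_iff _).trans ⟨?_, fun h => Or.inr ⟨_, _, rfl, h⟩⟩
  rintro (h | ⟨γ, k, e, h⟩)
  · simp at h
  · obtain ⟨rfl, rfl⟩ := cons_inj.1 e
    exact h

theorem isSeq_cases {l : M} (h : IsSeq 𝒮 l) : l = nil ∨ ∃ a k, l = cons a k ∧ IsTerm 𝒮 a ∧ IsSeq 𝒮 k := by
  rcases (rawOT_spec.2.seq_iff _).1 h with h | ⟨γ, k, e, h1, h2, -⟩
  · exact Or.inl h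
  · exact Or.inr ⟨_, _, e, h1, h2⟩

theorem isTerm_tSum {l : M} : IsTerm 𝒮 (tSum l) ↔ IsSeq 𝒮 l ∧
    ∀ γ, l = cons γ nil → γ ≠ tOmega ∧ ∀ σ, γ ≠ tTheta σ := by
  refine (rawOT_spec.2.term_iff _).trans ⟨?_, fun h => Or.inr (Or.inr ⟨l, h.1, rfl, fun γ e => ?_⟩)⟩
  · rintro (h | ⟨σ, h, e⟩ | ⟨l, h, e, h'⟩)
    · simp at h
    · simp at e
    · rw [tSum_inj] at e
      subst e
      refine ⟨h, fun γ e => ?_⟩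
      subst e
      have := h' _ rfl
      push Not at this
      refine ⟨this.1, fun σ e => ?_⟩
      subst e
      exact this.2 σ (isTerm_tTheta.1 (isSeq_cons.1 h).1) rfl
  · rintro (h1 | ⟨σ, -, h1⟩)
    · exact (h.2 γ e).1 h1
    · exact (h.2 γ e).2 σ h1

theorem isTerm_cases {s : M} (h : IsTerm 𝒮 s) :
    s = tOmega ∨ (∃ σ, s = tTheta σ ∧ IsTerm 𝒮 σ) ∨ ∃ l, s = tSum l ∧ IsSeq 𝒮 l := by
  rcases (rawOT_spec.2.term_iff _).1 h with h | ⟨σ, h, e⟩ | ⟨l, h, e, -⟩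
  · exact Or.inl h
  · exact Or.inr (Or.inl ⟨_, e, h⟩)
  · exact Or.inr (Or.inr ⟨_, e, h⟩)

@[simp] theorem not_omemE_tOmega {x : M} : ¬ omemE 𝒮 x tOmega := fun h => by
  rcases (rawOT_spec.2.memE_iff _ _).1 h with ⟨σ, h, -⟩ | ⟨σ, h, -⟩ <;> simp at h

@[simp] theorem omemE_tTheta {x s : M} : omemE 𝒮 x (tTheta s) ↔ x = tTheta s := by
  refine (rawOT_spec.2.memE_iff _ _).trans ⟨?_, fun h => Or.inl ⟨_, rfl, h⟩⟩
  rintro (⟨σ, h, h'⟩ | ⟨l, h, -⟩)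
  · exact h'
  · simp at h

@[simp] theorem omemE_tSum {x l : M} : omemE 𝒮 x (tSum l) ↔ oseqMemE 𝒮 x l := by
  refine (rawOT_spec.2.memE_iff _ _).trans ⟨?_, fun h => Or.inr ⟨_, rfl, h⟩⟩
  rintro (⟨σ, h, h'⟩ | ⟨l, h, h'⟩)
  · simp at h
  · rw [tSum_inj] at h; rwa [h]

@[simp] theorem not_oseqMemE_nil {x : M} : ¬ oseqMemE 𝒮 x nil := fun h => by
  obtain ⟨γ, k, h, -⟩ := (rawOT_spec.2.seqMemE_iff _ _).1 h
  simp at h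

@[simp] theorem oseqMemE_cons {x a l : M} :
    oseqMemE 𝒮 x (cons a l) ↔ omemE 𝒮 x a ∨ oseqMemE 𝒮 x l := by
  refine (rawOT_spec.2.seqMemE_iff _ _).trans ⟨?_, fun h => ⟨_, _, rfl, h⟩⟩
  rintro ⟨γ, k, e, h⟩
  obtain ⟨rfl, rfl⟩ := cons_inj.1 e
  exact h

theorem omemE_le {x s : M} (h : omemE 𝒮 x s) : x ≤ s :=
  memE_le rawOT_spec.1.memE rawOT_spec.1.seqMemE rawOT_spec.2.memE_iff rawOT_spec.2.seqMemE_iff h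

theorem omemE_lt_tTheta {x s : M} (h : omemE 𝒮 x s) : x < tTheta s :=
  (omemE_le h).trans_lt (lt_tTheta s)

@[simp] theorem not_olt_tOmega_tOmega : ¬ olt 𝒮 (tOmega : M) tOmega := fun h => by
  rcases (rawOT_spec.2.lt_iff _ _).1 h with ⟨-, γ, l, h, -⟩ | ⟨σ, h, -⟩ | ⟨k, h, -⟩ <;> simp at h

@[simp] theorem not_olt_tOmega_tTheta {s : M} : ¬ olt 𝒮 (tOmega : M) (tTheta s) := fun h => by
  rcases (rawOT_spec.2.lt_iff _ _).1 h with ⟨-, γ, l, h, -⟩ | ⟨σ, h, -⟩ | ⟨k, h, -⟩ <;> simp at h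

theorem olt_tOmega_tSum {l : M} :
    olt 𝒮 tOmega (tSum l) ↔ ∃ γ k, l = cons γ k ∧ ole 𝒮 tOmega γ := by
  refine (rawOT_spec.2.lt_iff _ _).trans ⟨?_, ?_⟩
  · rintro (⟨-, γ, l, h, h'⟩ | ⟨σ, h, -⟩ | ⟨k, h, -⟩)
    · exact ⟨γ, l, tSum_inj.1 h, h'⟩
    · simp at h
    · simp at h
  · rintro ⟨γ, k, rfl, h⟩
    exact Or.inl ⟨rfl, _, _, rfl, h⟩

@[simp] theorem olt_tTheta_tOmega {s : M} : olt 𝒮 (tTheta s) tOmega :=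
  (rawOT_spec.2.lt_iff _ _).2 (Or.inr (Or.inl ⟨_, rfl, Or.inl rfl⟩))

theorem olt_tTheta_iff {s t : M} : olt 𝒮 (tTheta s) t ↔ (rawOT 𝒮).ThetaLt s t := by
  refine (rawOT_spec.2.lt_iff _ _).trans ⟨?_, fun h => Or.inr (Or.inl ⟨_, rfl, h⟩)⟩
  rintro (⟨h, -⟩ | ⟨σ, h, h'⟩ | ⟨k, h, -⟩)
  · simp at h
  · rw [tTheta_inj] at h; rwa [h]
  · simp at h

theorem olt_tSum_iff {k t : M} : olt 𝒮 (tSum k) t ↔ (rawOT 𝒮).SumLt k t := by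
  refine (rawOT_spec.2.lt_iff _ _).trans ⟨?_, fun h => Or.inr (Or.inr ⟨_, rfl, h⟩)⟩
  rintro (⟨h, -⟩ | ⟨σ, h, -⟩ | ⟨k, h, h'⟩)
  · simp at h
  · simp at h
  · rw [tSum_inj] at h; rwa [h]

theorem olt_tTheta_tTheta {s t : M} : olt 𝒮 (tTheta s) (tTheta t) ↔
    (∃ x, omemE 𝒮 x t ∧ ole 𝒮 (tTheta s) x) ∨
      (olt 𝒮 s t ∧ ∀ x, omemE 𝒮 x s → olt 𝒮 x (tTheta t)) := by
  refine olt_tTheta_iff.trans ⟨?_, fun h => Or.inr (Or.inl ⟨_, rfl, h⟩)⟩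
  rintro (h | ⟨τ, h, h'⟩ | ⟨γ, l, h, -⟩)
  · simp at h
  · rw [tTheta_inj] at h; subst h; exact h'
  · simp at h

theorem olt_tTheta_tSum {s l : M} :
    olt 𝒮 (tTheta s) (tSum l) ↔ ∃ γ k, l = cons γ k ∧ ole 𝒮 (tTheta s) γ := by
  refine olt_tTheta_iff.trans ⟨?_, ?_⟩
  · rintro (h | ⟨τ, h, -⟩ | ⟨γ, l, h, h'⟩)
    · simp at h
    · simp at h
    · exact ⟨γ, l, tSum_inj.1 h, h'⟩
  · rintro ⟨γ, k, rfl, h⟩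
    exact Or.inr (Or.inr ⟨_, _, rfl, h⟩)

theorem olt_tSum_tOmega {l : M} :
    olt 𝒮 (tSum l) tOmega ↔ ∀ γ k, l = cons γ k → olt 𝒮 γ tOmega := by
  refine olt_tSum_iff.trans ⟨?_, fun h => Or.inl ⟨rfl, h⟩⟩
  rintro (⟨-, h⟩ | ⟨⟨τ, h⟩, -⟩ | ⟨m, h, -⟩)
  · exact h
  · simp at h
  · simp at h

theorem olt_tSum_tTheta {l t : M} :
    olt 𝒮 (tSum l) (tTheta t) ↔ ∀ γ k, l = cons γ k → olt 𝒮 γ (tTheta t) := by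
  refine olt_tSum_iff.trans ⟨?_, fun h => Or.inr (Or.inl ⟨⟨_, rfl⟩, h⟩)⟩
  rintro (⟨h, -⟩ | ⟨-, h⟩ | ⟨m, h, -⟩)
  · simp at h
  · exact h
  · simp at h

@[simp] theorem olt_tSum_tSum {k l : M} : olt 𝒮 (tSum k) (tSum l) ↔ oseqLt 𝒮 k l := by
  refine olt_tSum_iff.trans ⟨?_, fun h => Or.inr (Or.inr ⟨_, rfl, h⟩)⟩
  rintro (⟨h, -⟩ | ⟨⟨τ, h⟩, -⟩ | ⟨m, h, h'⟩)
  · simp at h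
  · simp at h
  · rw [tSum_inj] at h; subst h; exact h'

@[simp] theorem not_oseqLt_nil {k : M} : ¬ oseqLt 𝒮 k nil := fun h => by
  rcases (rawOT_spec.2.seqLt_iff _ _).1 h with ⟨-, h⟩ | ⟨γ, k', δ, l', -, h, -⟩
  · exact h rfl
  · simp at h

@[simp] theorem oseqLt_nil_cons {a l : M} : oseqLt 𝒮 nil (cons a l) :=
  (rawOT_spec.2.seqLt_iff _ _).2 (Or.inl ⟨rfl, by simp⟩)

theorem oseqLt_cons_cons {a k b l : M} : oseqLt 𝒮 (cons a k) (cons b l) ↔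
    olt 𝒮 a b ∨ (a = b ∧ oseqLt 𝒮 k l) := by
  refine (rawOT_spec.2.seqLt_iff _ _).trans ⟨?_, fun h => Or.inr ⟨_, _, _, _, rfl, rfl, h⟩⟩
  rintro (⟨h, -⟩ | ⟨γ, k', δ, l', h, h', h''⟩)
  · simp at h
  · obtain ⟨rfl, rfl⟩ := cons_inj.1 h
    obtain ⟨rfl, rfl⟩ := cons_inj.1 h'
    exact h''

theorem exists_of_omemE {x s : M} (h : omemE 𝒮 x s) : ∃ t, x = tTheta t := by
  have h3 : Rec 𝒮 (fun s => Imp (omemE 𝒮 x s ∨ oseqMemE 𝒮 x s) (IsTheta x)) := by fun_prop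
  refine ⟨_, (strong_induction h3 (fun s ih h => ?_) s (Or.inl h) : IsTheta x)⟩
  rcases h with h | h
  · rcases (rawOT_spec.2.memE_iff _ _).1 h with ⟨σ, rfl, rfl⟩ | ⟨l, rfl, h'⟩
    · simp
    · exact ih l (lt_tSum l) (Or.inr h')
  · obtain ⟨γ, k, rfl, h' | h'⟩ := (rawOT_spec.2.seqMemE_iff _ _).1 h
    · exact ih γ (lt_cons_left _ _) (Or.inl h')
    · exact ih k (lt_cons_right _ _) (Or.inr h')

/-! #### Uniqueness of the notation system -/

/-- The sets of terms and sequences are closed under subterms. -/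
structure OTData.SubtermClosed (O : OTData M) : Prop where
  theta : ∀ s, tTheta s ∈ O.term → s ∈ O.term
  sum : ∀ l, tSum l ∈ O.term → l ∈ O.seq
  head : ∀ a l, cons a l ∈ O.seq → a ∈ O.term
  tail : ∀ a l, cons a l ∈ O.seq → l ∈ O.seq

theorem IsOT.subtermClosed {O : OTData M} (h : IsOT O) : O.SubtermClosed where
  theta s hs := by
    rcases (h.term_iff _).1 hs with e | ⟨σ, h, e⟩ | ⟨l, h, e, -⟩
    · simp at e
    · rw [tTheta_inj] at e; rwa [e]
    · simp at e
  sum s hs := by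
    rcases (h.term_iff _).1 hs with e | ⟨σ, h, e⟩ | ⟨l, h, e, -⟩
    · simp at e
    · simp at e
    · rw [tSum_inj] at e; rwa [e]
  head a l hs := by
    rcases (h.seq_iff _).1 hs with e | ⟨γ, k, e, h, -⟩
    · simp at e
    · obtain ⟨rfl, rfl⟩ := cons_inj.1 e; exact h
  tail a l hs := by
    rcases (h.seq_iff _).1 hs with e | ⟨γ, k, e, -, h, -⟩
    · simp at e
    · obtain ⟨rfl, rfl⟩ := cons_inj.1 e; exact h

include hS in
theorem OTData.SubtermClosed.memE {O : OTData M} (h : O.SubtermClosed) (hO : O.Coded 𝒮) {x s : M}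
    (hs : s ∈ O.term) (hx : omemE 𝒮 x s) : x ∈ O.term := by
  have h1 := (OTData.coded_iff.1 hO).term
  have h2 := (OTData.coded_iff.1 hO).seq
  have h3 : Rec 𝒮 (fun s => Imp ((s ∈ O.term ∧ omemE 𝒮 x s) ∨ (s ∈ O.seq ∧ oseqMemE 𝒮 x s))
    (x ∈ O.term)) := by fun_prop
  refine strong_induction h3 (fun s ih h => ?_) s (Or.inl ⟨hs, hx⟩)
  rcases h with ⟨h0, h'⟩ | ⟨h0, h'⟩
  · rcases (rawOT_spec.2.memE_iff _ _).1 h' with ⟨σ, rfl, rfl⟩ | ⟨l, rfl, h4⟩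
    · exact h0
    · exact ih l (lt_tSum l) (Or.inr ⟨h.sum _ h0, h4⟩)
  · obtain ⟨γ, k, rfl, h' | h'⟩ := (rawOT_spec.2.seqMemE_iff _ _).1 h'
    · exact ih γ (lt_cons_left _ _) (Or.inl ⟨h.head _ _ h0, h'⟩)
    · exact ih k (lt_cons_right _ _) (Or.inr ⟨h.tail _ _ h0, h'⟩)

/-- The right hand side consults the relations only at terms with a smaller sum of codes. It serves
twice: to see that the restriction of the raw solution solves the official equations, and to see
that every official solution agrees with the raw one on its terms. -/
theorem OTData.SubtermClosed.ltRhs_congr {O : OTData M} (h : O.SubtermClosed) {s t : M}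
    (hs : s ∈ O.term) (ht : t ∈ O.term)
    (hE : ∀ x u, u ∈ O.term → (O.memE x u ↔ omemE 𝒮 x u))
    (hE' : ∀ x u, u ∈ O.term → omemE 𝒮 x u → x ∈ O.term)
    (hlt : ∀ a b, a ∈ O.term → b ∈ O.term → a + b < s + t → (O.lt a b ↔ olt 𝒮 a b))
    (hseq : ∀ a b, a ∈ O.seq → b ∈ O.seq → a + b < s + t → (O.seqLt a b ↔ oseqLt 𝒮 a b)) :
    O.LtRhs s t ↔ (rawOT 𝒮).LtRhs s t := by
  have e : ∀ a b, a ∈ O.term → b ∈ O.term → a + b < s + t → (O.le a b ↔ (rawOT 𝒮).le a b) :=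
    fun a b ha hb hab => or_congr_right (hlt a b ha hb hab)
  refine or_congr ?_ (or_congr ?_ ?_)
  · refine and_congr_right ?_
    rintro rfl
    refine exists_congr fun γ => exists_congr fun l => and_congr_right ?_
    rintro rfl
    exact e _ _ hs (h.head _ _ (h.sum _ ht))
      (add_lt_add_right ((lt_cons_left _ _).trans (lt_tSum _)) _)
  · refine exists_congr fun σ => and_congr_right ?_
    rintro rfl
    refine or_congr_right (or_congr ?_ ?_)
    · refine exists_congr fun τ => and_congr_right ?_
      rintro rfl
      have hσ := h.theta _ hs
      have hτ := h.theta _ ht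
      refine or_congr (exists_congr fun x => ?_) (and_congr ?_ (forall_congr' fun x => ?_))
      · rw [hE x τ hτ]
        exact and_congr_right fun hx => e _ _ hs (hE' _ _ hτ hx)
          (add_lt_add_right (omemE_lt_tTheta hx) _)
      · exact hlt _ _ hσ hτ (add_lt_add (lt_tTheta _) (lt_tTheta _))
      · rw [hE x σ hσ]
        exact imp_congr_right fun hx => hlt _ _ (hE' _ _ hσ hx) ht
          (add_lt_add_left (omemE_lt_tTheta hx) _)
    · refine exists_congr fun γ => exists_congr fun l => and_congr_right ?_
      rintro rfl
      exact e _ _ hs (h.head _ _ (h.sum _ ht))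
        (add_lt_add_right ((lt_cons_left _ _).trans (lt_tSum _)) _)
  · refine exists_congr fun k => and_congr_right ?_
    rintro rfl
    have hk : ∀ γ l, k = cons γ l → (O.lt γ t ↔ olt 𝒮 γ t) := by
      rintro γ l rfl
      exact hlt _ _ (h.head _ _ (h.sum _ hs)) ht
        (add_lt_add_left ((lt_cons_left _ _).trans (lt_tSum _)) _)
    refine or_congr ?_ (or_congr ?_ ?_)
    · refine and_congr_right ?_
      rintro rfl
      exact forall_congr' fun γ => forall_congr' fun l => imp_congr_right (hk γ l)
    · refine and_congr_right fun _ => ?_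
      exact forall_congr' fun γ => forall_congr' fun l => imp_congr_right (hk γ l)
    · refine exists_congr fun m => and_congr_right ?_
      rintro rfl
      exact hseq _ _ (h.sum _ hs) (h.sum _ ht) (add_lt_add (lt_tSum _) (lt_tSum _))

theorem OTData.SubtermClosed.seqLtRhs_congr {O : OTData M} (h : O.SubtermClosed) {s t : M}
    (hs : s ∈ O.seq) (ht : t ∈ O.seq)
    (hlt : ∀ a b, a ∈ O.term → b ∈ O.term → a + b < s + t → (O.lt a b ↔ olt 𝒮 a b))
    (hseq : ∀ a b, a ∈ O.seq → b ∈ O.seq → a + b < s + t → (O.seqLt a b ↔ oseqLt 𝒮 a b)) :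
    O.SeqLtRhs s t ↔ (rawOT 𝒮).SeqLtRhs s t := by
  refine or_congr_right (exists_congr fun γ => exists_congr fun k => exists_congr fun δ =>
    exists_congr fun l => and_congr_right ?_)
  rintro rfl
  refine and_congr_right ?_
  rintro rfl
  exact or_congr (hlt _ _ (h.head _ _ hs) (h.head _ _ ht)
    (add_lt_add (lt_cons_left _ _) (lt_cons_left _ _))) (and_congr_right fun _ =>
    hseq _ _ (h.tail _ _ hs) (h.tail _ _ ht) (add_lt_add (lt_cons_right _ _) (lt_cons_right _ _)))

variable (𝒮) in
/-- The notation system, with all relations restricted to terms and sequences. -/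
noncomputable def restrictedOT : OTData M where
  term := (rawOT 𝒮).term
  seq := (rawOT 𝒮).seq
  lt s t := IsTerm 𝒮 s ∧ IsTerm 𝒮 t ∧ olt 𝒮 s t
  seqLt s t := IsSeq 𝒮 s ∧ IsSeq 𝒮 t ∧ oseqLt 𝒮 s t
  memE x s := IsTerm 𝒮 s ∧ omemE 𝒮 x s
  seqMemE x s := IsSeq 𝒮 s ∧ oseqMemE 𝒮 x s

theorem restrictedOT_coded : (restrictedOT 𝒮).Coded 𝒮 := by
  refine OTData.coded_iff.2 ⟨rawOT_spec.1.term, rawOT_spec.1.seq, ?_, ?_, ?_, ?_⟩ <;>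
  · simp only [restrictedOT]
    fun_prop

theorem restrictedOT_subtermClosed : (restrictedOT 𝒮).SubtermClosed where
  theta _ := isTerm_tTheta.1
  sum _ h := (isTerm_tSum.1 h).1
  head _ _ h := (isSeq_cons.1 h).1
  tail _ _ h := (isSeq_cons.1 h).2.1

theorem IsTerm.of_omemE {x s : M} (hs : IsTerm 𝒮 s) (hx : omemE 𝒮 x s) : IsTerm 𝒮 x :=
  restrictedOT_subtermClosed.memE restrictedOT_coded hs hx

theorem isOT_restrictedOT : IsOT (restrictedOT 𝒮) where
  term_iff := rawOT_spec.2.term_iff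
  seq_iff l := by
    refine (rawOT_spec.2.seq_iff l).trans (or_congr_right (exists_congr fun γ => exists_congr fun k =>
      and_congr_right ?_))
    rintro rfl
    refine and_congr_right fun h1 => and_congr_right fun h2 => forall_congr' fun γ' =>
      forall_congr' fun k' => imp_congr_right ?_
    rintro rfl
    refine or_congr_right ⟨fun h => ⟨(isSeq_cons.1 h2).1, h1, h⟩, fun h => h.2.2⟩
  lt_iff s t := by
    refine and_congr_right fun hs => and_congr_right fun ht => (rawOT_spec.2.lt_iff s t).trans ?_
    refine (restrictedOT_subtermClosed.ltRhs_congr hs ht ?_ ?_ ?_ ?_).symm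
    · exact fun x u hu => ⟨And.right, fun h => ⟨hu, h⟩⟩
    · exact fun x u hu hx => IsTerm.of_omemE hu hx
    · exact fun a b ha hb _ => ⟨fun h => h.2.2, fun h => ⟨ha, hb, h⟩⟩
    · exact fun a b ha hb _ => ⟨fun h => h.2.2, fun h => ⟨ha, hb, h⟩⟩
  seqLt_iff s t := by
    refine and_congr_right fun hs => and_congr_right fun ht => (rawOT_spec.2.seqLt_iff s t).trans ?_
    refine (restrictedOT_subtermClosed.seqLtRhs_congr hs ht ?_ ?_).symm
    · exact fun a b ha hb _ => ⟨fun h => h.2.2, fun h => ⟨ha, hb, h⟩⟩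
    · exact fun a b ha hb _ => ⟨fun h => h.2.2, fun h => ⟨ha, hb, h⟩⟩
  memE_iff x s := by
    refine and_congr_right fun hs => (rawOT_spec.2.memE_iff x s).trans (or_congr_right
      (exists_congr fun l => and_congr_right ?_))
    rintro rfl
    exact ⟨fun h => ⟨(isTerm_tSum.1 hs).1, h⟩, And.right⟩
  seqMemE_iff x l := by
    refine and_congr_right fun hl => (rawOT_spec.2.seqMemE_iff x l).trans
      (exists_congr fun γ => exists_congr fun k => and_congr_right ?_)
    rintro rfl
    exact or_congr ⟨fun h => ⟨(isSeq_cons.1 hl).1, h⟩, And.right⟩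
      ⟨fun h => ⟨(isSeq_cons.1 hl).2.1, h⟩, And.right⟩

include hS in
theorem IsOT.memE_iff_omemE {O : OTData M} (hO : O.Coded 𝒮) (h : IsOT O) (x s : M) :
    (s ∈ O.term → (O.memE x s ↔ omemE 𝒮 x s)) ∧ (s ∈ O.seq → (O.seqMemE x s ↔ oseqMemE 𝒮 x s)) := by
  obtain ⟨h1, h2, -, -, h3, h4⟩ := OTData.coded_iff.1 hO
  have hc := h.subtermClosed
  have hr : Rec 𝒮 (fun s => Imp (s ∈ O.term) (O.memE x s ↔ omemE 𝒮 x s) ∧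
    Imp (s ∈ O.seq) (O.seqMemE x s ↔ oseqMemE 𝒮 x s)) := by fun_prop
  refine strong_induction hr (fun s ih => ⟨fun hs => ?_, fun hs => ?_⟩) s
  · rw [h.memE_iff, and_iff_right hs]
    refine Iff.trans (or_congr_right (exists_congr fun l => and_congr_right ?_))
      (rawOT_spec.2.memE_iff x s).symm
    rintro rfl
    exact (ih l (lt_tSum l)).2 (hc.sum _ hs)
  · rw [h.seqMemE_iff, and_iff_right hs]
    refine Iff.trans (exists_congr fun γ => exists_congr fun k => and_congr_right ?_)
      (rawOT_spec.2.seqMemE_iff x s).symm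
    rintro rfl
    exact or_congr ((ih _ (lt_cons_left _ _)).1 (hc.head _ _ hs))
      ((ih _ (lt_cons_right _ _)).2 (hc.tail _ _ hs))

include hS in
theorem IsOT.lt_iff_olt {O : OTData M} (hO : O.Coded 𝒮) (h : IsOT O) (s t : M) :
    (s ∈ O.term → t ∈ O.term → (O.lt s t ↔ olt 𝒮 s t)) ∧
      (s ∈ O.seq → t ∈ O.seq → (O.seqLt s t ↔ oseqLt 𝒮 s t)) := by
  obtain ⟨h1, h2, h3, h4, -, -⟩ := OTData.coded_iff.1 hO
  have hc := h.subtermClosed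
  have hr : Rec 𝒮 (fun q : M × M =>
    Imp (q.1 ∈ O.term) (Imp (q.2 ∈ O.term) (O.lt q.1 q.2 ↔ olt 𝒮 q.1 q.2)) ∧
    Imp (q.1 ∈ O.seq) (Imp (q.2 ∈ O.seq) (O.seqLt q.1 q.2 ↔ oseqLt 𝒮 q.1 q.2))) := by fun_prop
  refine strong_induction_two hr (fun s t ih => ⟨fun hs ht => ?_, fun hs ht => ?_⟩) s t
  · dsimp only at ih hs ht ⊢
    rw [h.lt_iff, and_iff_right hs, and_iff_right ht]
    refine Iff.trans (hc.ltRhs_congr hs ht ?_ ?_ ?_ ?_) (rawOT_spec.2.lt_iff s t).symm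
    · exact fun x u hu => (h.memE_iff_omemE hO x u).1 hu
    · exact fun x u hu hx => hc.memE hO hu hx
    · exact fun a b ha hb hab => (ih a b hab).1 ha hb
    · exact fun a b ha hb hab => (ih a b hab).2 ha hb
  · dsimp only at ih hs ht ⊢
    rw [h.seqLt_iff, and_iff_right hs, and_iff_right ht]
    refine Iff.trans (hc.seqLtRhs_congr hs ht ?_ ?_) (rawOT_spec.2.seqLt_iff s t).symm
    · exact fun a b ha hb hab => (ih a b hab).1 ha hb
    · exact fun a b ha hb hab => (ih a b hab).2 ha hb

include hS in
theorem IsOT.mem_term_iff {O : OTData M} (hO : O.Coded 𝒮) (h : IsOT O) (s : M) :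
    (s ∈ O.term ↔ IsTerm 𝒮 s) ∧ (s ∈ O.seq ↔ IsSeq 𝒮 s) := by
  obtain ⟨h1, h2, -, -, -, -⟩ := OTData.coded_iff.1 hO
  have hc := h.subtermClosed
  have hr : Rec 𝒮 (fun s => (s ∈ O.term ↔ IsTerm 𝒮 s) ∧ (s ∈ O.seq ↔ IsSeq 𝒮 s)) := by fun_prop
  refine strong_induction hr (fun s ih => ⟨?_, ?_⟩) s
  · refine (h.term_iff s).trans (Iff.trans (or_congr_right (or_congr ?_ ?_))
      (rawOT_spec.2.term_iff s).symm)
    · refine exists_congr fun σ => ?_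
      rw [and_comm, and_comm (a := _ ∈ _)]
      refine and_congr_right ?_
      rintro rfl
      exact (ih _ (lt_tTheta _)).1
    · refine exists_congr fun l => ?_
      rw [and_left_comm, and_left_comm (a := _ ∈ _)]
      refine and_congr_right ?_
      rintro rfl
      refine and_congr (ih _ (lt_tSum _)).2 (forall_congr' fun γ => imp_congr_right ?_)
      rintro rfl
      refine not_congr (or_congr_right (exists_congr fun σ => ?_))
      rw [and_comm, and_comm (a := _ ∈ _)]
      refine and_congr_right ?_
      rintro rfl
      exact (ih _ ((lt_tTheta _).trans ((lt_cons_left _ _).trans (lt_tSum _)))).1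
  · refine (h.seq_iff s).trans (Iff.trans (or_congr_right (exists_congr fun γ =>
      exists_congr fun k => and_congr_right ?_)) (rawOT_spec.2.seq_iff s).symm)
    rintro rfl
    have e1 := (ih _ (lt_cons_left γ k)).1
    have e2 := (ih _ (lt_cons_right γ k)).2
    rw [← and_assoc, ← and_assoc]
    refine Iff.trans (and_congr_right ?_) (and_congr_left' (and_congr e1 e2))
    rintro ⟨hγ, hk⟩
    refine forall_congr' fun γ' => forall_congr' fun k' => imp_congr_right ?_
    rintro rfl
    exact or_congr_right ((h.lt_iff_olt hO _ _).1 (hc.head _ _ hk) hγ)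

/-- By uniqueness, the choice of the solution O in the definition of `bachmannHoward` is irrelevant,
and one can compute with the raw order from here on. -/
theorem bachmannHoward_lt_iff {s t : M} :
    (bachmannHoward 𝒮).lt s t ↔ IsTerm 𝒮 s ∧ IsTerm 𝒮 t ∧ olt 𝒮 s t := by
  constructor
  · rintro ⟨O, hO, h, hlt⟩
    obtain ⟨hs, ht, -⟩ := (h.lt_iff _ _).1 hlt
    exact ⟨(h.mem_term_iff hO _).1.1 hs, (h.mem_term_iff hO _).1.1 ht,
      ((h.lt_iff_olt hO _ _).1 hs ht).1 hlt⟩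
  · intro h
    exact ⟨_, restrictedOT_coded, isOT_restrictedOT, h⟩

theorem mem_bachmannHoward_iff {s : M} :
    s ∈ (bachmannHoward 𝒮).dom ↔ IsTerm 𝒮 s ∧ olt 𝒮 s tOmega := by
  refine (bachmannHoward_lt_iff (𝒮 := 𝒮) (s := s) (t := tOmega)).trans ?_
  simp [isTerm_tOmega]

theorem bachmannHoward_dom_mem : (bachmannHoward 𝒮).dom ∈ 𝒮 := by
  have h : Rec 𝒮 (fun s => IsTerm 𝒮 s ∧ olt 𝒮 s tOmega) := by fun_prop
  convert h.mem
  ext s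
  exact mem_bachmannHoward_iff

/-- Trichotomy needs no transitivity. Asymmetry is not proved syntactically; it will follow from the
interpretation in Goodstein terms. -/
theorem olt_trichotomy {s t : M} (hs : IsTerm 𝒮 s) (ht : IsTerm 𝒮 t) :
    olt 𝒮 s t ∨ s = t ∨ olt 𝒮 t s := by
  have hr : Rec 𝒮 (fun q : M × M =>
    Imp (IsTerm 𝒮 q.1) (Imp (IsTerm 𝒮 q.2) (olt 𝒮 q.1 q.2 ∨ q.1 = q.2 ∨ olt 𝒮 q.2 q.1)) ∧
    Imp (IsSeq 𝒮 q.1) (Imp (IsSeq 𝒮 q.2) (oseqLt 𝒮 q.1 q.2 ∨ q.1 = q.2 ∨ oseqLt 𝒮 q.2 q.1))) := by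
    fun_prop
  refine (strong_induction_two hr (fun s t ih => ?_) s t).1 hs ht
  have ih1 : ∀ a b, a + b < s + t → IsTerm 𝒮 a → IsTerm 𝒮 b → (olt 𝒮 a b ∨ a = b ∨ olt 𝒮 b a) :=
    fun a b h ha hb => (ih a b h).1 ha hb
  have ih2 : ∀ a b, a + b < s + t → IsSeq 𝒮 a → IsSeq 𝒮 b → (oseqLt 𝒮 a b ∨ a = b ∨ oseqLt 𝒮 b a) :=
    fun a b h ha hb => (ih a b h).2 ha hb
  clear ih
  refine ⟨fun hs ht => ?_, fun hs ht => ?_⟩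
  · dsimp only at hs ht ⊢
    have key : ∀ u l, IsTerm 𝒮 u → u = s ∨ u = t → tSum l = s ∨ tSum l = t → u + tSum l = s + t →
        IsSeq 𝒮 l → ((∃ γ k, l = cons γ k ∧ ole 𝒮 u γ) ∨ ∀ γ k, l = cons γ k → olt 𝒮 γ u) := by
      intro u l hu _ _ e hl
      rcases isSeq_cases hl with rfl | ⟨a, k, rfl, ha, hk⟩
      · exact Or.inr fun γ k h => by simp at h
      · have : u + a < s + t := by
          rw [← e]; exact add_lt_add_right ((lt_cons_left _ _).trans (lt_tSum _)) _
        rcases ih1 _ _ this hu ha with h | h | h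
        · exact Or.inl ⟨_, _, rfl, Or.inr h⟩
        · exact Or.inl ⟨_, _, rfl, Or.inl h⟩
        · refine Or.inr fun γ k h' => ?_
          obtain ⟨rfl, rfl⟩ := cons_inj.1 h'
          exact h
    have key2 : ∀ σ τ, IsTerm 𝒮 σ → IsTerm 𝒮 τ → tTheta σ + tTheta τ = s + t → olt 𝒮 σ τ →
        olt 𝒮 (tTheta σ) (tTheta τ) ∨ olt 𝒮 (tTheta τ) (tTheta σ) := by
      intro σ τ hσ hτ e h
      by_cases h' : ∀ x, omemE 𝒮 x σ → olt 𝒮 x (tTheta τ)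
      · exact Or.inl (olt_tTheta_tTheta.2 (Or.inr ⟨h, h'⟩))
      -- If the side condition for ϑ(σ) < ϑ(τ) fails at x ∈ E(σ), then ϑ(τ) ≤ x by induction
      -- hypothesis, and the first clause yields ϑ(τ) < ϑ(σ).
      · push Not at h'
        obtain ⟨x, hx, hx'⟩ := h'
        have : x + tTheta τ < s + t := by
          rw [← e]; exact add_lt_add_left (omemE_lt_tTheta hx) _
        refine Or.inr (olt_tTheta_tTheta.2 (Or.inl ⟨x, hx, ?_⟩))
        rcases ih1 _ _ this (hσ.of_omemE hx) (isTerm_tTheta.2 hτ) with h1 | h1 | h1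
        · exact absurd h1 hx'
        · exact Or.inl h1.symm
        · exact Or.inr h1
    rcases isTerm_cases hs with rfl | ⟨σ, rfl, hσ⟩ | ⟨k, rfl, hk⟩ <;>
    rcases isTerm_cases ht with rfl | ⟨τ, rfl, hτ⟩ | ⟨l, rfl, hl⟩
    · exact Or.inr (Or.inl rfl)
    · simp
    · rcases key _ _ hs (Or.inl rfl) (Or.inr rfl) rfl hl with h | h
      · exact Or.inl (olt_tOmega_tSum.2 h)
      · exact Or.inr (Or.inr (olt_tSum_tOmega.2 h))
    · simp
    · rcases ih1 _ _ (add_lt_add (lt_tTheta σ) (lt_tTheta τ)) hσ hτ with h | h | h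
      · exact (key2 _ _ hσ hτ rfl h).imp_right Or.inr
      · exact Or.inr (Or.inl (by rw [h]))
      · exact (key2 _ _ hτ hσ (add_comm _ _) h).symm.imp_right Or.inr
    · rcases key _ _ hs (Or.inl rfl) (Or.inr rfl) rfl hl with h | h
      · exact Or.inl (olt_tTheta_tSum.2 h)
      · exact Or.inr (Or.inr (olt_tSum_tTheta.2 h))
    · rcases key _ _ ht (Or.inr rfl) (Or.inl rfl) (add_comm _ _) hk with h | h
      · exact Or.inr (Or.inr (olt_tOmega_tSum.2 h))
      · exact Or.inl (olt_tSum_tOmega.2 h)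
    · rcases key _ _ ht (Or.inr rfl) (Or.inl rfl) (add_comm _ _) hk with h | h
      · exact Or.inr (Or.inr (olt_tTheta_tSum.2 h))
      · exact Or.inl (olt_tSum_tTheta.2 h)
    · simpa using ih2 _ _ (add_lt_add (lt_tSum k) (lt_tSum l)) hk hl
  · dsimp only at hs ht ⊢
    rcases isSeq_cases hs with rfl | ⟨a, k, rfl, ha, hk⟩ <;>
    rcases isSeq_cases ht with rfl | ⟨b, l, rfl, hb, hl⟩
    · simp
    · simp
    · simp
    · rw [oseqLt_cons_cons, oseqLt_cons_cons, cons_inj]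
      rcases ih1 _ _ (add_lt_add (lt_cons_left a k) (lt_cons_left b l)) ha hb with h | rfl | h
      · exact Or.inl (Or.inl h)
      · rcases ih2 _ _ (add_lt_add (lt_cons_right a k) (lt_cons_right a l)) hk hl with h | rfl | h
        · exact Or.inl (Or.inr ⟨rfl, h⟩)
        · exact Or.inr (Or.inl ⟨rfl, rfl⟩)
        · exact Or.inr (Or.inr (Or.inr ⟨rfl, h⟩))
      · exact Or.inr (Or.inr (Or.inl h))

end NotationSystem

/-! ### The collapsing operation on T. -/

section Collapse

variable {M : Type*} [CommSemiring M] [LinearOrder M] [IsStrictOrderedRing M]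
    [CanonicallyOrderedAdd M] [DiscreteNumbers M] {𝒮 : Set (Set M)} [hS : Fact (ModelsRCA0 𝒮)]

@[simp] theorem tlt_nil_gcons {γ δ r : M} : tlt 𝒮 nil (gcons γ δ r) := isLex_tlt.nil_gcons _ _ _

@[simp] theorem not_tlt_nil {s : M} : ¬ tlt 𝒮 s nil := isLex_tlt.not_nil s

theorem tlt_gcons {γ δ r γ' δ' r' : M} : tlt 𝒮 (gcons γ δ r) (gcons γ' δ' r') ↔
    tlt 𝒮 γ γ' ∨ (γ = γ' ∧ (tlt 𝒮 δ δ' ∨ (δ = δ' ∧ tlt 𝒮 r r'))) := isLex_tlt.gcons_iff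

variable (𝒮) in
/-- The non-strict version of `tlt`. -/
def tle (s t : M) : Prop := s = t ∨ tlt 𝒮 s t

@[fun_prop]
theorem Rec.tle {α : Type*} [Enc M α] {f g : α → M} (hf : Rec 𝒮 f) (hg : Rec 𝒮 g) :
    Rec 𝒮 (fun a => tle 𝒮 (f a) (g a)) := by
  unfold InvGoodstein.tle; fun_prop

theorem tle_refl (s : M) : tle 𝒮 s s := Or.inl rfl

theorem tle_trans {s t u : M} (h : tle 𝒮 s t) (h' : tle 𝒮 t u) : tle 𝒮 s u := by
  rcases h with rfl | h
  · exact h'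
  · rcases h' with rfl | h'
    · exact Or.inr h
    · exact Or.inr (tlt_trans h h')

theorem tlt_of_tle_of_tlt {s t u : M} (h : tle 𝒮 s t) (h' : tlt 𝒮 t u) : tlt 𝒮 s u := by
  rcases h with rfl | h
  · exact h'
  · exact tlt_trans h h'

theorem tlt_of_tlt_of_tle {s t u : M} (h : tlt 𝒮 s t) (h' : tle 𝒮 t u) : tlt 𝒮 s u := by
  rcases h' with rfl | h'
  · exact h
  · exact tlt_trans h h'

theorem tle_or_tlt {s t : M} (hs : GT 𝒮 s) (ht : GT 𝒮 t) : tle 𝒮 s t ∨ tlt 𝒮 t s := by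
  rcases tlt_trichotomy hs ht with h | h | h
  · exact Or.inl (Or.inr h)
  · exact Or.inl (Or.inl h)
  · exact Or.inr h

theorem exists_graft : ∃ f : M → M → M, Rec 𝒮 (fun q : M × M => f q.1 q.2) ∧
    ∀ s c, f s c = Cond (IsG s ∧ tlt 𝒮 (unpairL c) (gexp s))
      (gcons (gexp s) (gcoef s) (f (cdr s) c)) (unpairR c) :=
  exists_recursion_two (𝒮 := 𝒮)
    (F := fun f s c => Cond (IsG s ∧ tlt 𝒮 (unpairL c) (gexp s))
      (gcons (gexp s) (gcoef s) (f (cdr s) c)) (unpairR c)) (by fun_prop)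
    (fun g g' s c h => by
      by_cases hs : IsG s
      · rw [h _ _ (add_lt_add_left hs.tail_lt c)]
      · rw [cond_neg (fun h => hs h.1), cond_neg (fun h => hs h.1)])

/-- The part of `m` with exponents above `b`, followed by `y`; here `c` is the pair of `b`
and `y`. -/
noncomputable def graftAux (𝒮 : Set (Set M)) : M → M → M :=
  Classical.epsilon fun f => Rec 𝒮 (fun q : M × M => f q.1 q.2) ∧
    ∀ s c, f s c = Cond (IsG s ∧ tlt 𝒮 (unpairL c) (gexp s))
      (gcons (gexp s) (gcoef s) (f (cdr s) c)) (unpairR c)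

/-- The part of `m` with exponents above `b`, followed by `y`. -/
noncomputable def graft (𝒮 : Set (Set M)) (m b y : M) : M := graftAux 𝒮 m (pair b y)

@[fun_prop]
theorem Rec.graft {α : Type*} [Enc M α] {f g h : α → M} (hf : Rec 𝒮 f) (hg : Rec 𝒮 g)
    (hh : Rec 𝒮 h) : Rec 𝒮 (fun a => graft 𝒮 (f a) (g a) (h a)) :=
  (Classical.epsilon_spec (exists_graft (𝒮 := 𝒮))).1.comp (hf.prodMk (hg.pair hh))

theorem graft_eq (m b y : M) : graft 𝒮 m b y =
    Cond (IsG m ∧ tlt 𝒮 b (gexp m)) (gcons (gexp m) (gcoef m) (graft 𝒮 (cdr m) b y)) y := by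
  have := (Classical.epsilon_spec (exists_graft (𝒮 := 𝒮))).2 m (pair b y)
  rw [unpairL_pair, unpairR_pair] at this
  exact this

theorem graft_of_tlt {g b : M} (h : tlt 𝒮 b g) (d r y : M) :
    graft 𝒮 (gcons g d r) b y = gcons g d (graft 𝒮 r b y) := by
  rw [graft_eq]; simp [h]

theorem graft_of_not_tlt {g b : M} (h : ¬ tlt 𝒮 b g) (d r y : M) :
    graft 𝒮 (gcons g d r) b y = y := by
  rw [graft_eq]; simp [h]

@[simp] theorem graft_nil (b y : M) : graft 𝒮 nil b y = y := by
  rw [graft_eq]; simp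

theorem graft_cases (m b y : M) : graft 𝒮 m b y = y ∨
    ∃ g d r, m = gcons g d r ∧ tlt 𝒮 b g ∧ graft 𝒮 m b y = gcons g d (graft 𝒮 r b y) := by
  by_cases h : IsG m ∧ tlt 𝒮 b (gexp m)
  · exact Or.inr ⟨_, _, _, h.1, h.2, by rw [graft_eq, cond_pos h]⟩
  · left; rw [graft_eq, cond_neg h]

variable (𝒮) in
/-- The collapse of `b` above `m`. -/
noncomputable def collapse (b m : M) : M := graft 𝒮 m b (gcons b m nil)

@[fun_prop]
theorem Rec.collapse {α : Type*} [Enc M α] {f g : α → M} (hf : Rec 𝒮 f) (hg : Rec 𝒮 g) :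
    Rec 𝒮 (fun a => collapse 𝒮 (f a) (g a)) := by
  unfold InvGoodstein.collapse; fun_prop

@[simp] theorem collapse_nil (b : M) : collapse 𝒮 b nil = gcons b nil nil := graft_nil _ _

theorem collapse_eq_gcons (b m : M) : ∃ g d r, collapse 𝒮 b m = gcons g d r ∧ tle 𝒮 b g := by
  rcases graft_cases (𝒮 := 𝒮) m b (gcons b m nil) with h | ⟨g, d, r, rfl, h1, h2⟩
  · exact ⟨_, _, _, h, tle_refl b⟩
  · exact ⟨_, _, _, h2, Or.inr h1⟩

@[simp] theorem nil_tlt_collapse (b m : M) : tlt 𝒮 nil (collapse 𝒮 b m) := by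
  obtain ⟨g, d, r, h, -⟩ := collapse_eq_gcons (𝒮 := 𝒮) b m
  rw [h]; exact tlt_nil_gcons

theorem tlt_collapse_of_exp_tlt {g b : M} (h : tlt 𝒮 g b) (d r m : M) :
    tlt 𝒮 (gcons g d r) (collapse 𝒮 b m) := by
  obtain ⟨g', d', r', h', hg⟩ := collapse_eq_gcons (𝒮 := 𝒮) b m
  rw [h']
  exact tlt_gcons.2 (Or.inl (tlt_of_tlt_of_tle h hg))

/-- The two terms agree up to the first exponent of r that is not above b. If that exponent equals
b, the coefficients decide: the one of r is a support element and hence below m. The term r varies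
while m stays fixed, so that the induction can pass to tails of m. -/
theorem tlt_graft {b m r : M} (hb : GT 𝒮 b) (hr : GT 𝒮 r) (h : ∀ z, InSupp 𝒮 z r → tlt 𝒮 z m) :
    tlt 𝒮 r (graft 𝒮 r b (gcons b m nil)) := by
  have hrec : Rec 𝒮 (fun r => Imp (GT 𝒮 r) (Imp (Ball r fun z => Imp (InSupp 𝒮 z r) (tlt 𝒮 z m))
    (tlt 𝒮 r (graft 𝒮 r b (gcons b m nil))))) := by fun_prop
  refine strong_induction hrec (fun r ih hr h => ?_) r hr (fun z _ => h z)
  rcases GT_cases hr with rfl | ⟨γ, δ, r, rfl, hγ, hr'⟩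
  · simp
  · by_cases hg : tlt 𝒮 b γ
    · rw [graft_of_tlt hg, tlt_gcons]
      refine Or.inr ⟨rfl, Or.inr ⟨rfl, ih r (tail_lt_gcons _ _ _) hr' fun z hz hz' => ?_⟩⟩
      exact h z (hz.trans (tail_lt_gcons _ _ _)) (by simp [hz'])
    · rw [graft_of_not_tlt hg, tlt_gcons]
      rcases tle_or_tlt hγ hb with (rfl | h1) | h1
      · exact Or.inr ⟨rfl, Or.inl (h δ (coef_lt_gcons _ _ _) (by simp))⟩
      · exact Or.inl h1
      · exact absurd h1 hg

theorem tlt_collapse {b m : M} (hb : GT 𝒮 b) (hm : TT 𝒮 m) : tlt 𝒮 m (collapse 𝒮 b m) :=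
  tlt_graft hb hm.1 hm.2

/-- The analogue of the second clause for ϑ. The appended summand has exponent b, which is below all
exponents that survive on the right. A term below the right hand side therefore stays below it when
its low part is replaced by this summand. -/
theorem graft_tlt_graft_of_exp_tlt {b b' m m' r r' : M} (hb : tlt 𝒮 b b')
    (h : tlt 𝒮 r (graft 𝒮 r' b' (gcons b' m' nil))) :
    tlt 𝒮 (graft 𝒮 r b (gcons b m nil)) (graft 𝒮 r' b' (gcons b' m' nil)) := by
  have hrec : Rec 𝒮 (fun q : M × M => Imp (tlt 𝒮 q.1 (graft 𝒮 q.2 b' (gcons b' m' nil)))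
    (tlt 𝒮 (graft 𝒮 q.1 b (gcons b m nil)) (graft 𝒮 q.2 b' (gcons b' m' nil)))) := by fun_prop
  refine strong_induction_two hrec (fun r r' ih h => ?_) r r' h
  dsimp only at h ⊢
  have hy : tlt 𝒮 (gcons b m nil) (graft 𝒮 r' b' (gcons b' m' nil)) := by
    rcases graft_cases (𝒮 := 𝒮) r' b' (gcons b' m' nil) with h | ⟨g, d, r, rfl, h1, h2⟩
    · rw [h]; exact tlt_gcons.2 (Or.inl hb)
    · rw [h2]; exact tlt_gcons.2 (Or.inl (tlt_trans hb h1))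
  rcases graft_cases (𝒮 := 𝒮) r b (gcons b m nil) with h1 | ⟨g, d, r, rfl, h1, h2⟩
  · rwa [h1]
  · rw [h2]
    rcases graft_cases (𝒮 := 𝒮) r' b' (gcons b' m' nil) with h3 | ⟨g', d', r', rfl, h3, h4⟩
    · rw [h3, tlt_gcons] at h ⊢
      simpa using h
    · rw [h4, tlt_gcons] at h ⊢
      refine h.imp_right (And.imp_right (Or.imp_right (And.imp_right fun h => ?_)))
      exact ih _ _ (add_lt_add (tail_lt_gcons _ _ _) (tail_lt_gcons _ _ _)) h

theorem collapse_tlt_collapse_of_tlt {b b' m m' : M} (hb : tlt 𝒮 b b')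
    (h : tlt 𝒮 m (collapse 𝒮 b' m')) : tlt 𝒮 (collapse 𝒮 b m) (collapse 𝒮 b' m') :=
  graft_tlt_graft_of_exp_tlt hb h

theorem graft_tlt_graft {b m m' r r' : M} (hm : tlt 𝒮 m m') (h : tlt 𝒮 r r') :
    tlt 𝒮 (graft 𝒮 r b (gcons b m nil)) (graft 𝒮 r' b (gcons b m' nil)) := by
  have hrec : Rec 𝒮 (fun q : M × M => Imp (tlt 𝒮 q.1 q.2)
    (tlt 𝒮 (graft 𝒮 q.1 b (gcons b m nil)) (graft 𝒮 q.2 b (gcons b m' nil)))) := by fun_prop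
  refine strong_induction_two hrec (fun r r' ih h => ?_) r r' h
  dsimp only at h ⊢
  rcases graft_cases (𝒮 := 𝒮) r b (gcons b m nil) with h1 | ⟨g, d, r, rfl, h1, h2⟩
  · rw [h1]
    rcases graft_cases (𝒮 := 𝒮) r' b (gcons b m' nil) with h | ⟨g, d, r, rfl, h1, h2⟩
    · rw [h]; exact tlt_gcons.2 (Or.inr ⟨rfl, Or.inl hm⟩)
    · rw [h2]; exact tlt_gcons.2 (Or.inl h1)
  · rw [h2]
    obtain ⟨g', d', r', rfl⟩ := isLex_tlt.exists_right h
    rw [tlt_gcons] at h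
    have hg : tlt 𝒮 b g' := by
      rcases h with h | ⟨rfl, -⟩
      · exact tlt_trans h1 h
      · exact h1
    rw [graft_of_tlt hg, tlt_gcons]
    refine h.imp_right (And.imp_right (Or.imp_right (And.imp_right fun h => ?_)))
    exact ih _ _ (add_lt_add (tail_lt_gcons _ _ _) (tail_lt_gcons _ _ _)) h

theorem collapse_tlt_collapse {b m m' : M} (h : tlt 𝒮 m m') :
    tlt 𝒮 (collapse 𝒮 b m) (collapse 𝒮 b m') := graft_tlt_graft h h

/-- For b < b' the required bound m < `collapse 𝒮 b' m'` comes from m ≤ m', since a collapse exceeds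
its second argument. -/
theorem collapse_tle_collapse {b b' m m' : M} (hb : tle 𝒮 b b') (h : tle 𝒮 m m')
    (hb' : GT 𝒮 b') (hm : TT 𝒮 m') : tle 𝒮 (collapse 𝒮 b m) (collapse 𝒮 b' m') := by
  rcases hb with rfl | hb
  · rcases h with rfl | h
    · exact tle_refl _
    · exact Or.inr (collapse_tlt_collapse h)
  · exact Or.inr (collapse_tlt_collapse_of_tlt hb (tlt_of_tle_of_tlt h (tlt_collapse hb' hm)))

theorem inSupp_graft {z r b y : M} (h : InSupp 𝒮 z (graft 𝒮 r b y)) :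
    InSupp 𝒮 z r ∨ InSupp 𝒮 z y := by
  have hrec : Rec 𝒮 (fun r => Imp (InSupp 𝒮 z (graft 𝒮 r b y)) (InSupp 𝒮 z r ∨ InSupp 𝒮 z y)) := by
    fun_prop
  refine strong_induction hrec (fun r ih h => ?_) r h
  rcases graft_cases (𝒮 := 𝒮) r b y with h1 | ⟨g, d, r, rfl, h1, h2⟩
  · rw [h1] at h; exact Or.inr h
  · rw [h2, inSupp_gcons] at h
    rw [inSupp_gcons]
    rcases h with h | h | h
    · exact Or.inl (Or.inl h)
    · exact Or.inl (Or.inr (Or.inl h))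
    · exact (ih _ (tail_lt_gcons _ _ _) h).imp_left fun h => Or.inr (Or.inr h)

theorem GT_graft {r b m : M} (hb : GT 𝒮 b) (hr : GT 𝒮 r) (hm : TT 𝒮 m) :
    GT 𝒮 (graft 𝒮 r b (gcons b m nil)) := by
  have hrec : Rec 𝒮 (fun r => Imp (GT 𝒮 r) (GT 𝒮 (graft 𝒮 r b (gcons b m nil)))) := by fun_prop
  have hy : GT 𝒮 (gcons b m nil) := GT_gcons.2 ⟨hb, hm, GT_nil, by simp⟩
  refine strong_induction hrec (fun r ih hr => ?_) r hr
  rcases graft_cases (𝒮 := 𝒮) r b (gcons b m nil) with h1 | ⟨g, d, r, rfl, h1, h2⟩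
  · rwa [h1]
  · rw [h2]
    obtain ⟨h3, h4, h5, h6⟩ := GT_gcons.1 hr
    refine GT_gcons.2 ⟨h3, h4, ih _ (tail_lt_gcons _ _ _) h5, fun γ' δ' r' h => ?_⟩
    rcases graft_cases (𝒮 := 𝒮) r b (gcons b m nil) with h7 | ⟨g', d', r', rfl, h7, h8⟩
    · rw [h7, gcons_inj] at h
      rwa [← h.1]
    · rw [h8, gcons_inj] at h
      rw [← h.1]
      exact h6 _ _ _ rfl

/-- The support of the collapse consists of elements of supp(m), of supp(b), and m itself. Only
those from b need the hypothesis, since m and its support are below the collapse anyway. -/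
theorem TT_collapse {b m : M} (hb : GT 𝒮 b) (hm : TT 𝒮 m)
    (h : ∀ z, InSupp 𝒮 z b → tlt 𝒮 z (collapse 𝒮 b m)) : TT 𝒮 (collapse 𝒮 b m) := by
  refine ⟨GT_graft hb hm.1 hm, fun z hz => ?_⟩
  have h1 := tlt_collapse hb hm
  rcases inSupp_graft hz with h2 | h2
  · exact tlt_trans (hm.2 z h2) h1
  · simp only [inSupp_gcons, not_inSupp_nil, or_false] at h2
    rcases h2 with h2 | rfl
    · exact h z h2
    · exact h1

end Collapse

/-! ### Interpretation of the notation system in Goodstein terms over T. -/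

section Star

variable {M : Type*} [CommSemiring M] [LinearOrder M] [IsStrictOrderedRing M]
    [CanonicallyOrderedAdd M] [DiscreteNumbers M] {𝒮 : Set (Set M)} [hS : Fact (ModelsRCA0 𝒮)]

/-- The least nonzero Goodstein term. -/
def gone : M := gcons nil nil nil

/-- The Goodstein term that interprets `Ω`. -/
def gOmega : M := gcons gone nil nil

/-- A double power with exponent `s`. -/
def tower (s : M) : M := gcons (gcons s nil nil) nil nil

/-- Add a summand with exponent `g` in front. -/
noncomputable def prepend (g s : M) : M :=
  Cond (IsG s ∧ gexp s = g) (gcons g (gcons nil (gcoef s) nil) (cdr s)) (gcons g nil s)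

variable (𝒮) in
/-- The maximum of two terms. -/
noncomputable def tmax (a b : M) : M := Cond (tlt 𝒮 a b) b a

variable (𝒮) in
/-- Collapse `s` if all its exponents are countable. -/
noncomputable def settle (s : M) : M :=
  Cond (s = nil) (gcons nil gone nil)
    (Cond (gexp (gexp s) = nil) (gcons nil (collapse 𝒮 s (gcoef (gexp s))) nil) s)

variable {α : Type*} [Enc M α] {f g : α → M}

@[fun_prop]
theorem Rec.tower (hf : Rec 𝒮 f) : Rec 𝒮 (fun a => tower (f a)) := by
  unfold InvGoodstein.tower; fun_prop

@[fun_prop]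
theorem Rec.prepend (hf : Rec 𝒮 f) (hg : Rec 𝒮 g) : Rec 𝒮 (fun a => prepend (f a) (g a)) := by
  unfold InvGoodstein.prepend; fun_prop

@[fun_prop]
theorem Rec.tmax (hf : Rec 𝒮 f) (hg : Rec 𝒮 g) : Rec 𝒮 (fun a => tmax 𝒮 (f a) (g a)) := by
  unfold InvGoodstein.tmax; fun_prop

@[fun_prop]
theorem Rec.settle (hf : Rec 𝒮 f) : Rec 𝒮 (fun a => settle 𝒮 (f a)) := by
  unfold InvGoodstein.settle; fun_prop

theorem TT_tmax {a b : M} (ha : TT 𝒮 a) (hb : TT 𝒮 b) : TT 𝒮 (tmax 𝒮 a b) := by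
  unfold tmax
  by_cases h : tlt 𝒮 a b
  · rwa [cond_pos h]
  · rwa [cond_neg h]

theorem tle_tmax_left (a b : M) : tle 𝒮 a (tmax 𝒮 a b) := by
  unfold tmax
  by_cases h : tlt 𝒮 a b
  · rw [cond_pos h]; exact Or.inr h
  · rw [cond_neg h]; exact tle_refl a

theorem tle_tmax_right {a b : M} (ha : GT 𝒮 a) (hb : GT 𝒮 b) : tle 𝒮 b (tmax 𝒮 a b) := by
  unfold tmax
  by_cases h : tlt 𝒮 a b
  · rw [cond_pos h]; exact tle_refl b
  · rw [cond_neg h]; exact (tle_or_tlt hb ha).resolve_right h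

theorem prepend_cases (g s : M) : (∃ d r, s = gcons g d r ∧ prepend g s = gcons g (gcons nil d nil) r) ∨
    ((∀ d r, s ≠ gcons g d r) ∧ prepend g s = gcons g nil s) := by
  unfold prepend
  by_cases h : IsG s ∧ gexp s = g
  · obtain ⟨h, rfl⟩ := h
    exact Or.inl ⟨_, _, h, cond_pos ⟨h, rfl⟩ _ _⟩
  · refine Or.inr ⟨?_, cond_neg h _ _⟩
    rintro d r rfl
    simp at h

theorem prepend_eq_gcons (g s : M) : ∃ d r, prepend g s = gcons g d r := by
  rcases prepend_cases g s with ⟨d, r, -, h⟩ | ⟨-, h⟩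
  · exact ⟨_, _, h⟩
  · exact ⟨_, _, h⟩

theorem inSupp_prepend {z g s : M} (h : InSupp 𝒮 z (prepend g s)) : InSupp 𝒮 z g ∨ InSupp 𝒮 z s ∨
    z = nil ∨ ∃ d r, s = gcons g d r ∧ z = gcons nil d nil := by
  rcases prepend_cases g s with ⟨d, r, rfl, h'⟩ | ⟨-, h'⟩
  · rw [h', inSupp_gcons] at h
    rcases h with h | h | h
    · exact Or.inl h
    · exact Or.inr (Or.inr (Or.inr ⟨_, _, rfl, h⟩))
    · exact Or.inr (Or.inl (by simp [h]))
  · rw [h', inSupp_gcons] at h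
    rcases h with h | h | h
    · exact Or.inl h
    · exact Or.inr (Or.inr (Or.inl h))
    · exact Or.inr (Or.inl h)

/-- Goodstein terms have strictly descending exponents, while sums in the notation system may repeat
them. Repetitions are counted by the coefficient, with successor d ↦ (1+X)^0·(1+d). If s already
begins with g, then so does t, and both coefficients are raised. -/
theorem prepend_tlt_prepend {g s t : M} (h : tlt 𝒮 s t)
    (ht : ∀ g' d r, t = gcons g' d r → tle 𝒮 g' g) : tlt 𝒮 (prepend g s) (prepend g t) := by
  rcases prepend_cases g s with ⟨d, r, rfl, h'⟩ | ⟨-, h'⟩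
  · obtain ⟨g', d', r', rfl⟩ := isLex_tlt.exists_right h
    have hg := ht _ _ _ rfl
    rw [tlt_gcons] at h
    rcases h with h | ⟨rfl, h⟩
    · exact absurd (tlt_of_tle_of_tlt hg h) (tlt_irrefl _)
    · rcases prepend_cases g (gcons g d' r') with ⟨d2, r2, h2, h3⟩ | ⟨h2, -⟩
      · rw [gcons_inj] at h2
        obtain ⟨-, rfl, rfl⟩ := h2
        rw [h', h3]
        simpa [tlt_gcons, tlt_irrefl] using h
      · exact absurd rfl (h2 d' r')
  · rw [h']
    rcases prepend_cases g t with ⟨d2, r2, h2, h3⟩ | ⟨-, h3⟩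
    · rw [h3, tlt_gcons]; simp
    · rw [h3, tlt_gcons]; simp [h]

variable (𝒮) in
/-- Coefficients that count repetitions. -/
def IsNumeral (d : M) : Prop := TT 𝒮 d ∧ tlt 𝒮 d (gcons nil d nil) ∧ tlt 𝒮 d gOmega

theorem isNumeral_nil : IsNumeral 𝒮 nil := ⟨TT_nil, by simp, by simp [gOmega]⟩

theorem IsNumeral.succ {d : M} (h : IsNumeral 𝒮 d) : IsNumeral 𝒮 (gcons nil d nil) := by
  refine ⟨⟨GT_gcons.2 ⟨GT_nil, h.1, GT_nil, by simp⟩, ?_⟩, ?_, ?_⟩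
  · intro z hz
    simp only [inSupp_gcons, not_inSupp_nil, false_or, or_false] at hz
    rw [hz]; exact h.2.1
  · exact tlt_gcons.2 (Or.inr ⟨rfl, Or.inl h.2.1⟩)
  · exact tlt_gcons.2 (Or.inl tlt_nil_gcons)

@[fun_prop]
theorem Rec.isNumeral (hf : Rec 𝒮 f) : Rec 𝒮 (fun a => IsNumeral 𝒮 (f a)) := by
  unfold IsNumeral; fun_prop

theorem GT_prepend {g s : M} (hg : GT 𝒮 g) (hs : GT 𝒮 s)
    (h : ∀ g' d r, s = gcons g' d r → tle 𝒮 g' g ∧ IsNumeral 𝒮 d) : GT 𝒮 (prepend g s) := by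
  rcases prepend_cases g s with ⟨d, r, rfl, h'⟩ | ⟨h1, h'⟩
  · rw [h']
    have := GT_gcons.1 hs
    exact GT_gcons.2 ⟨hg, (h _ _ _ rfl).2.succ.1, this.2.2.1, this.2.2.2⟩
  · rw [h']
    refine GT_gcons.2 ⟨hg, TT_nil, hs, ?_⟩
    rintro g' d' r' rfl
    rcases (h _ _ _ rfl).1 with rfl | h2
    · exact absurd rfl (h1 d' r')
    · exact h2

theorem GT_gone : GT 𝒮 (gone : M) := GT_gcons.2 ⟨GT_nil, TT_nil, GT_nil, by simp⟩

theorem TT_gone : TT 𝒮 (gone : M) := (isNumeral_nil (𝒮 := 𝒮)).succ.1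

theorem GT_gOmega : GT 𝒮 (gOmega : M) := GT_gcons.2 ⟨GT_gone, TT_nil, GT_nil, by simp⟩

theorem GT_tower {s : M} (h : GT 𝒮 s) : GT 𝒮 (tower s) :=
  GT_gcons.2 ⟨GT_gcons.2 ⟨h, TT_nil, GT_nil, by simp⟩, TT_nil, GT_nil, by simp⟩

theorem tower_tlt_tower {s t : M} (h : tlt 𝒮 s t) : tlt 𝒮 (tower s) (tower t) :=
  tlt_gcons.2 (Or.inl (tlt_gcons.2 (Or.inl h)))

theorem tower_tle_tower {s t : M} (h : tle 𝒮 s t) : tle 𝒮 (tower s) (tower t) := by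
  rcases h with rfl | h
  · exact tle_refl _
  · exact Or.inr (tower_tlt_tower h)

theorem eq_nil_of_tlt_gone {s : M} (h : tlt 𝒮 s gone) : s = nil := by
  rcases isLex_tlt.left_cases h with h1 | ⟨γ, δ, r, rfl⟩
  · exact h1
  · simp [gone, tlt_gcons] at h

variable (𝒮) in
/-- The recursion equations for the interpretation `st` of terms and `sq` of sequences by Goodstein
terms, and for the bounds `mt` and `mq` on the interpretations of subterms in `E`. -/
structure IsStar (st mt sq mq : M → M) : Prop where
  rec_st : Rec 𝒮 st
  rec_mt : Rec 𝒮 mt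
  rec_sq : Rec 𝒮 sq
  rec_mq : Rec 𝒮 mq
  st_omega : st tOmega = gOmega
  st_theta : ∀ σ, st (tTheta σ) = gcons nil (mt (tTheta σ)) nil
  st_sum : ∀ l, st (tSum l) = settle 𝒮 (sq l)
  mt_omega : mt tOmega = nil
  mt_theta : ∀ σ, mt (tTheta σ) = collapse 𝒮 (tower (st σ)) (mt σ)
  mt_sum : ∀ l, mt (tSum l) = mq l
  sq_nil : sq nil = nil
  sq_cons : ∀ γ l, sq (cons γ l) = prepend (st γ) (sq l)
  mq_nil : mq nil = nil
  mq_cons : ∀ γ l, mq (cons γ l) = tmax 𝒮 (mt γ) (mq l)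

/-- The four functions are packed into one recursion on codes. The conditions i < n with default
value 0 make locality evident even on numbers that code no term. -/
theorem exists_star : ∃ st mt sq mq : M → M, IsStar 𝒮 st mt sq mq := by
  obtain ⟨f, hf, h⟩ := exists_recursion (𝒮 := 𝒮)
    (F := fun f n => pair
      (pair
        (Cond (n = tOmega) gOmega
          (Cond (IsTheta n) (gcons nil (collapse 𝒮
            (tower (unpairL (unpairL (Cond (unpairR n < n) (f (unpairR n)) 0))))
            (unpairR (unpairL (Cond (unpairR n < n) (f (unpairR n)) 0)))) nil)
          (settle 𝒮 (unpairL (unpairR (Cond (unpairR n < n) (f (unpairR n)) 0))))))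
        (Cond (n = tOmega) nil
          (Cond (IsTheta n) (collapse 𝒮
            (tower (unpairL (unpairL (Cond (unpairR n < n) (f (unpairR n)) 0))))
            (unpairR (unpairL (Cond (unpairR n < n) (f (unpairR n)) 0))))
          (unpairR (unpairR (Cond (unpairR n < n) (f (unpairR n)) 0))))))
      (pair
        (Cond (n = nil) nil (prepend (unpairL (unpairL (Cond (car n < n) (f (car n)) 0)))
          (unpairL (unpairR (Cond (cdr n < n) (f (cdr n)) 0)))))
        (Cond (n = nil) nil (tmax 𝒮 (unpairR (unpairL (Cond (car n < n) (f (car n)) 0)))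
          (unpairR (unpairR (Cond (cdr n < n) (f (cdr n)) 0)))))))
    (by fun_prop)
    (fun g g' n h => by
      have e : ∀ i, Cond (i < n) (g i) 0 = Cond (i < n) (g' i) 0 := fun i => by
        by_cases hi : i < n
        · rw [h i hi]
        · rw [cond_neg hi, cond_neg hi]
      simp only [e])
  refine ⟨fun n => unpairL (unpairL (f n)), fun n => unpairR (unpairL (f n)),
    fun n => unpairL (unpairR (f n)), fun n => unpairR (unpairR (f n)),
    by fun_prop, by fun_prop, by fun_prop, by fun_prop, ?_, fun σ => ?_, fun l => ?_, ?_, fun σ => ?_,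
    fun l => ?_, ?_, fun γ l => ?_, ?_, fun γ l => ?_⟩ <;> rw [h]
  · simp
  · simp [lt_tTheta]
  · simp [lt_tSum]
  · simp
  · simp [lt_tTheta]
  · simp [lt_tSum]
  · simp
  · simp [lt_cons_left, lt_cons_right]
  · simp
  · simp [lt_cons_left, lt_cons_right]

namespace IsStar

variable {st mt sq mq : M → M} (h : IsStar 𝒮 st mt sq mq)
include h

theorem sq_cons_eq (γ k : M) : ∃ d r, sq (cons γ k) = gcons (st γ) d r := by
  rw [h.sq_cons]; exact prepend_eq_gcons _ _

theorem st_eq_gcons {s : M} (hs : IsTerm 𝒮 s) : ∃ g d r, st s = gcons g d r := by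
  rcases isTerm_cases hs with rfl | ⟨σ, rfl, -⟩ | ⟨l, rfl, hl⟩
  · exact ⟨_, _, _, h.st_omega⟩
  · exact ⟨_, _, _, h.st_theta σ⟩
  · rw [h.st_sum]
    unfold settle
    rcases isSeq_cases hl with rfl | ⟨γ, k, rfl, -⟩
    · rw [h.sq_nil, cond_pos rfl]; exact ⟨_, _, _, rfl⟩
    · obtain ⟨d, r, e⟩ := h.sq_cons_eq γ k
      rw [e, cond_neg gcons_ne_nil]
      by_cases h' : gexp (gexp (gcons (st γ) d r)) = nil
      · rw [cond_pos h']; exact ⟨_, _, _, rfl⟩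
      · rw [cond_neg h']; exact ⟨_, _, _, rfl⟩

theorem st_sum_nil : st (tSum nil) = gcons nil gone nil := by
  rw [h.st_sum, h.sq_nil]; exact cond_pos rfl _ _

/-- A value (1+X)^0·(1+x) is to be read as the element x of T, i.e. as an ordinal below Ω; all other
values have nonzero leading exponent. -/
theorem st_shape {s : M} (hs : IsTerm 𝒮 s) :
    (∃ x, st s = gcons nil x nil) ∨ ∃ g d r, st s = gcons g d r ∧ g ≠ nil := by
  rcases isTerm_cases hs with rfl | ⟨σ, rfl, -⟩ | ⟨l, rfl, hl⟩
  · exact Or.inr ⟨_, _, _, h.st_omega, by simp [gone]⟩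
  · exact Or.inl ⟨_, h.st_theta σ⟩
  · rcases isSeq_cases hl with rfl | ⟨γ, k, rfl, hγ, -⟩
    · exact Or.inl ⟨_, h.st_sum_nil⟩
    · rw [h.st_sum]
      unfold settle
      obtain ⟨d, r, e⟩ := h.sq_cons_eq γ k
      rw [e, cond_neg gcons_ne_nil]
      by_cases h' : gexp (gexp (gcons (st γ) d r)) = nil
      · rw [cond_pos h']; exact Or.inl ⟨_, rfl⟩
      · rw [cond_neg h']
        obtain ⟨_, _, _, e⟩ := h.st_eq_gcons hγ
        exact Or.inr ⟨_, _, _, rfl, by simp [e]⟩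

/-- A sum whose leading exponent is countable must receive a countable value again. This is achieved
by collapsing the formal sum above the element x for the leading exponent; other sums keep their
formal value. -/
theorem st_sum_cons {γ k : M} (hγ : IsTerm 𝒮 γ) :
    (∃ x, st γ = gcons nil x nil ∧
      st (tSum (cons γ k)) = gcons nil (collapse 𝒮 (sq (cons γ k)) x) nil) ∨
    ((∃ g d r, st γ = gcons g d r ∧ g ≠ nil) ∧ st (tSum (cons γ k)) = sq (cons γ k)) := by
  obtain ⟨d, r, e⟩ := h.sq_cons_eq γ k
  rcases h.st_shape hγ with ⟨x, hx⟩ | ⟨g, d', r', hg, hg'⟩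
  · refine Or.inl ⟨x, hx, ?_⟩
    rw [h.st_sum, e, hx]
    simp [settle]
  · refine Or.inr ⟨⟨_, _, _, hg, hg'⟩, ?_⟩
    rw [h.st_sum, e, hg]
    simp [settle, hg']

theorem exists_of_st_tle {s x : M} (hs : IsTerm 𝒮 s) (hx : tle 𝒮 (st s) (gcons nil x nil)) :
    ∃ y, st s = gcons nil y nil ∧ tle 𝒮 y x := by
  rcases h.st_shape hs with ⟨y, hy⟩ | ⟨g, d, r, hg, hg'⟩
  · refine ⟨y, hy, ?_⟩
    rw [hy] at hx
    rcases hx with hx | hx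
    · rw [gcons_inj] at hx; exact Or.inl hx.2.1
    · simp [tlt_gcons] at hx
      exact Or.inr hx
  · rw [hg] at hx
    rcases hx with hx | hx
    · rw [gcons_inj] at hx; exact absurd hx.1 hg'
    · simp [tlt_gcons, hg'] at hx

theorem exists_of_st_tlt_gOmega {s : M} (hs : IsTerm 𝒮 s) (hx : tlt 𝒮 (st s) gOmega) :
    ∃ y, st s = gcons nil y nil := by
  rcases h.st_shape hs with hy | ⟨g, d, r, hg, hg'⟩
  · exact hy
  · rw [hg, gOmega, tlt_gcons] at hx
    rcases hx with hx | ⟨-, hx | ⟨-, hx⟩⟩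
    · exact absurd (eq_nil_of_tlt_gone hx) hg'
    · simp at hx
    · simp at hx

theorem nil_tlt_st {s : M} (hs : IsTerm 𝒮 s) : tlt 𝒮 nil (st s) := by
  obtain ⟨g, d, r, e⟩ := h.st_eq_gcons hs
  rw [e]; exact tlt_nil_gcons

theorem gone_tle_st {s : M} (hs : IsTerm 𝒮 s) (hs' : GT 𝒮 (st s)) : tle 𝒮 gone (st s) := by
  rcases tle_or_tlt GT_gone hs' with h1 | h1
  · exact h1
  · obtain ⟨g, d, r, e⟩ := h.st_eq_gcons hs
    rw [eq_nil_of_tlt_gone h1] at e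
    simp at e

end IsStar

variable (𝒮) in
/-- Invariants of the interpretation of the term `s`. -/
def StarTerm (st mt : M → M) (s : M) : Prop :=
  GT 𝒮 (st s) ∧ TT 𝒮 (mt s) ∧ (∀ z, InSupp 𝒮 z (st s) → tlt 𝒮 z (collapse 𝒮 (tower gone) (mt s))) ∧
    ∀ x, omemE 𝒮 x s → tle 𝒮 (mt x) (mt s)

variable (𝒮) in
/-- Invariants of the interpretation of the sequence `l`. -/
def StarSeq (st mt sq mq : M → M) (l : M) : Prop :=
  GT 𝒮 (sq l) ∧ TT 𝒮 (mq l) ∧ (∀ z, InSupp 𝒮 z (sq l) → tlt 𝒮 z (collapse 𝒮 (tower gone) (mq l))) ∧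
    (∀ x, oseqMemE 𝒮 x l → tle 𝒮 (mt x) (mq l)) ∧ (∀ g d r, sq l = gcons g d r → IsNumeral 𝒮 d) ∧
    ∀ γ k x, l = cons γ k → st γ = gcons nil x nil →
      ∀ z, InSupp 𝒮 z (sq l) → tlt 𝒮 z gOmega ∨ tle 𝒮 z x

section Invariants

variable {st mt sq mq : M → M} (h : IsStar 𝒮 st mt sq mq)
include h

theorem IsStar.rec_starTerm : Rec 𝒮 (StarTerm 𝒮 st mt) := by
  have h1 := h.rec_st
  have h2 := h.rec_mt
  have : Rec 𝒮 (fun s => GT 𝒮 (st s) ∧ TT 𝒮 (mt s) ∧ (Ball (st s) fun z => Imp (InSupp 𝒮 z (st s))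
      (tlt 𝒮 z (collapse 𝒮 (tower gone) (mt s)))) ∧
      Ball (s + 1) fun x => Imp (omemE 𝒮 x s) (tle 𝒮 (mt x) (mt s))) := by fun_prop
  refine this.of_iff fun s => and_congr_right fun _ => and_congr_right fun _ => and_congr ?_ ?_
  · exact ⟨fun h z _ hz => h z hz, fun h z hz => h z (lt_of_inSupp hz) hz⟩
  · exact ⟨fun h x _ hx => h x hx, fun h x hx => h x (lt_add_one_iff'.2 (omemE_le hx)) hx⟩

theorem IsStar.rec_starSeq : Rec 𝒮 (StarSeq 𝒮 st mt sq mq) := by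
  have h1 := h.rec_st
  have h2 := h.rec_mt
  have h3 := h.rec_sq
  have h4 := h.rec_mq
  have : Rec 𝒮 (fun s => GT 𝒮 (sq s) ∧ TT 𝒮 (mq s) ∧ (Ball (sq s) fun z => Imp (InSupp 𝒮 z (sq s))
      (tlt 𝒮 z (collapse 𝒮 (tower gone) (mq s)))) ∧
      (Ball (tSum s + 1) fun x => Imp (oseqMemE 𝒮 x s) (tle 𝒮 (mt x) (mq s))) ∧
      Imp (IsG (sq s)) (IsNumeral 𝒮 (gcoef (sq s))) ∧
      Imp (IsCons s ∧ st (car s) = gcons nil (gcoef (st (car s))) nil)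
        (Ball (sq s) fun z => Imp (InSupp 𝒮 z (sq s))
          (tlt 𝒮 z gOmega ∨ tle 𝒮 z (gcoef (st (car s)))))) := by
    fun_prop
  refine this.of_iff fun s => and_congr_right fun _ => and_congr_right fun _ => and_congr ?_
    (and_congr ?_ (and_congr ?_ ?_))
  · exact ⟨fun h z _ hz => h z hz, fun h z hz => h z (lt_of_inSupp hz) hz⟩
  · exact ⟨fun h x _ hx => h x hx,
      fun h x hx => h x (lt_add_one_iff'.2 (omemE_le (omemE_tSum.2 hx))) hx⟩
  · exact ⟨fun h hs => h _ _ _ hs, fun h g d r e => by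
      have := h (isG_iff.2 ⟨_, _, _, e⟩)
      rwa [e, gcoef_gcons] at this⟩
  · constructor
    · rintro h ⟨h1, h2⟩ z _ hz
      exact h _ _ _ h1 h2 z hz
    · rintro h γ k x rfl hx z hz
      have := h ⟨by simp, by simp [hx]⟩ z (lt_of_inSupp hz) hz
      simpa [hx] using this

/-- The induction step for the invariants of terms. -/
theorem IsStar.starTerm_step {s : M} (hs : IsTerm 𝒮 s)
    (ih : ∀ a < s, IsTerm 𝒮 a → StarTerm 𝒮 st mt a)
    (ih' : ∀ a < s, IsSeq 𝒮 a → StarSeq 𝒮 st mt sq mq a) : StarTerm 𝒮 st mt s := by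
  have hb : GT 𝒮 (tower gone : M) := GT_tower GT_gone
  rcases isTerm_cases hs with rfl | ⟨σ, rfl, hσ⟩ | ⟨l, rfl, hl⟩
  · refine ⟨?_, ?_, ?_, fun x hx => absurd hx not_omemE_tOmega⟩
    · rw [h.st_omega]; exact GT_gOmega
    · rw [h.mt_omega]; exact TT_nil
    · rw [h.st_omega]
      intro z hz
      simp [gOmega, gone] at hz
      rw [hz]; exact nil_tlt_collapse _ _
  · obtain ⟨h1, h2, h3, -⟩ := ih σ (lt_tTheta σ) hσ
    have hT : TT 𝒮 (mt (tTheta σ)) := by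
      rw [h.mt_theta]
      refine TT_collapse (GT_tower h1) h2 fun z hz => ?_
      simp only [tower, inSupp_gcons, not_inSupp_nil, or_false, or_self] at hz
      rcases hz with (hz | rfl) | rfl
      -- The invariant bounds the support by a collapse at the fixed exponent `tower gone`. Every
      -- value is at least `gone`, so this exponent is at most the one used for ϑ(σ).
      · exact tlt_of_tlt_of_tle (h3 z hz) (collapse_tle_collapse
          (tower_tle_tower (h.gone_tle_st hσ h1)) (tle_refl _) (GT_tower h1) h2)
      · exact nil_tlt_collapse _ _
      · exact nil_tlt_collapse _ _
    refine ⟨?_, hT, ?_, ?_⟩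
    · rw [h.st_theta]
      exact GT_gcons.2 ⟨GT_nil, hT, GT_nil, by simp⟩
    · intro z hz
      rw [h.st_theta] at hz
      simp only [inSupp_gcons, not_inSupp_nil, or_false, false_or] at hz
      rw [hz]
      exact tlt_collapse hb hT
    · intro x hx
      rw [omemE_tTheta] at hx
      rw [hx]; exact tle_refl _
  · obtain ⟨h1, h2, h3, h4, -, h6⟩ := ih' l (lt_tSum l) hl
    rw [StarTerm, h.mt_sum]
    have h4' : ∀ x, omemE 𝒮 x (tSum l) → tle 𝒮 (mt x) (mq l) := fun x hx => h4 x (omemE_tSum.1 hx)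
    rcases isSeq_cases hl with rfl | ⟨γ, k, rfl, hγ, -⟩
    · refine ⟨?_, h2, ?_, h4'⟩
      · rw [h.st_sum_nil]; exact GT_gcons.2 ⟨GT_nil, TT_gone, GT_nil, by simp⟩
      · rw [h.st_sum_nil]
        intro z hz
        simp only [inSupp_gcons, not_inSupp_nil, or_false, false_or] at hz
        rw [hz]
        exact tlt_collapse_of_exp_tlt tlt_nil_gcons _ _ _
    · rcases h.st_sum_cons (k := k) hγ with ⟨x, hx, e⟩ | ⟨-, e⟩
      · obtain ⟨d, r, e'⟩ := h.sq_cons_eq γ k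
        have hTx : TT 𝒮 x := by
          have := (ih γ ((lt_cons_left _ _).trans (lt_tSum _)) hγ).1
          rw [hx] at this
          exact (GT_gcons.1 this).2.1
        have hxs : InSupp 𝒮 x (sq (cons γ k)) := by rw [e', hx]; simp
        refine ⟨?_, h2, ?_, h4'⟩
        · rw [e]
          refine GT_gcons.2 ⟨GT_nil, TT_collapse h1 hTx fun z hz => ?_, GT_nil, by simp⟩
          -- The support of a formal sum with countable exponents consists of repetition counters,
          -- which are below the value of Ω, and of elements for the exponents, which are at most x.
          rcases h6 γ k x rfl hx z hz with hz | hz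
          · refine tlt_trans hz (tlt_collapse_of_exp_tlt ?_ _ _ _)
            rw [e']
            exact tlt_gcons.2 (Or.inl (h.nil_tlt_st hγ))
          · exact tlt_of_tle_of_tlt hz (tlt_collapse h1 hTx)
        · intro z hz
          rw [e] at hz
          simp only [inSupp_gcons, not_inSupp_nil, or_false, false_or] at hz
          rw [hz]
          refine collapse_tlt_collapse_of_tlt ?_ (h3 x hxs)
          rw [e', tower, hx]
          exact tlt_gcons.2 (Or.inl (tlt_gcons.2 (Or.inl tlt_nil_gcons)))
      · rw [e]
        exact ⟨h1, h2, h3, h4'⟩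

/-- The induction step for the invariants of sequences. -/
theorem IsStar.starSeq_step {s : M} (hs : IsSeq 𝒮 s)
    (ih : ∀ a < s, IsTerm 𝒮 a → StarTerm 𝒮 st mt a)
    (ih' : ∀ a < s, IsSeq 𝒮 a → StarSeq 𝒮 st mt sq mq a)
    (ihlt : ∀ a b, a + b < s → IsTerm 𝒮 a → IsTerm 𝒮 b → olt 𝒮 a b → tlt 𝒮 (st a) (st b)) :
    StarSeq 𝒮 st mt sq mq s := by
  have hb : GT 𝒮 (tower gone : M) := GT_tower GT_gone
  rcases isSeq_cases hs with rfl | ⟨γ, k, rfl, hγ, hk⟩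
  · rw [StarSeq, h.sq_nil, h.mq_nil]
    exact ⟨GT_nil, TT_nil, by simp, by simp, by simp, by simp⟩
  · obtain ⟨h1, h2, h3, h4⟩ := ih γ (lt_cons_left _ _) hγ
    obtain ⟨k1, k2, k3, k4, k5, k6⟩ := ih' k (lt_cons_right _ _) hk
    have hle : ∀ γ' k', k = cons γ' k' → IsTerm 𝒮 γ' ∧ tle 𝒮 (st γ') (st γ) := by
      rintro γ' k' rfl
      have hγ' := (isSeq_cons.1 hk).1
      refine ⟨hγ', ?_⟩
      rcases (isSeq_cons.1 hs).2.2 _ _ rfl with rfl | h5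
      · exact tle_refl _
      · refine Or.inr (ihlt _ _ ?_ hγ' hγ h5)
        rw [add_comm]
        exact lt_trans (add_lt_add_right (lt_cons_left _ _) _) (add_lt_cons _ _)
    have hT : TT 𝒮 (mq (cons γ k)) := by rw [h.mq_cons]; exact TT_tmax h2 k2
    have hl : tle 𝒮 (mt γ) (mq (cons γ k)) := by rw [h.mq_cons]; exact tle_tmax_left _ _
    have hr : tle 𝒮 (mq k) (mq (cons γ k)) := by rw [h.mq_cons]; exact tle_tmax_right h2.1 k2.1
    have hhead : ∀ g d r, sq k = gcons g d r → ∃ γ' k', k = cons γ' k' ∧ g = st γ' := by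
      intro g d r e
      rcases isSeq_cases hk with rfl | ⟨γ', k', rfl, -⟩
      · rw [h.sq_nil] at e; simp at e
      · obtain ⟨d', r', e'⟩ := h.sq_cons_eq γ' k'
        rw [e', gcons_inj] at e
        exact ⟨_, _, rfl, e.1.symm⟩
    refine ⟨?_, hT, ?_, ?_, ?_, ?_⟩
    · rw [h.sq_cons]
      refine GT_prepend h1 k1 fun g d r e => ⟨?_, k5 g d r e⟩
      obtain ⟨γ', k', rfl, rfl⟩ := hhead g d r e
      exact (hle _ _ rfl).2
    · intro z hz
      rw [h.sq_cons] at hz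
      rcases inSupp_prepend hz with hz | hz | rfl | ⟨d, r, -, rfl⟩
      · exact tlt_of_tlt_of_tle (h3 z hz) (collapse_tle_collapse (tle_refl _) hl hb hT)
      · exact tlt_of_tlt_of_tle (k3 z hz) (collapse_tle_collapse (tle_refl _) hr hb hT)
      · exact nil_tlt_collapse _ _
      · exact tlt_collapse_of_exp_tlt tlt_nil_gcons _ _ _
    · intro x hx
      rw [oseqMemE_cons] at hx
      rcases hx with hx | hx
      · exact tle_trans (h4 x hx) hl
      · exact tle_trans (k4 x hx) hr
    · intro g d r e
      rw [h.sq_cons] at e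
      rcases prepend_cases (st γ) (sq k) with ⟨d', r', e1, e2⟩ | ⟨-, e2⟩
      · rw [e2, gcons_inj] at e
        rw [← e.2.1]
        exact (k5 _ _ _ e1).succ
      · rw [e2, gcons_inj] at e
        rw [← e.2.1]
        exact isNumeral_nil
    · intro γ0 k0 x e hx z hz
      rw [cons_inj] at e
      obtain ⟨rfl, rfl⟩ := e
      rw [h.sq_cons] at hz
      rcases inSupp_prepend hz with hz | hz | rfl | ⟨d, r, -, rfl⟩
      · rw [hx] at hz
        simp only [inSupp_gcons, not_inSupp_nil, or_false, false_or] at hz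
        exact Or.inr (Or.inl hz)
      · rcases isSeq_cases hk with rfl | ⟨γ', k', rfl, -⟩
        · rw [h.sq_nil] at hz; exact absurd hz not_inSupp_nil
        · have h5 := hle _ _ rfl
          rw [hx] at h5
          obtain ⟨y, hy, hyx⟩ := h.exists_of_st_tle h5.1 h5.2
          exact (k6 _ _ _ rfl hy z hz).imp_right fun h => tle_trans h hyx
      · exact Or.inl tlt_nil_gcons
      · exact Or.inl (tlt_gcons.2 (Or.inl tlt_nil_gcons))

/-- The bound attached to s is a maximum of `nil` and of the bounds attached to elements of E(s). It
therefore lies below c as soon as all of these do. -/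
theorem IsStar.mt_tlt {s c : M} (hs : IsTerm 𝒮 s) (hc : tlt 𝒮 nil c)
    (hx : ∀ x, omemE 𝒮 x s → tlt 𝒮 (mt x) c) : tlt 𝒮 (mt s) c := by
  have h1 := h.rec_mt
  have h2 := h.rec_mq
  have hr : Rec 𝒮 (fun s =>
    Imp (IsTerm 𝒮 s) (Imp (Ball (s + 1) fun x => Imp (omemE 𝒮 x s) (tlt 𝒮 (mt x) c))
      (tlt 𝒮 (mt s) c)) ∧
    Imp (IsSeq 𝒮 s) (Imp (Ball (tSum s + 1) fun x => Imp (oseqMemE 𝒮 x s) (tlt 𝒮 (mt x) c))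
      (tlt 𝒮 (mq s) c))) := by fun_prop
  refine (strong_induction hr (fun s ih => ⟨fun hs hx => ?_, fun hs hx => ?_⟩) s).1 hs
    fun x _ => hx x
  · rcases isTerm_cases hs with rfl | ⟨σ, rfl, hσ⟩ | ⟨l, rfl, hl⟩
    · rwa [h.mt_omega]
    · exact hx _ (lt_add_one_iff'.2 le_rfl) (omemE_tTheta.2 rfl)
    · rw [h.mt_sum]
      exact (ih l (lt_tSum l)).2 hl fun x hxl hx' => hx x hxl (omemE_tSum.2 hx')
  · rcases isSeq_cases hs with rfl | ⟨γ, k, rfl, hγ, hk⟩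
    · rwa [h.mq_nil]
    · have h3 := (ih γ (lt_cons_left _ _)).1 hγ fun x _ hx' => hx x (lt_add_one_iff'.2
        (omemE_le (omemE_tSum.2 (oseqMemE_cons.2 (Or.inl hx'))))) (oseqMemE_cons.2 (Or.inl hx'))
      have h4 := (ih k (lt_cons_right _ _)).2 hk fun x _ hx' => hx x (lt_add_one_iff'.2
        (omemE_le (omemE_tSum.2 (oseqMemE_cons.2 (Or.inr hx'))))) (oseqMemE_cons.2 (Or.inr hx'))
      rw [h.mq_cons]
      unfold tmax
      by_cases h5 : tlt 𝒮 (mt γ) (mq k)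
      · rwa [cond_pos h5]
      · rwa [cond_neg h5]

/-- The induction step for the preservation of the order on terms. -/
theorem IsStar.tlt_step {s t : M} (hs : IsTerm 𝒮 s) (ht : IsTerm 𝒮 t)
    (hQ : ∀ a, a ≤ s ∨ a ≤ t → IsTerm 𝒮 a → StarTerm 𝒮 st mt a)
    (hQ' : ∀ a, a ≤ s ∨ a ≤ t → IsSeq 𝒮 a → StarSeq 𝒮 st mt sq mq a)
    (ih : ∀ a b, a + b < s + t → IsTerm 𝒮 a → IsTerm 𝒮 b → olt 𝒮 a b → tlt 𝒮 (st a) (st b))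
    (ih' : ∀ a b, a + b < s + t → IsSeq 𝒮 a → IsSeq 𝒮 b → oseqLt 𝒮 a b → tlt 𝒮 (sq a) (sq b))
    (hlt : olt 𝒮 s t) : tlt 𝒮 (st s) (st t) := by
  have ihle : ∀ a b, a + b < s + t → IsTerm 𝒮 a → IsTerm 𝒮 b → ole 𝒮 a b → tle 𝒮 (st a) (st b) := by
    rintro a b hab ha hb (rfl | h1)
    · exact tle_refl _
    · exact Or.inr (ih a b hab ha hb h1)
  have hhd : ∀ γ l : M, γ < tSum (cons γ l) := fun γ l => (lt_cons_left _ _).trans (lt_tSum _)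
  have hTx : ∀ γ x, γ ≤ s ∨ γ ≤ t → IsTerm 𝒮 γ → st γ = gcons nil x nil → TT 𝒮 x :=
    fun γ x h1 hγ e => by
      have := (hQ γ h1 hγ).1
      rw [e] at this
      exact (GT_gcons.1 this).2.1
  rcases isTerm_cases hs with rfl | ⟨σ, rfl, hσ⟩ | ⟨k, rfl, hk⟩ <;>
  rcases isTerm_cases ht with rfl | ⟨τ, rfl, hτ⟩ | ⟨l, rfl, hl⟩
  · simp at hlt
  · simp at hlt
  · obtain ⟨γ, l, rfl, h1⟩ := olt_tOmega_tSum.1 hlt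
    have hγ := (isSeq_cons.1 hl).1
    have h2 := ihle _ _ (add_lt_add_right (hhd γ l) _) hs hγ h1
    rw [h.st_omega] at h2 ⊢
    rcases h.st_sum_cons (k := l) hγ with ⟨x, hx, -⟩ | ⟨-, e⟩
    · rw [hx] at h2
      exact absurd (tlt_of_tle_of_tlt h2 (tlt_gcons.2 (Or.inl tlt_nil_gcons) : tlt 𝒮 _ gOmega))
        (tlt_irrefl _)
    · obtain ⟨d, r, e'⟩ := h.sq_cons_eq γ l
      rw [e, e', gOmega]
      exact tlt_gcons.2 (Or.inl (tlt_of_tlt_of_tle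
        (tlt_gcons.2 (Or.inl tlt_nil_gcons) : tlt 𝒮 gone gOmega) h2))
  · rw [h.st_omega, h.st_theta]
    exact tlt_gcons.2 (Or.inl tlt_nil_gcons)
  · have hm : TT 𝒮 (mt τ) := (hQ τ (Or.inr (lt_tTheta τ).le) hτ).2.1
    have hGτ : GT 𝒮 (tower (st τ)) := GT_tower (hQ τ (Or.inr (lt_tTheta τ).le) hτ).1
    rw [h.st_theta, h.st_theta]
    refine tlt_gcons.2 (Or.inr ⟨rfl, Or.inl ?_⟩)
    -- In the first clause the value of ϑ(σ) is at most the bound for E(τ), which the collapse for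
    -- ϑ(τ) exceeds. In the second clause the exponent increases and the bound for E(σ) is below the
    -- value of ϑ(τ), so the collapses compare.
    rcases olt_tTheta_tTheta.1 hlt with ⟨x, hx, h1⟩ | ⟨h1, h2⟩
    · obtain ⟨ρ, rfl⟩ := exists_of_omemE hx
      have h3 := ihle _ _ (add_lt_add_right (omemE_lt_tTheta hx) _) hs (hτ.of_omemE hx) h1
      rw [h.st_theta, h.st_theta] at h3
      have h4 : tle 𝒮 (mt (tTheta σ)) (mt (tTheta ρ)) := by
        rcases h3 with h3 | h3
        · rw [gcons_inj] at h3; exact Or.inl h3.2.1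
        · simp [tlt_gcons] at h3; exact Or.inr h3
      refine tlt_of_tle_of_tlt (tle_trans h4 ?_) (?_ : tlt 𝒮 (mt τ) _)
      · exact (hQ τ (Or.inr (lt_tTheta τ).le) hτ).2.2.2 _ hx
      · rw [h.mt_theta]; exact tlt_collapse hGτ hm
    · have h3 := ih _ _ (add_lt_add (lt_tTheta σ) (lt_tTheta τ)) hσ hτ h1
      rw [h.mt_theta σ, h.mt_theta τ]
      refine collapse_tlt_collapse_of_tlt (tower_tlt_tower h3) ?_
      rw [← h.mt_theta τ]
      exact h.mt_tlt hσ (by rw [h.mt_theta]; exact nil_tlt_collapse _ _) fun x hx => by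
        have h4 := ih _ _ (add_lt_add_left (omemE_lt_tTheta hx) _) (hσ.of_omemE hx) ht (h2 x hx)
        obtain ⟨ρ, rfl⟩ := exists_of_omemE hx
        rw [h.st_theta, h.st_theta] at h4
        simpa [tlt_gcons] using h4
  · obtain ⟨γ, l, rfl, h1⟩ := olt_tTheta_tSum.1 hlt
    have hγ := (isSeq_cons.1 hl).1
    have h2 := ihle _ _ (add_lt_add_right (hhd γ l) _) hs hγ h1
    rw [h.st_theta] at h2 ⊢
    rcases h.st_sum_cons (k := l) hγ with ⟨x, hx, e⟩ | ⟨-, e⟩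
    · rw [e]
      refine tlt_gcons.2 (Or.inr ⟨rfl, Or.inl ?_⟩)
      refine tlt_of_tle_of_tlt ?_ (tlt_collapse (hQ' _ (Or.inr (lt_tSum _).le) hl).1
        (hTx γ x (Or.inr (hhd γ l).le) hγ hx))
      rw [hx] at h2
      rcases h2 with h2 | h2
      · rw [gcons_inj] at h2; exact Or.inl h2.2.1
      · simp [tlt_gcons] at h2; exact Or.inr h2
    · obtain ⟨d, r, e'⟩ := h.sq_cons_eq γ l
      rw [e, e']
      exact tlt_gcons.2 (Or.inl (h.nil_tlt_st hγ))
  · rw [h.st_omega]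
    rcases isSeq_cases hk with rfl | ⟨γ, k, rfl, hγ, -⟩
    · rw [h.st_sum_nil]
      exact tlt_gcons.2 (Or.inl tlt_nil_gcons)
    · have h2 := ih _ _ (add_lt_add_left (hhd γ k) _) hγ ht (olt_tSum_tOmega.1 hlt _ _ rfl)
      rw [h.st_omega] at h2
      obtain ⟨y, hy⟩ := h.exists_of_st_tlt_gOmega hγ h2
      rcases h.st_sum_cons (k := k) hγ with ⟨x, hx, e⟩ | ⟨⟨g, d, r, hg, hg'⟩, -⟩
      · rw [e]
        exact tlt_gcons.2 (Or.inl tlt_nil_gcons)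
      · rw [hg, gcons_inj] at hy
        exact absurd hy.1 hg'
  · rw [h.st_theta]
    rcases isSeq_cases hk with rfl | ⟨γ, k, rfl, hγ, -⟩
    · rw [h.st_sum_nil, h.mt_theta]
      exact tlt_gcons.2 (Or.inr ⟨rfl, Or.inl (tlt_collapse_of_exp_tlt tlt_nil_gcons _ _ _)⟩)
    · have h2 := ih _ _ (add_lt_add_left (hhd γ k) _) hγ ht (olt_tSum_tTheta.1 hlt _ _ rfl)
      rw [h.st_theta] at h2
      obtain ⟨y, hy, -⟩ := h.exists_of_st_tle hγ (Or.inr h2)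
      rcases h.st_sum_cons (k := k) hγ with ⟨x, hx, e⟩ | ⟨⟨g, d, r, hg, hg'⟩, -⟩
      · rw [e]
        refine tlt_gcons.2 (Or.inr ⟨rfl, Or.inl ?_⟩)
        rw [hx] at h2
        rw [h.mt_theta] at h2 ⊢
        -- Here the double power is needed: the leading exponent of the formal sum is some
        -- (1+X)^0·(1+x), which is below the exponent (1+X)^(τ*) of the tower. Hence values of ϑ are
        -- closed under countable sums.
        refine collapse_tlt_collapse_of_tlt ?_ (by simpa [tlt_gcons] using h2)
        obtain ⟨d, r, e'⟩ := h.sq_cons_eq γ k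
        rw [e', hx]
        exact tlt_gcons.2 (Or.inl (tlt_gcons.2 (Or.inl (h.nil_tlt_st hτ))))
      · rw [hg, gcons_inj] at hy
        exact absurd hy.1 hg'
  · rw [olt_tSum_tSum] at hlt
    have hsq := ih' _ _ (add_lt_add (lt_tSum k) (lt_tSum l)) hk hl hlt
    rcases isSeq_cases hl with rfl | ⟨δ, l, rfl, hδ, -⟩
    · simp at hlt
    have hGl := (hQ' _ (Or.inr (lt_tSum _).le) hl).1
    rcases isSeq_cases hk with rfl | ⟨γ, k, rfl, hγ, -⟩
    · rw [h.st_sum_nil]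
      rcases h.st_sum_cons (k := l) hδ with ⟨x, hx, e⟩ | ⟨-, e⟩
      · rw [e]
        refine tlt_gcons.2 (Or.inr ⟨rfl, Or.inl (tlt_collapse_of_exp_tlt ?_ _ _ _)⟩)
        obtain ⟨d, r, e'⟩ := h.sq_cons_eq δ l
        rw [e']; exact tlt_nil_gcons
      · obtain ⟨d, r, e'⟩ := h.sq_cons_eq δ l
        rw [e, e']
        exact tlt_gcons.2 (Or.inl (h.nil_tlt_st hδ))
    · have h2 : tle 𝒮 (st γ) (st δ) := ihle _ _ (add_lt_add (hhd γ k) (hhd δ l)) hγ hδ (by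
        rcases oseqLt_cons_cons.1 hlt with h1 | ⟨h1, -⟩
        · exact Or.inr h1
        · exact Or.inl h1)
      rcases h.st_sum_cons (k := l) hδ with ⟨x, hx, e⟩ | ⟨-, e⟩
      · rw [hx] at h2
        obtain ⟨y, hy, hyx⟩ := h.exists_of_st_tle hγ h2
        rcases h.st_sum_cons (k := k) hγ with ⟨x', hx', e'⟩ | ⟨⟨g, d, r, hg, hg'⟩, -⟩
        · rw [hx', gcons_inj] at hy
          rw [e, e']
          -- Both sums are countable. The formal sums are the exponents of the collapses and are
          -- already compared. It remains to see that the element for the smaller leading exponent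
          -- is below the larger collapse.
          refine tlt_gcons.2 (Or.inr ⟨rfl, Or.inl (collapse_tlt_collapse_of_tlt hsq ?_)⟩)
          rw [hy.2.1]
          exact tlt_of_tle_of_tlt hyx (tlt_collapse hGl (hTx δ x (Or.inr (hhd δ l).le) hδ hx))
        · rw [hg, gcons_inj] at hy
          exact absurd hy.1 hg'
      · rw [e]
        rcases h.st_sum_cons (k := k) hγ with ⟨x', hx', e'⟩ | ⟨-, e'⟩
        · obtain ⟨d, r, e2⟩ := h.sq_cons_eq δ l
          rw [e', e2]
          exact tlt_gcons.2 (Or.inl (h.nil_tlt_st hδ))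
        · rwa [e']

/-- The induction step for the preservation of the order on sequences. -/
theorem IsStar.seq_tlt_step {s t : M} (hs : IsSeq 𝒮 s) (ht : IsSeq 𝒮 t)
    (ih : ∀ a b, a + b < s + t → IsTerm 𝒮 a → IsTerm 𝒮 b → olt 𝒮 a b → tlt 𝒮 (st a) (st b))
    (ih' : ∀ a b, a + b < s + t → IsSeq 𝒮 a → IsSeq 𝒮 b → oseqLt 𝒮 a b → tlt 𝒮 (sq a) (sq b))
    (hlt : oseqLt 𝒮 s t) : tlt 𝒮 (sq s) (sq t) := by
  rcases isSeq_cases ht with rfl | ⟨δ, l, rfl, hδ, hl⟩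
  · simp at hlt
  obtain ⟨d, r, e⟩ := h.sq_cons_eq δ l
  rcases isSeq_cases hs with rfl | ⟨γ, k, rfl, hγ, hk⟩
  · rw [h.sq_nil, e]; exact tlt_nil_gcons
  · rcases oseqLt_cons_cons.1 hlt with h1 | ⟨rfl, h1⟩
    · obtain ⟨d', r', e'⟩ := h.sq_cons_eq γ k
      rw [e, e']
      exact tlt_gcons.2 (Or.inl (ih _ _ (add_lt_add (lt_cons_left _ _) (lt_cons_left _ _)) hγ hδ h1))
    · rw [h.sq_cons, h.sq_cons]
      refine prepend_tlt_prepend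
        (ih' _ _ (add_lt_add (lt_cons_right _ _) (lt_cons_right _ _)) hk hl h1) fun g' d' r' e1 => ?_
      rcases isSeq_cases hl with rfl | ⟨γ', k', rfl, hγ', -⟩
      · rw [h.sq_nil] at e1; simp at e1
      · obtain ⟨d2, r2, e2⟩ := h.sq_cons_eq γ' k'
        rw [e2, gcons_inj] at e1
        rw [← e1.1]
        rcases (isSeq_cons.1 ht).2.2 _ _ rfl with rfl | h2
        · exact tle_refl _
        · refine Or.inr (ih _ _ ?_ hγ' hγ h2)
          refine lt_of_lt_of_le ?_ le_add_self
          rw [add_comm]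
          exact lt_trans (add_lt_add_right (lt_cons_left _ _) _) (add_lt_cons _ _)

/-- The invariants and order preservation depend on each other: values of sequences are Goodstein
terms because the order of the exponents is preserved, and collapses are compared via the
invariants. So all of this is proved by one induction on the sum of two codes. -/
theorem IsStar.main (s t : M) :
    (IsTerm 𝒮 s → StarTerm 𝒮 st mt s) ∧
      (IsTerm 𝒮 s → IsTerm 𝒮 t → olt 𝒮 s t → tlt 𝒮 (st s) (st t)) := by
  have h1 := h.rec_starTerm
  have h2 := h.rec_starSeq
  have h3 := h.rec_st
  have h4 := h.rec_sq
  have hr : Rec 𝒮 (fun q : M × M =>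
    (Imp (IsTerm 𝒮 q.1) (StarTerm 𝒮 st mt q.1) ∧ Imp (IsSeq 𝒮 q.1) (StarSeq 𝒮 st mt sq mq q.1)) ∧
    Imp (IsTerm 𝒮 q.1) (Imp (IsTerm 𝒮 q.2) (Imp (olt 𝒮 q.1 q.2) (tlt 𝒮 (st q.1) (st q.2)))) ∧
    Imp (IsSeq 𝒮 q.1) (Imp (IsSeq 𝒮 q.2) (Imp (oseqLt 𝒮 q.1 q.2) (tlt 𝒮 (sq q.1) (sq q.2))))) := by
    fun_prop
  have key := strong_induction_two hr (fun s t ih => ?_)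
  · exact ⟨(key s t).1.1, (key s t).2.1⟩
  -- The unary statements are read off from the binary induction hypothesis at the pair (a, 0).
  have ihT : ∀ a, a < s + t → IsTerm 𝒮 a → StarTerm 𝒮 st mt a :=
    fun a ha => (ih a 0 (by rwa [add_zero])).1.1
  have ihS : ∀ a, a < s + t → IsSeq 𝒮 a → StarSeq 𝒮 st mt sq mq a :=
    fun a ha => (ih a 0 (by rwa [add_zero])).1.2
  have ihlt : ∀ a b, a + b < s + t → IsTerm 𝒮 a → IsTerm 𝒮 b → olt 𝒮 a b → tlt 𝒮 (st a) (st b) :=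
    fun a b hab => (ih a b hab).2.1
  have ihslt : ∀ a b, a + b < s + t → IsSeq 𝒮 a → IsSeq 𝒮 b → oseqLt 𝒮 a b →
    tlt 𝒮 (sq a) (sq b) := fun a b hab => (ih a b hab).2.2
  -- The comparison of s and t uses the invariants at s and t themselves. These may have code s + t,
  -- so the step has to be carried out before the order is considered.
  have qT : ∀ u, u ≤ s + t → IsTerm 𝒮 u → StarTerm 𝒮 st mt u := fun u hu hu' =>
    h.starTerm_step hu' (fun a ha => ihT a (ha.trans_le hu)) (fun a ha => ihS a (ha.trans_le hu))
  have qS : ∀ u, u ≤ s + t → IsSeq 𝒮 u → StarSeq 𝒮 st mt sq mq u := fun u hu hu' =>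
    h.starSeq_step hu' (fun a ha => ihT a (ha.trans_le hu)) (fun a ha => ihS a (ha.trans_le hu))
      (fun a b hab => ihlt a b (hab.trans_le hu))
  have hle : ∀ a, a ≤ s ∨ a ≤ t → a ≤ s + t := by
    rintro a (ha | ha)
    · exact ha.trans le_self_add
    · exact ha.trans le_add_self
  refine ⟨⟨qT s le_self_add, qS s le_self_add⟩, fun hs ht hlt => ?_, fun hs ht hlt => ?_⟩
  · exact h.tlt_step hs ht (fun a ha => qT a (hle a ha)) (fun a ha => qS a (hle a ha)) ihlt ihslt hlt
  · exact h.seq_tlt_step hs ht ihlt ihslt hlt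

end Invariants

theorem olt_asymm {s t : M} (hs : IsTerm 𝒮 s) (ht : IsTerm 𝒮 t) (h : olt 𝒮 s t) : ¬ olt 𝒮 t s := by
  obtain ⟨st, mt, sq, mq, hst⟩ := exists_star (𝒮 := 𝒮)
  exact fun h' => tlt_asymm ((hst.main s t).2 hs ht h) ((hst.main t s).2 ht hs h')

/-- Terms below Ω have values below that of Ω, hence of the form (1+X)^0·(1+x). The embedding
extracts x, and trichotomy shows that it reflects the order. -/
theorem bachmannHoward_embeds_canonical : (bachmannHoward 𝒮).Embeds 𝒮 (canonical 𝒮) := by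
  obtain ⟨st, mt, sq, mq, h⟩ := exists_star (𝒮 := 𝒮)
  have h1 := h.rec_st
  have hcnt : ∀ s ∈ (bachmannHoward 𝒮).dom, IsTerm 𝒮 s ∧ ∃ x, st s = gcons nil x nil := by
    intro s hs
    obtain ⟨hs, hs'⟩ := mem_bachmannHoward_iff.1 hs
    have := (h.main s tOmega).2 hs isTerm_tOmega hs'
    rw [h.st_omega] at this
    exact ⟨hs, h.exists_of_st_tlt_gOmega hs this⟩
  have hlt : ∀ a ∈ (bachmannHoward 𝒮).dom, ∀ b ∈ (bachmannHoward 𝒮).dom, olt 𝒮 a b →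
      tlt 𝒮 (gcoef (st a)) (gcoef (st b)) := by
    intro a ha b hb hab
    obtain ⟨ha, x, hx⟩ := hcnt a ha
    obtain ⟨hb, y, hy⟩ := hcnt b hb
    have := (h.main a b).2 ha hb hab
    rw [hx, hy] at this ⊢
    simpa [tlt_gcons] using this
  refine ⟨fun s => gcoef (st s), Rec.codedFun (by fun_prop) bachmannHoward_dom_mem, fun s hs => ?_,
    fun a ha b hb => ?_⟩
  · obtain ⟨hs, x, hx⟩ := hcnt s hs
    have := ((h.main s s).1 hs).1
    rw [hx] at this
    beta_reduce
    rw [hx, gcoef_gcons]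
    exact (GT_gcons.1 this).2.1
  · have hat := (mem_bachmannHoward_iff.1 ha).1
    have hbt := (mem_bachmannHoward_iff.1 hb).1
    rw [bachmannHoward_lt_iff]
    refine ⟨fun hab => hlt a ha b hb hab.2.2, fun hab => ⟨hat, hbt, ?_⟩⟩
    rcases olt_trichotomy hat hbt with h2 | rfl | h2
    · exact h2
    · exact absurd hab (tlt_irrefl _)
    · exact absurd hab (tlt_asymm (hlt b hb a ha h2))

end Star

/-! ### Basic properties of termination points. -/

section TerminationPoint

variable {M : Type*} [CommSemiring M] [LinearOrder M] [IsStrictOrderedRing M]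
    [CanonicallyOrderedAdd M] [DiscreteNumbers M] {𝒮 : Set (Set M)} [hS : Fact (ModelsRCA0 𝒮)]

variable {X : Ord M} {A : M → M} (h : IsTerminationPoint 𝒮 X A)
include h

theorem IsTerminationPoint.gMem {x : M} (hx : x ∈ X.dom) :
    GMem 𝒮 X (A x) ∧ ∀ z, InSupp 𝒮 z (A x) → X.lt z x :=
  (gMem_below_iff h.coded).1 (h.mem x hx)

theorem IsTerminationPoint.mono {x y : M} (hx : x ∈ X.dom) (hy : y ∈ X.dom) (hxy : X.lt x y) :
    glex 𝒮 X.lt (A x) (A y) := by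
  have := h.above y hy x ⟨hx, hxy⟩
  rw [goodstein_lt_iff (h.coded.below y)] at this
  exact this.2.2

theorem IsTerminationPoint.le_of {x σ : M} (hx : x ∈ X.dom) (hσ : GMem 𝒮 X σ)
    (hs : ∀ z, InSupp 𝒮 z σ → X.lt z x) (hy : ∀ y ∈ X.dom, X.lt y x → glex 𝒮 X.lt (A y) σ) :
    A x = σ ∨ glex 𝒮 X.lt (A x) σ := by
  have hσ' : GMem 𝒮 (X.below x) σ := (gMem_below_iff h.coded).2 ⟨hσ, hs⟩
  refine (goodstein_le_iff (h.coded.below x) (h.mem x hx) hσ').1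
    (h.smallest x hx σ hσ' fun y hyx => ?_)
  rw [goodstein_lt_iff (h.coded.below x)]
  refine ⟨?_, hσ', hy y hyx.1 hyx.2⟩
  refine (gMem_below_iff h.coded).2 ⟨(h.gMem hyx.1).1, fun z hz => ?_⟩
  have hzy := (h.gMem hyx.1).2 z hz
  exact h.linear.trans _ (mem_dom_of_inSupp h.coded (h.gMem hyx.1).1 hz) _ hyx.1 _ hx hzy hyx.2

theorem IsTerminationPoint.lt_of_glex {x y : M} (hx : x ∈ X.dom) (hy : y ∈ X.dom)
    (hxy : glex 𝒮 X.lt (A x) (A y)) : X.lt x y := by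
  rcases h.linear.trichotomy x hx y hy with h1 | rfl | h1
  · exact h1
  · exact absurd hxy (glex_irrefl h.coded h.linear (h.gMem hx).1)
  · exact absurd hxy (glex_asymm h.coded h.linear (h.gMem hy).1 (h.gMem hx).1 (h.mono hy hx h1))

end TerminationPoint

/-! ### Embedding T into a strong termination point. -/

section CanonicalEmbeds

variable {M : Type*} [CommSemiring M] [LinearOrder M] [IsStrictOrderedRing M]
    [CanonicallyOrderedAdd M] [DiscreteNumbers M] {𝒮 : Set (Set M)} [hS : Fact (ModelsRCA0 𝒮)]

/-- Up to codes `n`, the function `F` is the action of the Goodstein predilator on `f`, which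
inverts `A`. -/
structure IsPartialInverse (𝒮 : Set (Set M)) (X : Ord M) (A f F : M → M) (n : M) : Prop where
  rec_f : Rec 𝒮 f
  rec_F : Rec 𝒮 F
  map_nil : F nil = nil
  map_gcons : ∀ γ δ r, gcons γ δ r ≤ n → F (gcons γ δ r) = gcons (F γ) (f δ) (F r)
  inverse : ∀ i < n, TT 𝒮 i → f i ∈ X.dom ∧ A (f i) = F i

variable {X : Ord M} {A f F : M → M} {n : M} (h : IsTerminationPoint 𝒮 X A)
  (hf : IsPartialInverse 𝒮 X A f F n)
include h hf

/-- For coefficients δ < δ' the induction hypothesis compares F(δ) = A(f(δ)) with F(δ') = A(f(δ')),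
and as A is increasing this gives f(δ) < f(δ'). Thus f need not be assumed monotone. -/
theorem IsPartialInverse.mono {i j : M} (hi : i ≤ n) (hj : j ≤ n) (hGi : GT 𝒮 i) (hGj : GT 𝒮 j)
    (hij : tlt 𝒮 i j) : glex 𝒮 X.lt (F i) (F j) := by
  have h1 := hf.rec_f
  have h2 := hf.rec_F
  have h3 := h.coded.rec_lt
  have hlex := isLex_glex h3
  have hr : Rec 𝒮 (fun q : M × M => Imp (q.1 ≤ n) (Imp (q.2 ≤ n) (Imp (GT 𝒮 q.1) (Imp (GT 𝒮 q.2)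
    (Imp (tlt 𝒮 q.1 q.2) (glex 𝒮 X.lt (F q.1) (F q.2))))))) := by fun_prop
  refine strong_induction_two hr (fun i j ih hi hj hGi hGj hij => ?_) i j hi hj hGi hGj hij
  dsimp only at ih hi hj hGi hGj hij ⊢
  obtain ⟨γ', δ', r', rfl⟩ := isLex_tlt.exists_right hij
  have hle : ∀ {a b c : M}, a < b → b ≤ c → a ≤ c := fun h h' => (h.trans_le h').le
  rcases GT_cases hGi with rfl | ⟨γ, δ, r, rfl, -⟩
  · rw [hf.map_nil, hf.map_gcons _ _ _ hj]
    exact hlex.nil_gcons _ _ _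
  · rw [hf.map_gcons _ _ _ hi, hf.map_gcons _ _ _ hj, hlex.gcons_iff]
    obtain ⟨h4, h5, h6, -⟩ := GT_gcons.1 hGi
    obtain ⟨h4', h5', h6', -⟩ := GT_gcons.1 hGj
    rcases tlt_gcons.1 hij with h7 | ⟨rfl, h7 | ⟨rfl, h7⟩⟩
    · exact Or.inl (ih _ _ (add_lt_add (exp_lt_gcons _ _ _) (exp_lt_gcons _ _ _))
        (hle (exp_lt_gcons _ _ _) hi) (hle (exp_lt_gcons _ _ _) hj) h4 h4' h7)
    · refine Or.inr ⟨rfl, Or.inl ?_⟩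
      have h8 := ih _ _ (add_lt_add (coef_lt_gcons _ _ _) (coef_lt_gcons _ _ _))
        (hle (coef_lt_gcons _ _ _) hi) (hle (coef_lt_gcons _ _ _) hj) h5.1 h5'.1 h7
      obtain ⟨h9, h10⟩ := hf.inverse δ ((coef_lt_gcons _ _ _).trans_le hi) h5
      obtain ⟨h9', h10'⟩ := hf.inverse δ' ((coef_lt_gcons _ _ _).trans_le hj) h5'
      rw [← h10, ← h10'] at h8
      exact h.lt_of_glex h9 h9' h8
    · exact Or.inr ⟨rfl, Or.inr ⟨rfl, ih _ _ (add_lt_add (tail_lt_gcons _ _ _) (tail_lt_gcons _ _ _))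
        (hle (tail_lt_gcons _ _ _) hi) (hle (tail_lt_gcons _ _ _) hj) h6 h6' h7⟩⟩

theorem IsPartialInverse.gMem {i : M} (hi : i ≤ n) (hG : GT 𝒮 i) : GMem 𝒮 X (F i) := by
  have h1 := hf.rec_f
  have h2 := hf.rec_F
  have h3 := rec_gMem h.coded
  have hr : Rec 𝒮 (fun i => Imp (i ≤ n) (Imp (GT 𝒮 i) (GMem 𝒮 X (F i)))) := by fun_prop
  refine strong_induction hr (fun i ih hi hG => ?_) i hi hG
  have hle : ∀ {a b c : M}, a < b → b ≤ c → a ≤ c := fun h h' => (h.trans_le h').le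
  rcases GT_cases hG with rfl | ⟨γ, δ, r, rfl, hγ, hr'⟩
  · rw [hf.map_nil]; exact gMem_nil h.coded
  · rw [hf.map_gcons _ _ _ hi, gMem_gcons h.coded]
    obtain ⟨-, h5, -, h6⟩ := GT_gcons.1 hG
    refine ⟨ih _ (exp_lt_gcons _ _ _) (hle (exp_lt_gcons _ _ _) hi) hγ,
      (hf.inverse δ ((coef_lt_gcons _ _ _).trans_le hi) h5).1,
      ih _ (tail_lt_gcons _ _ _) (hle (tail_lt_gcons _ _ _) hi) hr', fun γ' δ' r' e => ?_⟩
    have hri := hle (tail_lt_gcons _ _ _) hi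
    rcases GT_cases hr' with rfl | ⟨γ2, δ2, r2, rfl, hγ2, -⟩
    · rw [hf.map_nil] at e; simp at e
    · rw [hf.map_gcons _ _ _ hri, gcons_inj] at e
      rw [← e.1]
      exact hf.mono h (hle (exp_lt_gcons _ _ _) hri) (hle (exp_lt_gcons _ _ _) hi) hγ2 hγ (h6 _ _ _ rfl)

theorem IsPartialInverse.exists_of_inSupp {i z : M} (hi : i ≤ n) (hG : GT 𝒮 i)
    (hz : InSupp 𝒮 z (F i)) : ∃ δ, InSupp 𝒮 δ i ∧ z = f δ := by
  have h1 := hf.rec_f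
  have h2 := hf.rec_F
  have hr : Rec 𝒮 (fun i => Imp (i ≤ n) (Imp (GT 𝒮 i) (Imp (InSupp 𝒮 z (F i))
    (Bex i fun δ => InSupp 𝒮 δ i ∧ z = f δ)))) := by fun_prop
  suffices hs : Bex i fun δ => InSupp 𝒮 δ i ∧ z = f δ by
    obtain ⟨δ, -, hδ⟩ := hs
    exact ⟨δ, hδ⟩
  refine strong_induction hr (fun i ih hi hG hz => ?_) i hi hG hz
  have hle : ∀ {a b c : M}, a < b → b ≤ c → a ≤ c := fun h h' => (h.trans_le h').le
  rcases GT_cases hG with rfl | ⟨γ, δ, r, rfl, hγ, hr'⟩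
  · rw [hf.map_nil] at hz; exact absurd hz not_inSupp_nil
  · rw [hf.map_gcons _ _ _ hi, inSupp_gcons] at hz
    rcases hz with hz | rfl | hz
    · obtain ⟨d, hd, hd', rfl⟩ := ih _ (exp_lt_gcons _ _ _) (hle (exp_lt_gcons _ _ _) hi) hγ hz
      exact ⟨d, hd.trans (exp_lt_gcons _ _ _), by simp [hd'], rfl⟩
    · exact ⟨δ, coef_lt_gcons _ _ _, by simp, rfl⟩
    · obtain ⟨d, hd, hd', rfl⟩ := ih _ (tail_lt_gcons _ _ _) (hle (tail_lt_gcons _ _ _) hi) hr' hz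
      exact ⟨d, hd.trans (tail_lt_gcons _ _ _), by simp [hd'], rfl⟩

omit h in
-- Take the least z that dominates F(n). Elements y of supp(F(n)) have A(y) < F(n) ≤ A(z), because n
-- ∈ T, so the support is below z. No y < z dominates, so A(y) < F(n) for these y. Hence F(n)
-- competes with A(z) in the minimality condition, and A(z) ≤ F(n).
theorem IsPartialInverse.exists_preimage (h : IsStrongTerminationPoint 𝒮 X A) (hn : TT 𝒮 n) :
    ∃ z ∈ X.dom, A z = F n := by
  have ht := h.toIsTerminationPoint
  have hl := ht.linear
  have hw := hf.gMem ht le_rfl hn.1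
  obtain ⟨z, hz, ⟨hd1, hd2⟩, hleast⟩ := h.least (F n) hw
  have hd2' := (goodstein_le_iff ht.coded hw (ht.gMem hz).1).1 hd2
  have hsupp : ∀ y, InSupp 𝒮 y (F n) → y ∈ X.dom ∧ glex 𝒮 X.lt (A y) (F n) := by
    intro y hy
    obtain ⟨δ, hδ, rfl⟩ := hf.exists_of_inSupp ht le_rfl hn.1 hy
    have hδT := TT_of_inSupp hn.1 hδ
    obtain ⟨h1, h2⟩ := hf.inverse δ (lt_of_inSupp hδ) hδT
    refine ⟨h1, ?_⟩
    rw [h2]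
    exact hf.mono ht (lt_of_inSupp hδ).le le_rfl hδT.1 hn.1 (hn.2 δ hδ)
  refine ⟨z, hz, ?_⟩
  have hlt : ∀ y, InSupp 𝒮 y (F n) → X.lt y z := by
    intro y hy
    obtain ⟨h1, h2⟩ := hsupp y hy
    refine ht.lt_of_glex h1 hz ?_
    rcases hd2' with h3 | h3
    · rwa [← h3]
    · exact glex_trans ht.coded hl (ht.gMem h1).1 hw (ht.gMem hz).1 h2 h3
  have hbelow : ∀ y ∈ X.dom, X.lt y z → glex 𝒮 X.lt (A y) (F n) := by
    intro y hy hyz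
    rcases glex_trichotomy ht.coded hl (ht.gMem hy).1 hw with h1 | h1
    · exact h1
    · exfalso
      have hyd : ∀ x, InSupp 𝒮 x (F n) → X.le x y := by
        intro x hx
        obtain ⟨h2, h3⟩ := hsupp x hx
        refine Or.inr (ht.lt_of_glex h2 hy ?_)
        rcases h1 with h1 | h1
        · rwa [h1]
        · exact glex_trans ht.coded hl (ht.gMem h2).1 hw (ht.gMem hy).1 h3 h1
      have : X.le z y := hleast y hy ⟨hyd, (goodstein_le_iff ht.coded hw (ht.gMem hy).1).2
        (h1.imp_left Eq.symm)⟩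
      rcases this with rfl | h2
      · exact hl.irrefl _ hz hyz
      · exact hl.irrefl _ hz (hl.trans _ hz _ hy _ hz h2 hyz)
  rcases ht.le_of hz hw hlt hbelow with h1 | h1
  · exact h1
  · rcases hd2' with h3 | h3
    · exact h3.symm
    · exact absurd h1 (glex_asymm ht.coded hl hw (ht.gMem hz).1 h3)

end CanonicalEmbeds

section CanonicalEmbeds

variable {M : Type*} [CommSemiring M] [LinearOrder M] [IsStrictOrderedRing M]
    [CanonicallyOrderedAdd M] [DiscreteNumbers M] {𝒮 : Set (Set M)} [hS : Fact (ModelsRCA0 𝒮)]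

/-- The value at n codes the pair of f(n) and F(n). That f(n) can be found depends on the
correctness of the earlier values, which is why a recursion with admissible values is used instead
of a recursion with a fixed functional. -/
theorem exists_isPartialInverse {X : Ord M} {A : M → M} (h : IsStrongTerminationPoint 𝒮 X A) :
    ∃ f F, ∀ n, IsPartialInverse 𝒮 X A f F n := by
  have ht := h.toIsTerminationPoint
  obtain ⟨B, hB, hBA⟩ := exists_rec_of_codedFun ht.coded.1 ht.coded_seq
  have hX := ht.coded.rec_dom
  have hR : Rec 𝒮 (fun q : M × M × M => (Imp (q.1 = nil) (unpairR q.2.2 = nil) ∧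
      Imp (IsG q.1) (unpairR q.2.2 = gcons (unpairR (app q.2.1 (gexp q.1)))
        (unpairL (app q.2.1 (gcoef q.1))) (unpairR (app q.2.1 (cdr q.1)))) ∧
      Imp (TT 𝒮 q.1) (unpairL q.2.2 ∈ X.dom ∧ B (unpairL q.2.2) = unpairR q.2.2))) := by fun_prop
  have key := exists_course_of_values (R := fun n s v => Imp (n = nil) (unpairR v = nil) ∧
      Imp (IsG n) (unpairR v = gcons (unpairR (app s (gexp n))) (unpairL (app s (gcoef n)))
        (unpairR (app s (cdr n)))) ∧
      Imp (TT 𝒮 n) (unpairL v ∈ X.dom ∧ B (unpairL v) = unpairR v)) hR ?_ ?_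
  · obtain ⟨g, hg, hgs⟩ := key
    refine ⟨fun n => unpairL (g n), fun n => unpairR (g n), fun n => ⟨by fun_prop, by fun_prop, ?_, ?_, ?_⟩⟩
    · obtain ⟨s, -, hs, -⟩ := hgs nil
      exact hs rfl
    · intro γ δ r _
      obtain ⟨s, hs, -, hs', -⟩ := hgs (gcons γ δ r)
      have := hs' (isG_gcons _ _ _)
      rwa [gexp_gcons, gcoef_gcons, cdr_gcons, hs _ (exp_lt_gcons _ _ _), hs _ (coef_lt_gcons _ _ _),
        hs _ (tail_lt_gcons _ _ _)] at this
    · intro i _ hi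
      obtain ⟨s, -, -, -, hs⟩ := hgs i
      obtain ⟨h1, h2⟩ := hs hi
      exact ⟨h1, by rw [← hBA _ h1]; exact h2⟩
  · rintro n s s' v hss ⟨h1, h2, h3⟩
    refine ⟨h1, fun hG => ?_, h3⟩
    rw [← hss _ hG.exp_lt, ← hss _ hG.coef_lt, ← hss _ hG.tail_lt]
    exact h2 hG
  · intro n s hs
    set w := Cond (n = nil) nil (gcons (unpairR (app s (gexp n))) (unpairL (app s (gcoef n)))
        (unpairR (app s (cdr n)))) with hw
    have hwG : IsG n → w = (gcons (unpairR (app s (gexp n))) (unpairL (app s (gcoef n)))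
        (unpairR (app s (cdr n)))) := fun hG => cond_neg (by rintro rfl; simp at hG) _ _
    -- The segment contains values below n only. F is patched at n by w, the value that the
    -- recursion equation dictates, while f is not yet needed there.
    have hpart : IsPartialInverse 𝒮 X A (fun i => unpairL (app s i))
        (fun i => Cond (i = n) w (unpairR (app s i))) n := by
      have hlt : ∀ i < n, Cond (i = n) w (unpairR (app s i)) = unpairR (app s i) :=
        fun i hi => cond_neg hi.ne _ _
      refine ⟨by fun_prop, by fun_prop, ?_, fun γ δ r hle => ?_, fun i hi hT => ?_⟩
      · rcases eq_or_ne nil n with rfl | hn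
        · rw [cond_pos rfl]; exact cond_pos rfl _ _
        · rw [cond_neg hn]
          exact (hs nil (lt_of_le_of_ne (num_nonneg n) hn)).1 rfl
      · have h1 := (exp_lt_gcons γ δ r).trans_le hle
        have h2 := (tail_lt_gcons γ δ r).trans_le hle
        rw [hlt _ h1, hlt _ h2]
        rcases eq_or_lt_of_le hle with rfl | hn
        · rw [cond_pos rfl, hwG (isG_gcons _ _ _)]
          simp
        · rw [hlt _ hn]
          have := (hs _ hn).2.1 (isG_gcons _ _ _)
          simpa using this
      · rw [hlt i hi]
        obtain ⟨h1, h2⟩ := (hs i hi).2.2 hT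
        exact ⟨h1, by rw [← hBA _ h1]; exact h2⟩
    by_cases hn : TT 𝒮 n
    · obtain ⟨z, hz, hz'⟩ := hpart.exists_preimage h hn
      rw [cond_pos rfl] at hz'
      refine ⟨pair z w, ?_⟩
      rw [unpairL_pair, unpairR_pair]
      refine ⟨fun e => by rw [hw, cond_pos e], hwG, fun _ => ⟨hz, ?_⟩⟩
      rw [hBA z hz, hz']
    -- Outside of T the value of f does not matter, but F still has to be recorded for the terms
    -- that contain n.
    · refine ⟨pair 0 w, ?_⟩
      rw [unpairL_pair, unpairR_pair]
      exact ⟨fun e => by rw [hw, cond_pos e], hwG, fun h => absurd h hn⟩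

theorem canonical_embeds {X : Ord M} {A : M → M} (h : IsStrongTerminationPoint 𝒮 X A) :
    (canonical 𝒮).Embeds 𝒮 X := by
  obtain ⟨f, F, hf⟩ := exists_isPartialInverse h
  have ht := h.toIsTerminationPoint
  have hdom : ∀ a ∈ (canonical 𝒮).dom, f a ∈ X.dom ∧ A (f a) = F a := fun a ha =>
    (hf (a + 1)).inverse a (lt_add_one_iff'.2 le_rfl) ha
  refine embeds_of_mono canonical_coded canonical_linear
    (fun a ha b hb hab hba => ht.linear.irrefl a ha (ht.linear.trans a ha b hb a ha hab hba))
    (hf 0).rec_f (fun a ha => (hdom a ha).1) fun a ha b hb hab => ?_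
  obtain ⟨h1, h2⟩ := hdom a ha
  obtain ⟨h3, h4⟩ := hdom b hb
  refine ht.lt_of_glex h1 h3 ?_
  rw [h2, h4]
  exact (hf (a + b)).mono ht le_self_add le_add_self ha.1 hb.1 hab

end CanonicalEmbeds

/-! ### Height functions that support recursion. -/

section Height

variable {M : Type*} [CommSemiring M] [LinearOrder M] [IsStrictOrderedRing M]
    [CanonicallyOrderedAdd M] [DiscreteNumbers M] {𝒮 : Set (Set M)} [hS : Fact (ModelsRCA0 𝒮)]

/-- Summing 2n + 1 + B(n) over all arguments up to the given one yields a monotone function with the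
required growth. -/
theorem exists_majorant {B : M → M} (hB : Rec 𝒮 B) : ∃ m : M → M, Rec 𝒮 m ∧
    (∀ b, b + b < m b) ∧ (∀ b, B b ≤ m b) ∧ ∀ a b, a ≤ b → m a ≤ m b := by
  obtain ⟨m, hm, h⟩ := exists_recursion (𝒮 := 𝒮)
    (F := fun g n => n + n + 1 + B n + Cond (predecessor n < n) (g (predecessor n)) 0) (by fun_prop)
    (fun g g' n h => by
      by_cases hn : predecessor n < n
      · simp only [h _ hn]
      · rw [cond_neg hn, cond_neg hn])
  have hsucc : ∀ n, m n ≤ m (n + 1) := fun n => by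
    rw [h (n + 1), predecessor_add_one, cond_pos (lt_add_one_iff'.2 le_rfl)]
    exact le_add_self
  refine ⟨m, hm, fun b => ?_, fun b => ?_, fun a b hab => ?_⟩
  · rw [h, add_assoc (b + b + 1)]
    exact lt_of_lt_of_le (lt_add_one_iff'.2 le_rfl) le_self_add
  · rw [h]
    exact le_add_self.trans le_self_add
  · have hr : Rec 𝒮 (fun b => Imp (a ≤ b) (m a ≤ m b)) := by fun_prop
    refine set_induction hr (fun h0 => ?_) (fun b ih hab => ?_) b hab
    · rw [le_antisymm h0 (num_nonneg a)]
    · rcases eq_or_lt_of_le hab with rfl | hab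
      · exact le_rfl
      · exact (ih (lt_add_one_iff'.1 hab)).trans (hsucc b)

theorem exists_iterate {m : M → M} (hm : Rec 𝒮 m) : ∃ it : M → M → M,
    Rec 𝒮 (fun q : M × M => it q.1 q.2) ∧ (∀ b, it 0 b = b) ∧ ∀ k b, it (k + 1) b = m (it k b) := by
  obtain ⟨it, hit, h⟩ := exists_recursion_two (𝒮 := 𝒮)
    (F := fun g a b => Cond (predecessor a < a) (m (g (predecessor a) b)) b) (by fun_prop)
    (fun g g' a b h => by
      by_cases ha : predecessor a < a
      · rw [h _ _ (add_lt_add_left ha b)]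
      · rw [cond_neg ha, cond_neg ha])
  refine ⟨it, hit, fun b => ?_, fun k b => ?_⟩
  · rw [h]; exact cond_neg (not_lt.2 (num_nonneg _)) _ _
  · rw [h, predecessor_add_one]; exact cond_pos (lt_add_one_iff'.2 le_rfl) _ _

/-- A relation that is bounded by the function `B` and admits a height function also admits a height
function that determines its argument. -/
theorem exists_decodable_height {D : M → Prop} {P : M → M → Prop} {B h : M → M} (hB : Rec 𝒮 B)
    (hh : Rec 𝒮 h) (hPB : ∀ x y, D x → D y → P x y → x ≤ B y)
    (hP : ∀ x y, D x → D y → P x y → h x < h y) :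
    ∃ ν : M → M, Rec 𝒮 ν ∧ (∀ x, unpairR (ν x) = x) ∧ ∀ x y, D x → D y → P x y → ν x < ν y := by
  obtain ⟨m, hm, hm1, hm2, hm3⟩ := exists_majorant hB
  obtain ⟨it, hit, it0, its⟩ := exists_iterate hm
  have hself : ∀ b, b ≤ m b := fun b => le_self_add.trans (hm1 b).le
  have mono : ∀ k a b, a ≤ b → it k a ≤ it k b := by
    intro k a b hab
    have hr : Rec 𝒮 (fun k => it k a ≤ it k b) := by fun_prop
    refine set_induction hr (by rwa [it0, it0]) (fun k ih => ?_) k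
    rw [its, its]
    exact hm3 _ _ ih
  have incr : ∀ b k l, k ≤ l → it k b ≤ it l b := by
    intro b k l hkl
    have hr : Rec 𝒮 (fun l => Imp (k ≤ l) (it k b ≤ it l b)) := by fun_prop
    refine set_induction hr (fun h0 => ?_) (fun l ih hkl => ?_) l hkl
    · rw [le_antisymm h0 (num_nonneg k)]
    · rcases eq_or_lt_of_le hkl with rfl | hkl
      · exact le_rfl
      · exact (ih (lt_add_one_iff'.1 hkl)).trans (by rw [its]; exact hself _)
  have comm : ∀ k b, it k (m b) = it (k + 1) b := by
    intro k b
    have hr : Rec 𝒮 (fun k => it k (m b) = it (k + 1) b) := by fun_prop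
    refine set_induction hr ?_ (fun k ih => ?_) k
    · rw [its, it0, it0]
    · rw [its, ih, ← its]
  -- Infinitely many x may share a height, so recursion on h alone would need infinitely many
  -- earlier values at once; ν codes x as well. Each unit of height provides two iterations of m:
  -- one absorbs x ≤ m(y), the other one absorbs the summand x in the comparison of pairs.
  refine ⟨fun x => pair (it (h x + h x) x) x, by fun_prop, fun x => unpairR_pair _ _,
    fun x y hx hy hxy => pair_lt_pair ?_⟩
  refine lt_of_lt_of_le (b := it (h y + h y) y) ?_ le_self_add
  have hxm : x ≤ m y := (hPB x y hx hy hxy).trans (hm2 y)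
  obtain ⟨c, hc⟩ := le_iff_exists_add.1 (add_one_le_of_lt (hP x y hx hy hxy))
  set k := h x + h x + 1 + c + c with hk
  have hyk : h y + h y = k + 1 := by rw [hc, hk]; ring
  have h1 : it (h x + h x) x ≤ it k y := by
    refine (mono _ _ _ hxm).trans ?_
    rw [comm]
    have e : k = h x + h x + 1 + (c + c) := by rw [hk, add_assoc]
    rw [e]
    exact incr _ _ _ le_self_add
  have h2 : x ≤ it k y := by
    refine hxm.trans ?_
    have : m y = it (0 + 1) y := by rw [its, it0]
    rw [this]
    refine incr _ _ _ ?_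
    rw [hk, add_right_comm (h x + h x), add_right_comm (h x + h x + c), zero_add]
    exact le_add_self
  rw [hyk, its]
  exact (add_le_add h1 h2).trans_lt (hm1 _)

end Height

/-! ### Embedding regular termination points into the notation system. -/

section ThetaMap

variable {M : Type*} [CommSemiring M] [LinearOrder M] [IsStrictOrderedRing M]
    [CanonicallyOrderedAdd M] [DiscreteNumbers M] {𝒮 : Set (Set M)} [hS : Fact (ModelsRCA0 𝒮)]

/-- The sequence with entries `Ω` and `0`. -/
def omegaSeq : M := cons tOmega (cons (tSum nil) nil)

/-- The term `ω^s + ω^t`. -/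
def twoSum (s t : M) : M := tSum (cons s (cons t nil))

@[fun_prop]
theorem Rec.twoSum {α : Type*} [Enc M α] {f g : α → M} (hf : Rec 𝒮 f) (hg : Rec 𝒮 g) :
    Rec 𝒮 (fun a => twoSum (f a) (g a)) := by
  unfold InvGoodstein.twoSum; fun_prop

/-- The recursion equations for the function `L` that maps Goodstein terms to sequences of
terms of the notation system, for a given interpretation `f` of the coefficients. -/
structure IsSeqMap (f L : M → M) : Prop where
  map_nil : L nil = omegaSeq
  map_gcons : ∀ γ δ r, L (gcons γ δ r) = cons (twoSum (tSum (L γ)) (f δ)) (L r)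

theorem exists_seqMap {ν : M → M} (hν : Rec 𝒮 ν) : ∃ L : M → M → M,
    Rec 𝒮 (fun q : M × M => L q.1 q.2) ∧ (∀ s, IsSeqMap (fun δ => app s (ν δ)) (L s)) := by
  obtain ⟨L, hL, h⟩ := exists_recursion_two (𝒮 := 𝒮)
    (F := fun g a s => Cond (IsG a) (cons (twoSum (tSum (g (gexp a) s)) (app s (ν (gcoef a))))
      (g (cdr a) s)) omegaSeq) (by unfold omegaSeq; fun_prop)
    (fun g g' a s h => by
      by_cases ha : IsG a
      · rw [h _ _ (add_lt_add_left ha.exp_lt s), h _ _ (add_lt_add_left ha.tail_lt s)]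
      · rw [cond_neg ha, cond_neg ha])
  refine ⟨fun s a => L a s, by fun_prop, fun s => ⟨?_, fun γ δ r => ?_⟩⟩
  · beta_reduce; rw [h]; simp
  · beta_reduce; rw [h]; simp

include hS in
theorem IsSeqMap.congr {X : Ord M} (hX : X.Coded 𝒮) {f f' L L' : M → M} (h : IsSeqMap f L)
    (h' : IsSeqMap f' L') (hL : Rec 𝒮 L) (hL' : Rec 𝒮 L') (hf : Rec 𝒮 f) (hf' : Rec 𝒮 f') {a : M}
    (ha : GMem 𝒮 X a) (hff : ∀ δ, InSupp 𝒮 δ a → f δ = f' δ) : L a = L' a := by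
  have hg := rec_gMem hX
  have hr : Rec 𝒮 (fun a => Imp (GMem 𝒮 X a) (Imp (Ball a fun δ => Imp (InSupp 𝒮 δ a) (f δ = f' δ))
    (L a = L' a))) := by fun_prop
  refine strong_induction hr (fun a ih ha hff => ?_) a ha fun δ _ => hff δ
  rcases gMem_cases hX ha with rfl | ⟨γ, δ, r, rfl, h1, h2⟩
  · rw [h.map_nil, h'.map_nil]
  · rw [h.map_gcons, h'.map_gcons, hff δ (coef_lt_gcons _ _ _) (by simp),
      ih γ (exp_lt_gcons _ _ _) h1 fun δ' hδ hδ' => hff δ' (hδ.trans (exp_lt_gcons _ _ _)) (by simp [hδ']),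
      ih r (tail_lt_gcons _ _ _) h2 fun δ' hδ hδ' => hff δ' (hδ.trans (tail_lt_gcons _ _ _)) (by simp [hδ'])]

/-- The interpretation of a regular termination point in the notation system. -/
structure IsThetaMap (𝒮 : Set (Set M)) (X : Ord M) (A f L ν : M → M) : Prop extends IsSeqMap f L where
  rec_f : Rec 𝒮 f
  rec_L : Rec 𝒮 L
  rec_ν : Rec 𝒮 ν
  decode : ∀ x, unpairR (ν x) = x
  height : ∀ x y, x ∈ X.dom → y ∈ X.dom → InSupp 𝒮 x (A y) → ν x < ν y
  map_eq : ∀ x ∈ X.dom, f x = tTheta (tSum (L (A x)))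

/-- The value f(x) depends on f at the elements of supp(A_x), which have smaller ν. The recursion
therefore runs along the codes n = ν(x), from which x can be decoded, and assigns 0 to all other
numbers. Afterwards L is defined from the finished f. -/
theorem exists_thetaMap {X : Ord M} {A : M → M} (h : IsRegularTerminationPoint 𝒮 X A) :
    ∃ f L ν, IsThetaMap 𝒮 X A f L ν := by
  have ht := h.toIsTerminationPoint
  obtain ⟨B, hB, hBA⟩ := exists_rec_of_codedFun ht.coded.1 ht.coded_seq
  obtain ⟨h0, hh0, hh⟩ := h.height
  obtain ⟨h1, hh1, hh10⟩ := exists_rec_of_codedFun ht.coded.1 hh0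
  have hX := ht.coded.rec_dom
  obtain ⟨ν, hν, hdec, hlt⟩ := exists_decodable_height (𝒮 := 𝒮) (D := fun x => x ∈ X.dom)
    (P := fun x y => InSupp 𝒮 x (A y)) hB hh1
    (fun x y hx hy hxy => by rw [hBA y hy]; exact (lt_of_inSupp hxy).le)
    (fun x y hx hy hxy => by rw [hh10 x hx, hh10 y hy]; exact hh x hx y hy hxy)
  obtain ⟨Lc, hLc, hLc'⟩ := exists_seqMap hν
  have hloc : ∀ n s s', (∀ i < n, app s i = app s' i) → n = ν (unpairR n) → unpairR n ∈ X.dom →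
      Lc s (B (unpairR n)) = Lc s' (B (unpairR n)) := by
    intro n s s' hss hn hnX
    rw [hBA _ hnX]
    have hG := (ht.gMem hnX).1
    refine (hLc' s).congr ht.coded (hLc' s') (by fun_prop) (by fun_prop) (by fun_prop) (by fun_prop)
      hG fun δ hδ => hss _ ?_
    have := hlt δ _ (mem_dom_of_inSupp ht.coded hG hδ) hnX hδ
    rwa [← hn] at this
  have hR : Rec 𝒮 (fun q : M × M × M => q.2.2 = Cond (q.1 = ν (unpairR q.1) ∧ unpairR q.1 ∈ X.dom)
      (tTheta (tSum (Lc q.2.1 (B (unpairR q.1))))) 0) := by fun_prop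
  have key := exists_course_of_values (R := fun n s v => v = Cond (n = ν (unpairR n) ∧ unpairR n ∈ X.dom)
      (tTheta (tSum (Lc s (B (unpairR n))))) 0) hR
    (fun n s s' v hss hv => by
      by_cases hn : n = ν (unpairR n) ∧ unpairR n ∈ X.dom
      · rw [cond_pos hn] at hv ⊢
        rw [hv, hloc n s s' hss hn.1 hn.2]
      · rw [cond_neg hn] at hv ⊢
        exact hv)
    (fun n s _ => ⟨_, rfl⟩)
  obtain ⟨φ, hφ, hφs⟩ := key
  obtain ⟨L, hL, hLe⟩ := exists_recursion (𝒮 := 𝒮)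
    (F := fun g a => Cond (IsG a) (cons (twoSum (tSum (g (gexp a))) (φ (ν (gcoef a))))
      (g (cdr a))) omegaSeq) (by unfold omegaSeq; fun_prop)
    (fun g g' a h => by
      by_cases ha : IsG a
      · rw [h _ ha.exp_lt, h _ ha.tail_lt]
      · rw [cond_neg ha, cond_neg ha])
  have hLm : IsSeqMap (fun x => φ (ν x)) L := ⟨by rw [hLe]; simp, fun γ δ r => by rw [hLe]; simp⟩
  refine ⟨fun x => φ (ν x), L, ν, ⟨hLm, by fun_prop, hL, hν, hdec, hlt, fun x hx => ?_⟩⟩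
  obtain ⟨s, hs, hs'⟩ := hφs (ν x)
  rw [hdec, cond_pos ⟨rfl, hx⟩] at hs'
  rw [hs', hBA x hx]
  have hG := (ht.gMem hx).1
  rw [(hLc' s).congr ht.coded hLm (by fun_prop) hL (by fun_prop) (by fun_prop) hG fun δ hδ =>
    hs _ (hlt δ x (mem_dom_of_inSupp ht.coded hG hδ) hx hδ)]

section

variable {X : Ord M} {A f L ν : M → M}

/-- As ν can be decoded, the induction statement at given codes concerns a single pair (x, y) and no
unbounded quantifier over X. -/
theorem IsThetaMap.induction (hX : X.Coded 𝒮) (hf : IsThetaMap 𝒮 X A f L ν) {p : M → M → Prop}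
    (hp : Rec 𝒮 (fun q : M × M => p q.1 q.2))
    (hs : ∀ x ∈ X.dom, ∀ y ∈ X.dom,
      (∀ x' ∈ X.dom, ∀ y' ∈ X.dom, ν x' + ν y' < ν x + ν y → p x' y') → p x y) :
    ∀ x ∈ X.dom, ∀ y ∈ X.dom, p x y := by
  have h1 := hX.rec_dom
  have h2 := hf.rec_ν
  have hr : Rec 𝒮 (fun q : M × M => Imp (q.1 = ν (unpairR q.1)) (Imp (q.2 = ν (unpairR q.2))
    (Imp (unpairR q.1 ∈ X.dom) (Imp (unpairR q.2 ∈ X.dom) (p (unpairR q.1) (unpairR q.2)))))) := by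
    fun_prop
  intro x hx y hy
  have := strong_induction_two hr (fun i j ih hi hj hiX hjX => ?_) (ν x) (ν y)
    (by simp only [hf.decode]) (by simp only [hf.decode])
    (by simpa only [hf.decode]) (by simpa only [hf.decode])
  · simpa only [hf.decode] using this
  · refine hs _ hiX _ hjX fun x' hx' y' hy' hlt => ?_
    dsimp only at hi hj
    rw [← hi, ← hj] at hlt
    have := ih _ _ hlt (by simp only [hf.decode]) (by simp only [hf.decode])
      (by simpa only [hf.decode]) (by simpa only [hf.decode])
    simpa only [hf.decode] using this

include hS in
theorem IsSeqMap.tOmega_olt (hX : X.Coded 𝒮) (h : IsSeqMap f L) (hL : Rec 𝒮 L) {a : M}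
    (ha : GMem 𝒮 X a) : olt 𝒮 tOmega (tSum (L a)) := by
  have hg := rec_gMem hX
  have hr : Rec 𝒮 (fun a => Imp (GMem 𝒮 X a) (olt 𝒮 tOmega (tSum (L a)))) := by fun_prop
  refine strong_induction hr (fun a ih ha => ?_) a ha
  rcases gMem_cases hX ha with rfl | ⟨γ, δ, r, rfl, h1, h2⟩
  · rw [h.map_nil]
    exact olt_tOmega_tSum.2 ⟨_, _, rfl, Or.inl rfl⟩
  · rw [h.map_gcons]
    exact olt_tOmega_tSum.2 ⟨_, _, rfl, Or.inr (olt_tOmega_tSum.2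
      ⟨_, _, rfl, Or.inr (ih γ (exp_lt_gcons _ _ _) h1)⟩)⟩

include hS in
theorem IsSeqMap.tTheta_olt (hX : X.Coded 𝒮) (h : IsSeqMap f L) (hL : Rec 𝒮 L) {a : M}
    (ha : GMem 𝒮 X a) (s : M) : olt 𝒮 (tTheta s) (tSum (L a)) := by
  have hg := rec_gMem hX
  have hr : Rec 𝒮 (fun a => Imp (GMem 𝒮 X a) (olt 𝒮 (tTheta s) (tSum (L a)))) := by fun_prop
  refine strong_induction hr (fun a ih ha => ?_) a ha
  rcases gMem_cases hX ha with rfl | ⟨γ, δ, r, rfl, h1, h2⟩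
  · rw [h.map_nil]
    exact olt_tTheta_tSum.2 ⟨_, _, rfl, Or.inr olt_tTheta_tOmega⟩
  · rw [h.map_gcons]
    exact olt_tTheta_tSum.2 ⟨_, _, rfl, Or.inr (olt_tTheta_tSum.2
      ⟨_, _, rfl, Or.inr (ih γ (exp_lt_gcons _ _ _) h1)⟩)⟩

include hS in
theorem IsSeqMap.seqLt (hX : X.Coded 𝒮) (h : IsSeqMap f L) (hL : Rec 𝒮 L) (hf : Rec 𝒮 f) {a b : M}
    (ha : GMem 𝒮 X a) (hb : GMem 𝒮 X b)
    (hmono : ∀ x y, InSupp 𝒮 x a → InSupp 𝒮 y b → X.lt x y → olt 𝒮 (f x) (f y))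
    (hab : glex 𝒮 X.lt a b) : oseqLt 𝒮 (L a) (L b) := by
  have hg := rec_gMem hX
  have hXl := hX.rec_lt
  have hlex := isLex_glex hXl
  have hr : Rec 𝒮 (fun q : M × M => Imp (GMem 𝒮 X q.1) (Imp (GMem 𝒮 X q.2) (Imp
    (Ball q.1 fun x => Ball q.2 fun y => Imp (InSupp 𝒮 x q.1) (Imp (InSupp 𝒮 y q.2) (Imp (X.lt x y)
      (olt 𝒮 (f x) (f y))))) (Imp (glex 𝒮 X.lt q.1 q.2) (oseqLt 𝒮 (L q.1) (L q.2)))))) := by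
    fun_prop
  refine strong_induction_two hr (fun a b ih ha hb hmono hab => ?_) a b ha hb
    (fun x _ y _ => hmono x y) hab
  dsimp only at ha hb hmono hab ⊢
  have hmono' : ∀ x y, InSupp 𝒮 x a → InSupp 𝒮 y b → X.lt x y → olt 𝒮 (f x) (f y) :=
    fun x y hx hy => hmono x (lt_of_inSupp hx) y (lt_of_inSupp hy) hx hy
  have ih' : ∀ a' b', a' + b' < a + b → GMem 𝒮 X a' → GMem 𝒮 X b' →
      (∀ x, InSupp 𝒮 x a' → InSupp 𝒮 x a) → (∀ x, InSupp 𝒮 x b' → InSupp 𝒮 x b) →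
      glex 𝒮 X.lt a' b' → oseqLt 𝒮 (L a') (L b') := fun a' b' hab' ha' hb' hsa hsb =>
    ih a' b' hab' ha' hb' fun x _ y _ hx hy => hmono' x y (hsa x hx) (hsb y hy)
  obtain ⟨γ', δ', r', rfl⟩ := hlex.exists_right hab
  obtain ⟨hγ', hδ', hr', -⟩ := (gMem_gcons hX).1 hb
  rw [h.map_gcons]
  rcases gMem_cases hX ha with rfl | ⟨γ, δ, r, rfl, hγ, hr⟩
  · rw [h.map_nil, omegaSeq]
    exact oseqLt_cons_cons.2 (Or.inl (olt_tOmega_tSum.2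
      ⟨_, _, rfl, Or.inr (h.tOmega_olt hX hL hγ')⟩))
  · rw [h.map_gcons, oseqLt_cons_cons, twoSum, twoSum, olt_tSum_tSum, oseqLt_cons_cons]
    rcases hlex.gcons_iff.1 hab with h1 | ⟨rfl, h1 | ⟨rfl, h1⟩⟩
    · refine Or.inl (Or.inl (olt_tSum_tSum.2 (ih' _ _ (add_lt_add (exp_lt_gcons _ _ _)
        (exp_lt_gcons _ _ _)) hγ hγ' (fun x hx => by simp [hx]) (fun x hx => by simp [hx]) h1)))
    · refine Or.inl (Or.inr ⟨rfl, oseqLt_cons_cons.2 (Or.inl ?_)⟩)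
      exact hmono' _ _ (by simp) (by simp) h1
    · refine Or.inr ⟨rfl, ih' _ _ (add_lt_add (tail_lt_gcons _ _ _)
        (tail_lt_gcons _ _ _)) hr hr' (fun x hx => by simp [hx]) (fun x hx => by simp [hx]) h1⟩

include hS in
-- Terms of the form ϑ(σ) enter the sequence only as values f(δ) of coefficients; the closing
-- entries Ω and 0 contribute nothing to E.
theorem IsSeqMap.exists_of_memE (hX : X.Coded 𝒮) (h : IsSeqMap f L) (hL : Rec 𝒮 L) (hf : Rec 𝒮 f)
    {a e : M} (ha : GMem 𝒮 X a) (hθ : ∀ z ∈ X.dom, ∃ s, f z = tTheta s)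
    (he : oseqMemE 𝒮 e (L a)) : ∃ z, InSupp 𝒮 z a ∧ e = f z := by
  have hg := rec_gMem hX
  have hr : Rec 𝒮 (fun a => Imp (GMem 𝒮 X a) (Imp (oseqMemE 𝒮 e (L a))
    (Bex a fun z => InSupp 𝒮 z a ∧ e = f z))) := by fun_prop
  suffices hs : Bex a fun z => InSupp 𝒮 z a ∧ e = f z by
    obtain ⟨z, -, hz⟩ := hs
    exact ⟨z, hz⟩
  refine strong_induction hr (fun a ih ha he => ?_) a ha he
  rcases gMem_cases hX ha with rfl | ⟨γ, δ, r, rfl, hγ, hr⟩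
  · rw [h.map_nil, omegaSeq] at he
    simp at he
  · obtain ⟨s, hs⟩ := hθ δ ((gMem_gcons hX).1 ha).2.1
    rw [h.map_gcons, oseqMemE_cons, twoSum, omemE_tSum, oseqMemE_cons, oseqMemE_cons, omemE_tSum, hs,
      omemE_tTheta] at he
    rcases he with (he | he | he) | he
    · obtain ⟨d, hd, hd', rfl⟩ := ih _ (exp_lt_gcons _ _ _) hγ he
      exact ⟨d, hd.trans (exp_lt_gcons _ _ _), by simp [hd'], rfl⟩
    · exact ⟨δ, coef_lt_gcons _ _ _, by simp, by rw [hs, he]⟩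
    · exact absurd he not_oseqMemE_nil
    · obtain ⟨d, hd, hd', rfl⟩ := ih _ (tail_lt_gcons _ _ _) hr he
      exact ⟨d, hd.trans (tail_lt_gcons _ _ _), by simp [hd'], rfl⟩

variable (h : IsTerminationPoint 𝒮 X A) (hf : IsThetaMap 𝒮 X A f L ν)
include h hf

/-- For x < y the second clause for ϑ applies. The arguments compare since A_x < A_y and f is
monotone on the supports. Elements of E are values f(z) with z ∈ supp(A_x), and then z < x < y. In
both cases the heights have decreased. -/
theorem IsThetaMap.mono : ∀ x ∈ X.dom, ∀ y ∈ X.dom, X.lt x y → olt 𝒮 (f x) (f y) := by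
  have h1 := hf.rec_f
  have h2 := h.coded.rec_lt
  have hr : Rec 𝒮 (fun q : M × M => Imp (X.lt q.1 q.2) (olt 𝒮 (f q.1) (f q.2))) := by fun_prop
  refine hf.induction h.coded (p := fun x y => Imp (X.lt x y) (olt 𝒮 (f x) (f y))) hr
    fun x hx y hy ih hxy => ?_
  have hGx := h.gMem hx
  have hGy := h.gMem hy
  have hdx : ∀ z, InSupp 𝒮 z (A x) → z ∈ X.dom ∧ ν z < ν x := fun z hz => by
    have := mem_dom_of_inSupp h.coded hGx.1 hz
    exact ⟨this, hf.height z x this hx hz⟩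
  have hdy : ∀ z, InSupp 𝒮 z (A y) → z ∈ X.dom ∧ ν z < ν y := fun z hz => by
    have := mem_dom_of_inSupp h.coded hGy.1 hz
    exact ⟨this, hf.height z y this hy hz⟩
  rw [hf.map_eq x hx, hf.map_eq y hy]
  refine olt_tTheta_tTheta.2 (Or.inr ⟨olt_tSum_tSum.2 ?_, fun e he => ?_⟩)
  · refine hf.seqLt h.coded hf.rec_L hf.rec_f hGx.1 hGy.1 (fun z w hz hw hzw => ?_) (h.mono hx hy hxy)
    exact ih z (hdx z hz).1 w (hdy w hw).1 (add_lt_add (hdx z hz).2 (hdy w hw).2) hzw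
  · rw [omemE_tSum] at he
    obtain ⟨z, hz, rfl⟩ := hf.exists_of_memE h.coded hf.rec_L hf.rec_f hGx.1
      (fun z hz => ⟨_, hf.map_eq z hz⟩) he
    have := ih z (hdx z hz).1 y hy (add_lt_add_left (hdx z hz).2 _)
      (h.linear.trans z (hdx z hz).1 x hx y hy (hGx.2 z hz) hxy)
    rwa [hf.map_eq y hy] at this

/-- The closing entries Ω and 0 guarantee at least two entries, so the excluded sums with a single
exponent never arise. They also put every such sum above Ω and above all ϑ(σ), which makes the
exponents ω^Λ(γ) + ω^f(δ) weakly descending. -/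
theorem IsThetaMap.isSeq {a : M} (ha : GMem 𝒮 X a) (hz : ∀ z, InSupp 𝒮 z a → IsTerm 𝒮 (f z)) :
    IsSeq 𝒮 (L a) ∧ ∀ γ, L a ≠ cons γ nil := by
  have h1 := hf.rec_f
  have h2 := hf.rec_L
  have h3 := rec_gMem h.coded
  have hr : Rec 𝒮 (fun a => Imp (GMem 𝒮 X a) (Imp (Ball a fun z => Imp (InSupp 𝒮 z a) (IsTerm 𝒮 (f z)))
    (IsSeq 𝒮 (L a) ∧ IsCons (L a) ∧ IsCons (cdr (L a))))) := by fun_prop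
  have key : IsSeq 𝒮 (L a) ∧ IsCons (L a) ∧ IsCons (cdr (L a)) := by
    refine strong_induction hr (fun a ih ha hz => ?_) a ha fun z _ => hz z
    rcases gMem_cases h.coded ha with rfl | ⟨γ, δ, r, rfl, hγ, hr'⟩
    · rw [hf.map_nil, omegaSeq]
      refine ⟨?_, by simp, by simp⟩
      have h0 : IsTerm 𝒮 (tSum nil : M) := isTerm_tSum.2 ⟨isSeq_nil, by simp⟩
      refine isSeq_cons.2 ⟨isTerm_tOmega, isSeq_cons.2 ⟨h0, isSeq_nil, by simp⟩, fun b k e => ?_⟩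
      rw [cons_inj] at e
      rw [← e.1]
      exact Or.inr (olt_tSum_tOmega.2 (by simp))
    · obtain ⟨s1, s2, s3⟩ := ih γ (exp_lt_gcons _ _ _) hγ fun z hz' hz'' =>
        hz z (hz'.trans (exp_lt_gcons _ _ _)) (by simp [hz''])
      obtain ⟨r1, r2, r3⟩ := ih r (tail_lt_gcons _ _ _) hr' fun z hz' hz'' =>
        hz z (hz'.trans (tail_lt_gcons _ _ _)) (by simp [hz''])
      obtain ⟨-, hδ, -, hdesc⟩ := (gMem_gcons h.coded).1 ha
      rw [hf.map_gcons]
      refine ⟨?_, by simp, by simpa using r2⟩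
      have hs1 : IsTerm 𝒮 (tSum (L γ)) := isTerm_tSum.2 ⟨s1, fun γ' e => by simp [e] at s3⟩
      refine isSeq_cons.2 ⟨isTerm_tSum.2 ⟨isSeq_cons.2 ⟨hs1, isSeq_cons.2
        ⟨hz δ (coef_lt_gcons _ _ _) (by simp), isSeq_nil, by simp⟩, fun b k e => ?_⟩, by simp⟩, r1,
        fun b k e => ?_⟩
      · rw [cons_inj] at e
        rw [← e.1, hf.map_eq δ hδ]
        exact Or.inr (hf.tTheta_olt h.coded h2 hγ _)
      · rcases gMem_cases h.coded hr' with rfl | ⟨γ', δ', r', rfl, hγ', -⟩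
        · rw [hf.map_nil, omegaSeq, cons_inj] at e
          rw [← e.1]
          exact Or.inr (olt_tOmega_tSum.2 ⟨_, _, rfl, Or.inr (hf.tOmega_olt h.coded h2 hγ)⟩)
        · rw [hf.map_gcons, cons_inj] at e
          rw [← e.1]
          refine Or.inr (olt_tSum_tSum.2 (oseqLt_cons_cons.2 (Or.inl (olt_tSum_tSum.2 ?_))))
          exact hf.seqLt h.coded h2 h1 hγ' hγ (fun x y hx hy => hf.mono h x
            (mem_dom_of_inSupp h.coded hγ' hx) y (mem_dom_of_inSupp h.coded hγ hy)) (hdesc _ _ _ rfl)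
  refine ⟨key.1, fun γ e => ?_⟩
  simp [e] at key

theorem IsThetaMap.isTerm : ∀ x ∈ X.dom, IsTerm 𝒮 (f x) := by
  have h1 := hf.rec_f
  have hr : Rec 𝒮 (fun q : M × M => IsTerm 𝒮 (f q.1)) := by fun_prop
  intro x hx
  refine hf.induction h.coded (p := fun x y => IsTerm 𝒮 (f x)) hr (fun x hx y hy ih => ?_) x hx x hx
  rw [hf.map_eq x hx, isTerm_tTheta, isTerm_tSum]
  obtain ⟨h2, h3⟩ := hf.isSeq h (h.gMem hx).1 fun z hz => by
    have hzX := mem_dom_of_inSupp h.coded (h.gMem hx).1 hz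
    exact ih z hzX y hy (add_lt_add_left (hf.height z x hzX hx hz) _)
  exact ⟨h2, fun γ e => absurd e (h3 γ)⟩

end

theorem embeds_bachmannHoward {X : Ord M} {A : M → M} (h : IsRegularTerminationPoint 𝒮 X A) :
    X.Embeds 𝒮 (bachmannHoward 𝒮) := by
  obtain ⟨f, L, ν, hf⟩ := exists_thetaMap h
  have ht := h.toIsTerminationPoint
  refine embeds_of_mono ht.coded ht.linear (fun a ha b hb hab hba => ?_) hf.rec_f (fun a ha => ?_)
    fun a ha b hb hab => ?_
  · rw [bachmannHoward_lt_iff] at hab hba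
    exact olt_asymm hab.1 hab.2.1 hab.2.2 hba.2.2
  · rw [mem_bachmannHoward_iff]
    refine ⟨hf.isTerm ht a ha, ?_⟩
    rw [hf.map_eq a ha]
    exact olt_tTheta_tOmega
  · rw [bachmannHoward_lt_iff]
    exact ⟨hf.isTerm ht a ha, hf.isTerm ht b hb, hf.mono ht a ha b hb hab⟩

end ThetaMap

/-! ### Well founded termination points are strong. -/

section WellFounded

variable {M : Type*} [CommSemiring M] [LinearOrder M] [IsStrictOrderedRing M]
    [CanonicallyOrderedAdd M] [DiscreteNumbers M] {𝒮 : Set (Set M)} [hS : Fact (ModelsRCA0 𝒮)]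

theorem univ_mem_model : (Set.univ : Set M) ∈ 𝒮 := by
  have h : Rec 𝒮 (fun _ : M => True) := by fun_prop
  convert h.mem
  ext; simp

/-- Nonempty bounded subsets of a linear order have a greatest element. -/
theorem exists_greatest {X : Ord M} (hX : X.Coded 𝒮) (hl : X.IsLinear) {p : M → Prop}
    (hp : Rec 𝒮 p) (hd : ∀ w, p w → w ∈ X.dom) (n : M) (hn : ∃ w < n, p w) :
    ∃ m < n, p m ∧ ∀ w < n, p w → w = m ∨ X.lt w m := by
  have hlt := hX.rec_lt
  have hr : Rec 𝒮 (fun n => Imp (Bex n p) (Bex n fun m => p m ∧ Ball n fun w => Imp (p w)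
      (w = m ∨ X.lt w m))) := by
    have hlt' : Rec 𝒮 (fun a : (M × M) × M => X.lt a.2 a.1.2) :=
      hlt.comp (f := fun q : M × M => X.lt q.1 q.2) (g := fun a : (M × M) × M => (a.2, a.1.2))
        (by fun_prop)
    fun_prop
  refine set_induction hr (fun ⟨w, hw, _⟩ => absurd hw (not_lt.2 (num_nonneg w)))
    (fun n ih ⟨w, hw, hpw⟩ => ?_) n hn
  by_cases h : ∃ w < n, p w
  · obtain ⟨m, hm, hpm, hmax⟩ := ih h
    by_cases hpn : p n
    · rcases hl.trichotomy n (hd n hpn) m (hd m hpm) with h1 | h1 | h1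
      · refine ⟨m, hm.trans (lt_add_one_iff'.2 le_rfl), hpm, fun w hw hpw => ?_⟩
        rcases eq_or_lt_of_le (lt_add_one_iff'.1 hw) with rfl | hw
        · exact Or.inr h1
        · exact hmax w hw hpw
      · exact absurd h1.symm hm.ne
      · refine ⟨n, lt_add_one_iff'.2 le_rfl, hpn, fun w hw hpw => ?_⟩
        rcases eq_or_lt_of_le (lt_add_one_iff'.1 hw) with rfl | hw
        · exact Or.inl rfl
        · rcases hmax w hw hpw with rfl | h2
          · exact Or.inr h1
          · exact Or.inr (hl.trans w (hd w hpw) m (hd m hpm) n (hd n hpn) h2 h1)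
    · refine ⟨m, hm.trans (lt_add_one_iff'.2 le_rfl), hpm, fun w hw hpw => ?_⟩
      rcases eq_or_lt_of_le (lt_add_one_iff'.1 hw) with rfl | hw
      · exact absurd hpw hpn
      · exact hmax w hw hpw
  · rcases eq_or_lt_of_le (lt_add_one_iff'.1 hw) with rfl | hw
    · refine ⟨w, lt_add_one_iff'.2 le_rfl, hpw, fun v hv hpv => ?_⟩
      rcases eq_or_lt_of_le (lt_add_one_iff'.1 hv) with rfl | hv
      · exact Or.inl rfl
      · exact absurd ⟨v, hv, hpv⟩ h
    · exact absurd ⟨w, hw, hpw⟩ h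

/-- Nonempty subsets of a well founded linear order have a least element. -/
theorem Ord.WellFounded.exists_minimum {X : Ord M} (hw : X.WellFounded 𝒮) (hX : X.Coded 𝒮)
    (hl : X.IsLinear) {p : M → Prop} (hp : Rec 𝒮 p) (h : ∃ x ∈ X.dom, p x) :
    ∃ x ∈ X.dom, p x ∧ ∀ z ∈ X.dom, p z → X.le x z := by
  by_contra hno
  have hlt := hX.rec_lt
  have hdom := hX.rec_dom
  have hr : Rec 𝒮 (fun q : M × M => Imp (q.1 ∈ X.dom ∧ p q.1)
      ((q.2 ∈ X.dom ∧ p q.2) ∧ X.lt q.2 q.1)) := by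
    have hlt' : Rec 𝒮 (fun a : M × M => X.lt a.2 a.1) :=
      hlt.comp (f := fun q : M × M => X.lt q.1 q.2) (g := fun a : M × M => (a.2, a.1))
        (by fun_prop)
    fun_prop
  -- If there is no least element, search always finds a smaller one. Iterating this produces a
  -- descending sequence in the model.
  obtain ⟨g, hg, hgs⟩ := Rec.exists_search (r := fun a b => Imp (a ∈ X.dom ∧ p a)
      ((b ∈ X.dom ∧ p b) ∧ X.lt b a)) hr (fun a => by
    by_cases ha : a ∈ X.dom ∧ p a
    · by_contra hc
      refine hno ⟨a, ha.1, ha.2, fun z hz hpz => ?_⟩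
      rcases hl.trichotomy a ha.1 z hz with h1 | h1 | h1
      · exact Or.inr h1
      · exact Or.inl h1
      · exact absurd ⟨z, fun _ => ⟨⟨hz, hpz⟩, h1⟩⟩ hc
    · exact ⟨0, fun h => absurd h ha⟩)
  obtain ⟨it, hit, it0, its⟩ := exists_iterate hg
  obtain ⟨x, hx, hpx⟩ := h
  have hmem : ∀ n, it n x ∈ X.dom ∧ p (it n x) := by
    have hr' : Rec 𝒮 (fun n => it n x ∈ X.dom ∧ p (it n x)) := by fun_prop
    refine set_induction hr' (by rw [it0]; exact ⟨hx, hpx⟩) (fun n ih => ?_)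
    rw [its]
    exact (hgs _ ih).1
  have hrec : Rec 𝒮 (fun n => it n x) := by fun_prop
  refine hw ⟨fun n => it n x, hrec.codedFun univ_mem_model, fun n => (hmem n).1, fun n => ?_⟩
  simp only [its]
  exact (hgs _ (hmem n)).2

/-- In a well founded order, finite sets of predecessors give rise to a height function. -/
theorem Ord.WellFounded.exists_height {X : Ord M} (hw : X.WellFounded 𝒮) (hX : X.Coded 𝒮)
    (hl : X.IsLinear) {B : M → M} (hB : Rec 𝒮 B)
    (hBX : ∀ y ∈ X.dom, ∀ z, InSupp 𝒮 z (B y) → z ∈ X.dom ∧ X.lt z y) :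
    ∃ h : M → M, Rec 𝒮 h ∧ ∀ y ∈ X.dom, ∀ x, InSupp 𝒮 x (B y) → h x < h y := by
  have hlt : ∀ {α : Type _} [Enc M α] {f g : α → M}, Rec 𝒮 f → Rec 𝒮 g →
      Rec 𝒮 (fun a => X.lt (f a) (g a)) := fun hf hg => hX.rec_lt.comp (hf.prodMk hg)
  have hdom := hX.rec_dom
  -- candidates for the next element of a descending enumeration with history `σ`
  let P : M → M → Prop := fun σ w => InSupp 𝒮 w σ ∧ w ∈ X.dom ∧ X.lt w (gcoef σ)
  have hP : Rec 𝒮 (fun q : M × M => P q.1 q.2) := by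
    have := hlt (f := fun q : M × M => q.2) (g := fun q : M × M => gcoef q.1) (by fun_prop)
      (by fun_prop)
    fun_prop
  have hPlt : ∀ {σ w}, P σ w → w < σ := fun h => lt_of_inSupp h.1
  have hr : Rec 𝒮 (fun q : M × M => Imp (Bex q.1 (fun w => P q.1 w)) (P q.1 q.2 ∧
      Ball q.1 fun w => Imp (P q.1 w) (w = q.2 ∨ X.lt w q.2))) := by
    have := hlt (f := fun q : (M × M) × M => q.2) (g := fun q : (M × M) × M => q.1.2) (by fun_prop)
      (by fun_prop)
    fun_prop
  obtain ⟨sel, hsel, hsels⟩ := Rec.exists_search (r := fun σ v => Imp (Bex σ (fun w => P σ w))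
      (P σ v ∧ Ball σ fun w => Imp (P σ w) (w = v ∨ X.lt w v))) hr (fun σ => by
    by_cases h : ∃ w < σ, P σ w
    · have hPσ : Rec 𝒮 (fun w => P σ w) := by fun_prop
      obtain ⟨m, -, hm, hmax⟩ := exists_greatest hX hl hPσ (fun w hw => hw.2.1) σ h
      exact ⟨m, fun _ => ⟨hm, hmax⟩⟩
    · exact ⟨0, fun h' => absurd h' h⟩)
  let Act : M → Prop := fun σ => Bex σ (fun w => P σ w)
  have hAct : Rec 𝒮 Act := by
    show Rec 𝒮 (fun σ => Bex σ (fun w => P σ w))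
    fun_prop
  have act_of : ∀ {σ w}, P σ w → Act σ := fun h => ⟨_, hPlt h, h⟩
  -- The hereditary closure of supports is explored in descending order. The state σ is coded as a
  -- Goodstein term: its support is the set of elements found so far, its leading coefficient is the
  -- element visited last. A step visits the greatest found element below the latter and adds the
  -- support of its B-value.
  let step : M → M := fun σ => Cond (Act σ) (gcons σ (sel σ) (B (sel σ))) σ
  have hstep : Rec 𝒮 step := by
    show Rec 𝒮 (fun σ => Cond (Act σ) (gcons σ (sel σ) (B (sel σ))) σ)
    fun_prop
  obtain ⟨it, hit, it0, its⟩ := exists_iterate hstep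
  let s : M → M → M := fun n y => it n (gcons nil y (B y))
  have hs : Rec 𝒮 (fun q : M × M => s q.1 q.2) := by
    show Rec 𝒮 (fun q : M × M => it q.1 (gcons nil q.2 (B q.2)))
    fun_prop
  have s0 : ∀ y, s 0 y = gcons nil y (B y) := fun y => it0 _
  have ss : ∀ n y, Act (s n y) → s (n + 1) y = gcons (s n y) (sel (s n y)) (B (sel (s n y))) :=
    fun n y h => (its _ _).trans (cond_pos h _ _)
  have ss' : ∀ n y, ¬ Act (s n y) → s (n + 1) y = s n y :=
    fun n y h => (its _ _).trans (cond_neg h _ _)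
  have selP : ∀ {σ}, Act σ → P σ (sel σ) := fun h => (hsels _ h).1
  have sel_max : ∀ {σ w}, P σ w → w = sel σ ∨ X.lt w (sel σ) :=
    fun h => (hsels _ (act_of h)).2 _ (hPlt h) h
  have top : ∀ n y, Act (s n y) → gcoef (s (n + 1) y) = sel (s n y) := fun n y h => by
    rw [ss n y h]; simp
  have top_mem : ∀ n y, y ∈ X.dom → gcoef (s n y) ∈ X.dom := by
    intro n y hy
    have hr : Rec 𝒮 (fun n => gcoef (s n y) ∈ X.dom) := by fun_prop
    refine set_induction hr (by rw [s0]; simpa using hy) (fun n ih => ?_) n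
    by_cases h : Act (s n y)
    · rw [top n y h]; exact (selP h).2.1
    · rwa [ss' n y h]
  have inSucc : ∀ n y z, Act (s n y) → (InSupp 𝒮 z (s (n + 1) y) ↔
      InSupp 𝒮 z (s n y) ∨ z = sel (s n y) ∨ InSupp 𝒮 z (B (sel (s n y)))) := by
    intro n y z h
    rw [ss n y h, inSupp_gcons]
  have supp_mem : ∀ n y, y ∈ X.dom → ∀ z, InSupp 𝒮 z (s n y) → z ∈ X.dom := by
    intro n y hy z
    have hr : Rec 𝒮 (fun n => Imp (InSupp 𝒮 z (s n y)) (z ∈ X.dom)) := by fun_prop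
    refine set_induction hr (fun h => ?_) (fun n ih h => ?_) n
    · rw [s0, inSupp_gcons] at h
      rcases h with h | rfl | h
      · exact absurd h not_inSupp_nil
      · exact hy
      · exact (hBX y hy z h).1
    · by_cases ha : Act (s n y)
      · rcases (inSucc n y z ha).1 h with h | rfl | h
        · exact ih h
        · exact (selP ha).2.1
        · exact (hBX _ (selP ha).2.1 z h).1
      · rw [ss' n y ha] at h; exact ih h
  have supp_mono : ∀ n m y z, n ≤ m → InSupp 𝒮 z (s n y) → InSupp 𝒮 z (s m y) := by
    intro n m y z hnm hz
    have hr : Rec 𝒮 (fun m => Imp (n ≤ m) (InSupp 𝒮 z (s m y))) := by fun_prop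
    refine set_induction hr (fun h => ?_) (fun m ih h => ?_) m hnm
    · rwa [← le_antisymm h (num_nonneg n)]
    · rcases eq_or_lt_of_le h with rfl | h
      · exact hz
      · have := ih (lt_add_one_iff'.1 h)
        by_cases ha : Act (s m y)
        · exact (inSucc m y z ha).2 (Or.inl this)
        · rwa [ss' m y ha]
  have top_anti : ∀ n y, y ∈ X.dom → gcoef (s (n + 1) y) = gcoef (s n y) ∨
      X.lt (gcoef (s (n + 1) y)) (gcoef (s n y)) := by
    intro n y hy
    by_cases ha : Act (s n y)
    · rw [top n y ha]; exact Or.inr (selP ha).2.2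
    · rw [ss' n y ha]; exact Or.inl rfl
  have top_le : ∀ n m y, y ∈ X.dom → n ≤ m → gcoef (s m y) = gcoef (s n y) ∨
      X.lt (gcoef (s m y)) (gcoef (s n y)) := by
    intro n m y hy hnm
    have hr : Rec 𝒮 (fun m => Imp (n ≤ m) (gcoef (s m y) = gcoef (s n y) ∨
        X.lt (gcoef (s m y)) (gcoef (s n y)))) := by
      have := hlt (f := fun m : M => gcoef (s m y)) (g := fun m : M => gcoef (s n y)) (by fun_prop)
        (by fun_prop)
      fun_prop
    refine set_induction hr (fun h => ?_) (fun m ih h => ?_) m hnm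
    · rw [le_antisymm h (num_nonneg n)]; exact Or.inl rfl
    · rcases eq_or_lt_of_le h with rfl | h
      · exact Or.inl rfl
      · rcases ih (lt_add_one_iff'.1 h) with h1 | h1
        · rw [← h1]; exact top_anti m y hy
        · rcases top_anti m y hy with h2 | h2
          · rw [h2]; exact Or.inr h1
          · exact Or.inr (hl.trans _ (top_mem _ _ hy) _ (top_mem _ _ hy) _ (top_mem _ _ hy) h2 h1)
  -- Nothing is skipped: elements found later are below elements visited later, so the element
  -- visited next bounds everything below the current one that will ever be found.
  have enum_le : ∀ n m y w, y ∈ X.dom → n ≤ m → InSupp 𝒮 w (s m y) → X.lt w (gcoef (s n y)) →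
      w = gcoef (s (n + 1) y) ∨ X.lt w (gcoef (s (n + 1) y)) := by
    intro n m y w hy hnm hw hwn
    have hwX := supp_mem m y hy w hw
    have hr : Rec 𝒮 (fun m => Imp (n ≤ m) (Imp (InSupp 𝒮 w (s m y))
        (w = gcoef (s (n + 1) y) ∨ X.lt w (gcoef (s (n + 1) y))))) := by
      fun_prop
    have base : InSupp 𝒮 w (s n y) → w = gcoef (s (n + 1) y) ∨ X.lt w (gcoef (s (n + 1) y)) := by
      intro h
      have hPw : P (s n y) w := ⟨h, hwX, hwn⟩
      rw [top n y (act_of hPw)]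
      exact sel_max hPw
    refine set_induction hr (fun h hw => ?_) (fun m ih h hw => ?_) m hnm hw
    · refine base ?_
      rwa [le_antisymm h (num_nonneg n)]
    · rcases eq_or_lt_of_le h with rfl | h
      · exact base hw
      · have hnm := lt_add_one_iff'.1 h
        by_cases ha : Act (s m y)
        · have hle := top_le (n + 1) (m + 1) y hy (by gcongr)
          rw [top m y ha] at hle
          rcases (inSucc m y w ha).1 hw with hw | rfl | hw
          · exact ih hnm hw
          · exact hle
          · have h1 := (hBX _ (selP ha).2.1 w hw).2
            rcases hle with h2 | h2
            · rw [← h2]; exact Or.inr h1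
            · exact Or.inr (hl.trans _ hwX _ (selP ha).2.1 _ (top_mem _ _ hy) h1 h2)
        · rw [ss' m y ha] at hw
          exact ih hnm hw
  -- Found elements that are not below the current one have been visited, so their supports are
  -- already included.
  have closed : ∀ n y z w, y ∈ X.dom → InSupp 𝒮 z (s n y) → ¬ X.lt z (gcoef (s n y)) →
      InSupp 𝒮 w (B z) → InSupp 𝒮 w (s n y) := by
    intro n y z w hy hz hzt hw
    have hr : Rec 𝒮 (fun n => Imp (InSupp 𝒮 z (s n y)) (Imp (¬ X.lt z (gcoef (s n y)))
        (InSupp 𝒮 w (s n y)))) := by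
      have := hlt (f := fun m : M => z) (g := fun m : M => gcoef (s m y)) (by fun_prop)
        (by fun_prop)
      fun_prop
    refine set_induction hr (fun hz hzt => ?_) (fun n ih hz hzt => ?_) n hz hzt
    · rw [s0, inSupp_gcons] at hz ⊢
      rw [s0, gcoef_gcons] at hzt
      rcases hz with hz | rfl | hz
      · exact absurd hz not_inSupp_nil
      · exact Or.inr (Or.inr hw)
      · exact absurd (hBX y hy z hz).2 hzt
    · by_cases ha : Act (s n y)
      · rw [top n y ha] at hzt
        refine (inSucc n y w ha).2 ?_
        by_cases hzs : z = sel (s n y)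
        · rw [← hzs]; exact Or.inr (Or.inr hw)
        rcases (inSucc n y z ha).1 hz with h | h | h
        · refine Or.inl (ih h fun hlt => ?_)
          rcases sel_max ⟨h, supp_mem n y hy z h, hlt⟩ with h1 | h1
          · exact hzs h1
          · exact hzt h1
        · exact absurd h hzs
        · exact absurd (hBX _ (selP ha).2.1 z h).2 hzt
      · rw [ss' n y ha] at hz hzt ⊢
        exact ih hz hzt
  -- The visited elements strictly descend as long as the process is active, so well foundedness
  -- makes it stop. The number of steps is the height.
  have exists_inactive : ∀ y, ∃ n, Imp (y ∈ X.dom) (¬ Act (s n y)) := by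
    intro y
    by_cases hy : y ∈ X.dom
    · by_contra hno
      have hact : ∀ n, Act (s n y) := fun n => by
        by_contra h
        exact hno ⟨n, fun _ => h⟩
      have hrec : Rec 𝒮 (fun n => gcoef (s n y)) := by fun_prop
      refine hw ⟨fun n => gcoef (s n y), hrec.codedFun univ_mem_model,
        fun n => top_mem n y hy, fun n => ?_⟩
      simp only [top n y (hact n)]
      exact (selP (hact n)).2.2
    · exact ⟨0, fun h => absurd h hy⟩
  have rec_inactive : Rec 𝒮 (fun q : M × M => Imp (q.1 ∈ X.dom) (¬ Act (s q.2 q.1))) := by fun_prop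
  obtain ⟨N, hN, hNs⟩ := Rec.exists_least (r := fun y n => Imp (y ∈ X.dom) (¬ Act (s n y)))
    rec_inactive exists_inactive
  refine ⟨N, hN, fun y hy x hx => ?_⟩
  have hxX := (hBX y hy x hx).1
  have inactive_N := (hNs y).1 hy
  have act_x : ∀ j < N x, Act (s j x) := fun j hj => by
    by_contra h
    exact (hNs x).2 j hj (fun _ => h)
  have act_le : ∀ n ≤ N y, ∀ w, InSupp 𝒮 w (s (N y) y) → X.lt w (gcoef (s n y)) → n < N y := by
    intro n hn w hw hwn
    refine lt_of_le_of_ne hn ?_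
    rintro rfl
    exact inactive_N (act_of ⟨hw, supp_mem _ y hy w hw, hwn⟩)
  have cl : ∀ z w, InSupp 𝒮 z (s (N y) y) → InSupp 𝒮 w (B z) → InSupp 𝒮 w (s (N y) y) :=
    fun z w hz hw => closed _ y z w hy hz
      (fun h => inactive_N (act_of ⟨hz, supp_mem _ y hy z hz, h⟩)) hw
  have hx0 : InSupp 𝒮 x (s (N y) y) := supp_mono 0 _ y x (num_nonneg _) (by
    rw [s0, inSupp_gcons]; exact Or.inr (Or.inr hx))
  have hxy : X.lt x (gcoef (s 0 y)) := by rw [s0, gcoef_gcons]; exact (hBX y hy x hx).2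
  -- The run from x is compared with the run from y, shifted by one step. All elements found from x
  -- belong to the final set of y, and the element visited at time j from x is at most the one
  -- visited at time j + 1 from y. Hence the run from y is still active at time j.
  have key : ∀ j, Imp (j ≤ N x) ((Ball (s j x) fun w => Imp (InSupp 𝒮 w (s j x))
      (InSupp 𝒮 w (s (N y) y))) ∧ j < N y ∧ (gcoef (s j x) = gcoef (s (j + 1) y) ∨
        X.lt (gcoef (s j x)) (gcoef (s (j + 1) y)))) := by
    have hr : Rec 𝒮 (fun j => Imp (j ≤ N x) ((Ball (s j x) fun w => Imp (InSupp 𝒮 w (s j x))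
      (InSupp 𝒮 w (s (N y) y))) ∧ j < N y ∧ (gcoef (s j x) = gcoef (s (j + 1) y) ∨
        X.lt (gcoef (s j x)) (gcoef (s (j + 1) y))))) := by
      have := hlt (f := fun j : M => gcoef (s j x)) (g := fun j : M => gcoef (s (j + 1) y))
        (by fun_prop) (by fun_prop)
      fun_prop
    refine set_induction hr (fun _ => ⟨fun w _ hw => ?_, act_le 0 (num_nonneg _) x hx0 hxy, ?_⟩)
      (fun j ih hj => ?_)
    · rw [s0, inSupp_gcons] at hw
      rcases hw with hw | rfl | hw
      · exact absurd hw not_inSupp_nil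
      · exact hx0
      · exact cl x w hx0 hw
    · rw [s0 x, gcoef_gcons]
      exact enum_le 0 _ y x hy (num_nonneg _) hx0 hxy
    · have hj' : j < N x := (lt_add_one_iff'.2 le_rfl).trans_le hj
      obtain ⟨h1, h2, h3⟩ := ih hj'.le
      have ha := act_x j hj'
      have hP' := selP ha
      have hw1 := h1 _ (hPlt hP') hP'.1
      have hw2 : X.lt (sel (s j x)) (gcoef (s (j + 1) y)) := by
        rcases h3 with h3 | h3
        · rw [← h3]; exact hP'.2.2
        · exact hl.trans _ hP'.2.1 _ (top_mem _ _ hxX) _ (top_mem _ _ hy) hP'.2.2 h3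
      have hle := add_one_le_of_lt h2
      refine ⟨fun w _ hw => ?_, act_le _ hle _ hw1 hw2, ?_⟩
      · rcases (inSucc j x w ha).1 hw with hw | rfl | hw
        · exact h1 w (lt_of_inSupp hw) hw
        · exact hw1
        · exact cl _ w hw1 hw
      · rw [top j x ha]
        exact enum_le _ _ y _ hy hle hw1 hw2
  exact (key (N x) le_rfl).2.1

/-- Well founded termination points are strong. -/
theorem IsTerminationPoint.isStrong {X : Ord M} {A : M → M} (h : IsTerminationPoint 𝒮 X A)
    (hw : X.WellFounded 𝒮) : IsStrongTerminationPoint 𝒮 X A := by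
  have hX := h.coded
  have hl := h.linear
  have hlt := hX.rec_lt
  have hdom := hX.rec_dom
  obtain ⟨B, hB, hBA⟩ := exists_rec_of_codedFun hX.1 h.coded_seq
  have hBX : ∀ y ∈ X.dom, ∀ z, InSupp 𝒮 z (B y) → z ∈ X.dom ∧ X.lt z y := by
    intro y hy z hz
    rw [hBA y hy] at hz
    exact ⟨mem_dom_of_inSupp hX (h.gMem hy).1 hz, (h.gMem hy).2 z hz⟩
  obtain ⟨k, hk, hks⟩ := hw.exists_height hX hl hB hBX
  refine { toIsTerminationPoint := h, height := ⟨k, hk.codedFun hX.1, fun x _ y hy hxy => ?_⟩,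
           least := fun σ hσ => ?_ }
  · exact hks y hy x (by rw [hBA y hy]; exact hxy)
  obtain ⟨x, hx, hxσ⟩ := h.cofinal σ hσ
  rw [goodstein_le_iff hX hσ (h.gMem hx).1] at hxσ
  have hD : ∀ w ∈ X.dom, Dominates 𝒮 X A w σ ↔
      (Ball σ fun y => Imp (InSupp 𝒮 y σ) (y = w ∨ X.lt y w)) ∧
        (σ = B w ∨ glex 𝒮 X.lt σ (B w)) := by
    intro w hw
    rw [hBA w hw, ← goodstein_le_iff hX hσ (h.gMem hw).1]
    exact and_congr_left fun _ => ⟨fun h y _ hy => h y hy, fun h y hy => h y (lt_of_inSupp hy) hy⟩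
  have hr : Rec 𝒮 (fun w => (Ball σ fun y => Imp (InSupp 𝒮 y σ) (y = w ∨ X.lt y w)) ∧
        (σ = B w ∨ glex 𝒮 X.lt σ (B w))) := by
    have hL := (isLex_glex hlt)
    have h1 : Rec 𝒮 (fun w => glex 𝒮 X.lt σ (B w)) := by
      have := rec_glex hlt
      fun_prop
    have h2 : Rec 𝒮 (fun q : M × M => X.lt q.2 q.1) :=
      hlt.comp (f := fun q : M × M => X.lt q.1 q.2) (g := fun a : M × M => (a.2, a.1))
        (by fun_prop)
    fun_prop
  have hp : Rec 𝒮 (fun w => w ∈ X.dom ∧ (w = x ∨ InSupp 𝒮 w σ)) := by fun_prop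
  have hxb : x < x + σ + 1 := lt_add_one_iff'.2 le_self_add
  -- Cofinality yields x with σ ≤ A_x, but the support of σ need not lie below x. The maximum of x
  -- and this support does dominate σ. All candidates are at most x + σ as numbers.
  obtain ⟨m, -, ⟨hm, -⟩, hmax⟩ := exists_greatest hX hl hp (fun w hw => hw.1) (x + σ + 1)
    ⟨x, hxb, hx, Or.inl rfl⟩
  have hdm : Dominates 𝒮 X A m σ := by
    constructor
    · intro y hy
      exact hmax y ((lt_of_inSupp hy).trans_le (le_add_self.trans le_self_add))
        ⟨mem_dom_of_inSupp hX hσ hy, Or.inr hy⟩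
    · rw [goodstein_le_iff hX hσ (h.gMem hm).1]
      rcases hmax x hxb ⟨hx, Or.inl rfl⟩ with rfl | hxm
      · exact hxσ
      · have := h.mono hx hm hxm
        rcases hxσ with rfl | hxσ
        · exact Or.inr this
        · exact Or.inr (glex_trans hX hl hσ (h.gMem hx).1 (h.gMem hm).1 hxσ this)
  obtain ⟨w, hw, hpw, hmin⟩ := hw.exists_minimum hX hl hr ⟨m, hm, (hD m hm).1 hdm⟩
  exact ⟨w, hw, (hD w hw).2 hpw, fun z hz hz' => hmin z hz ((hD z hz).1 hz')⟩

end WellFounded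

end InvGoodstein

/-- Truth in every model `(M, 𝒮)` of `RCA₀`, i.e. (by completeness) provability in `RCA₀`. -/
theorem proposition5p6 {M : Type*} [CommSemiring M] [LinearOrder M] [IsStrictOrderedRing M]
    [CanonicallyOrderedAdd M] (𝒮 : Set (Set M)) (h𝒮 : InvGoodstein.ModelsRCA0 𝒮) :
    (∀ (X : InvGoodstein.Ord M) (A : M → M), InvGoodstein.IsStrongTerminationPoint 𝒮 X A →
      X.Equimorphic 𝒮 (InvGoodstein.bachmannHoward 𝒮)) ∧
    ((∃ (X : InvGoodstein.Ord M) (A : M → M), InvGoodstein.IsTerminationPoint 𝒮 X A ∧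
      X.WellFounded 𝒮) ↔ (InvGoodstein.bachmannHoward 𝒮).WellFounded 𝒮) := by
  have : InvGoodstein.DiscreteNumbers M := ⟨h𝒮.discrete⟩
  have := Fact.mk h𝒮
  have equimorphic : ∀ (X : InvGoodstein.Ord M) (A : M → M),
      InvGoodstein.IsStrongTerminationPoint 𝒮 X A →
        X.Equimorphic 𝒮 (InvGoodstein.bachmannHoward 𝒮) := fun X A h =>
    ⟨InvGoodstein.embeds_bachmannHoward h.toIsRegularTerminationPoint,
      InvGoodstein.bachmannHoward_embeds_canonical.trans InvGoodstein.bachmannHoward_dom_mem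
        InvGoodstein.canonical_coded.1 (InvGoodstein.canonical_embeds h)⟩
  refine ⟨equimorphic, fun ⟨X, A, h, hw⟩ => ?_, fun hw => ?_⟩
  · exact (equimorphic X A (h.isStrong hw)).2.wellFounded InvGoodstein.bachmannHoward_dom_mem hw
  -- The embedding into the notation system requires regularity only, so it is available for T
  -- without any appeal to strength.
  · exact ⟨InvGoodstein.canonical 𝒮, fun x => x, InvGoodstein.canonical_isTerminationPoint,
      (InvGoodstein.embeds_bachmannHoward InvGoodstein.canonical_isRegular).wellFounded
        InvGoodstein.canonical_coded.1 hw⟩
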